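/- Let $p\ge 1$, $n=2p$, and write points of $\mathbb{R}^{4p}$ as $\underline X=(x_1,y_1,\dots,x_{2p},y_{2p})$, with $z_k=x_k+iy_k$, $z_k^c=x_k-iy_k$, $\partial_{z_k}=\frac12(\partial_{x_k}-i\partial_{y_k})$, $\partial_{z_k^c}=\frac12(\partial_{x_k}+i\partial_{y_k})$. Let $\mathbb{C}_{4p}$ be the complex Clifford algebra with generators $e_1,\dots,e_{4p}$, $e_ie_j+e_je_i=-2\delta_{ij}$, and put $$\mathfrak f_k=-\tfrac12(e_{2k-1}-i\,e_{2k}),\qquad \mathfrak f_k^\dagger=\tfrac12(e_{2k-1}+i\,e_{2k}),\qquad k=1,\dots,2p.$$ Define the vector variables $$\underline z=\sum_{k=1}^{2p} z_k\mathfrak f_k,\quad \underline z^\dagger=\sum_{k=1}^{2p} z_k^c\mathfrak f_k^\dagger,\quad \underline z^J=\sum_{j=1}^p(z_{2j}\mathfrak f_{2j-1}^\dagger-z_{2j-1}\mathfrak f_{2j}^\dagger),\quad \underline z^{\dagger J}=\sum_{j=1}^p(z_{2j}^c\mathfrak f_{2j-1}-z_{2j-1}^c\mathfrak f_{2j}),$$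 the Dirac operators (acting by left multiplication) $$\partial_{\underline z}=\sum_k\mathfrak f_k^\dagger\partial_{z_k},\quad \partial_{\underline z}^\dagger=\sum_k\mathfrak f_k\partial_{z_k^c},\quad \partial_{\underline z}^J=\sum_j(\mathfrak f_{2j-1}\partial_{z_{2j}}-\mathfrak f_{2j}\partial_{z_{2j-1}}),\quad \partial_{\underline z}^{\dagger J}=\sum_j(\mathfrak f_{2j-1}^\dagger\partial_{z_{2j}^c}-\mathfrak f_{2j}^\dagger\partial_{z_{2j-1}^c}),$$ the left multiplication operator $P=\sum_{j=1}^p\mathfrak f_{2j}\mathfrak f_{2j-1}$ and the scalar operator $\mathcal E=\sum_{j=1}^p\left(z_{2j-1}\partial_{z_{2j}^c}-z_{2j}\partial_{z_{2j-1}^c}\right)$. A differentiable function $g$ with values in $\mathbb{C}_{4p}$ (for instance in spinor space, a left ideal of $\mathbb{C}_{4p}$) is $\mathfrak{osp}(4|2)$-monogenic in an open set $\Omega$ if $\partial_{\underline z}g=\partial_{\underline z}^\dagger g=\partial_{\underline z}^Jg=\partial_{\underline z}^{\dagger J}g=Pg=\mathcal E g=0$ in $\Omega$. Let $a_{4p}$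 be the area of the unit sphere of $\mathbb{R}^{4p}$ and $$E(\underline z)=\frac{2}{a_{4p}}\frac{\underline z}{|\underline X|^{4p}},\quad E^\dagger(\underline z)=\frac{2}{a_{4p}}\frac{\underline z^\dagger}{|\underline X|^{4p}},\quad E^J(\underline z)=\frac{2}{a_{4p}}\frac{\underline z^J}{|\underline X|^{4p}},\quad E^{\dagger J}(\underline z)=\frac{2}{a_{4p}}\frac{\underline z^{\dagger J}}{|\underline X|^{4p}}.$$ Let $\widehat{dz_k}$ (resp. $\widehat{dz_k^c}$) be the $(4p-1)$-form obtained from $dz_1\wedge dz_1^c\wedge\dots\wedge dz_{2p}\wedge dz_{2p}^c$ by omitting the factor $dz_k$ (resp. $dz_k^c$), and put $$d\sigma_{\underline z}=\sum_k\mathfrak f_k^\dagger\,\widehat{dz_k},\quad d\sigma_{\underline z^\dagger}=-\sum_k\mathfrak f_k\,\widehat{dz_k^c},\quad d\sigma_{\underline z^J}=\sum_j(\mathfrak f_{2j-1}\widehat{dz_{2j}}-\mathfrak f_{2j}\widehat{dz_{2j-1}}),\quad d\sigma_{\underline z^{\dagger J}}=-\sum_j(\mathfrak f_{2j-1}^\dagger\widehat{dz_{2j}^c}-\mathfrak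 f_{2j}^\dagger\widehat{dz_{2j-1}^c}).$$ Let $D\subset\mathbb{R}^{4p}$ be a bounded domain with smooth boundary $\partial D$, oriented by the outward normal, and let $g$ be $\mathfrak{osp}(4|2)$-monogenic in an open neighbourhood $\Omega$ of $\overline D$. Let $\underline v$ denote the vector variable of the integration point $\underline Y\in\partial D$ and $\underline z$ that of $\underline X$. Then, for every $\underline X\in\overset{\circ}{D}$, the following integrals converge absolutely and $$g(\underline X)=\frac{1}{(-2i)^n}\int_{\partial D}\left(E(\underline v-\underline z)\,d\sigma_{\underline v}+E^\dagger(\underline v-\underline z)\,d\sigma_{\underline v^\dagger}\right)g(\underline Y),$$ $$g(\underline X)=\frac{1}{(-2i)^n}\int_{\partial D}\left(E^J(\underline v-\underline z)\,d\sigma_{\underline v^J}+E^{\dagger J}(\underline v-\underline z)\,d\sigma_{\underline v^{\dagger J}}\right)g(\underline Y),$$ $$0=\int_{\partial D}E^\dagger(\underline v-\underline z)\,d\sigma_{\underline v}\,g(\underline Y),\qquad 0=\int_{\partial D}E^J(\underline v-\underline z)\,d\sigma_{\underline v^{\dagger J}}\,g(\underline Y),$$ $$0=\int_{\partial D}\left(\mathcal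 E E(\underline v-\underline z)\,d\sigma_{\underline v}+\mathcal E E^\dagger(\underline v-\underline z)\,d\sigma_{\underline v^\dagger}\right)g(\underline Y),$$ $$0=\int_{\partial D}\left(\mathcal E E^J(\underline v-\underline z)\,d\sigma_{\underline v^J}+\mathcal E E^{\dagger J}(\underline v-\underline z)\,d\sigma_{\underline v^{\dagger J}}\right)g(\underline Y),$$ where $\mathcal E$ acts on the kernels with respect to the variable $\underline X$. -/

import Mathlib

open scoped MeasureTheory ContDiff Gradient

noncomputable section

namespace OspMonogenic

/-! ### The complex Clifford algebra `ℂ_{4p}` -/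

/-- The complex quadratic form `v ↦ -∑ v_j²` in `4p` variables. -/
def cliffordForm (p : ℕ) : QuadraticForm ℂ (Fin (4 * p) → ℂ) :=
  QuadraticMap.weightedSumSquares ℂ (fun _ : Fin (4 * p) => (-1 : ℂ))

/-- The complex Clifford algebra `ℂ_{4p} = ℂ ⊗ ℝ_{0,4p}`: generators `e_j`, `e_j² = -1`. -/
def Cl (p : ℕ) : Type := CliffordAlgebra (cliffordForm p)

instance (p : ℕ) : Ring (Cl p) := inferInstanceAs (Ring (CliffordAlgebra (cliffordForm p)))

instance (p : ℕ) : Algebra ℂ (Cl p) :=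
  inferInstanceAs (Algebra ℂ (CliffordAlgebra (cliffordForm p)))

theorem finite_exteriorAlgebra (V : Type) [AddCommGroup V] [Module ℂ V] [Module.Finite ℂ V] :
    Module.Finite ℂ (ExteriorAlgebra ℂ V) := by
  have h1 : (⨆ i : ℕ, ⋀[ℂ]^i V) = ⊤ :=
    (DirectSum.Decomposition.isInternal (fun i : ℕ => ⋀[ℂ]^i V)).submodule_iSup_eq_top
  have h2 : (⨆ i ∈ Finset.range (Module.finrank ℂ V + 1), ⋀[ℂ]^i V) = ⊤ := by
    rw [eq_top_iff, ← h1]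
    refine iSup_le fun i => ?_
    by_cases hi : i < Module.finrank ℂ V + 1
    · exact le_iSup₂_of_le i (Finset.mem_range.2 hi) le_rfl
    · have h0 : Module.finrank ℂ (⋀[ℂ]^i V) = 0 := by
        rw [exteriorPower.finrank_eq]
        exact Nat.choose_eq_zero_of_lt (by omega)
      rw [Submodule.finrank_eq_zero.1 h0]
      exact bot_le
  refine Module.finite_def.2 ?_
  rw [← h2]
  exact Submodule.fg_biSup _ _ fun i _ => Module.Finite.iff_fg.1 inferInstance

instance (p : ℕ) : Module.Finite ℂ (Cl p) :=
  haveI : Module.Finite ℂ (ExteriorAlgebra ℂ (Fin (4 * p) → ℂ)) := finite_exteriorAlgebra _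
  haveI : Invertible (2 : ℂ) := invertibleOfNonzero two_ne_zero
  Module.Finite.equiv (CliffordAlgebra.equivExterior (cliffordForm p)).symm

section Norm

attribute [local instance] Matrix.linftyOpNormedRing Matrix.linftyOpNormedAlgebra

/-- A norm on the finite-dimensional algebra `ℂ_{4p}` (an operator norm of left multiplications).
It only serves to make derivatives and integrals available; these do not depend on its choice. -/
instance (p : ℕ) : NormedRing (Cl p) :=
  NormedRing.induced (Cl p) _ (Algebra.leftMulMatrix (Module.finBasis ℂ (Cl p)))
    (Algebra.leftMulMatrix_injective _)

instance (p : ℕ) : NormedAlgebra ℂ (Cl p) :=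
  NormedAlgebra.induced ℂ (Cl p) _ (Algebra.leftMulMatrix (Module.finBasis ℂ (Cl p)))

end Norm

/-! ### Euclidean space `ℝ^{4p}`, indices and coordinates

All indices start at `0`: `(X_0, …, X_{4p-1}) = (x_0, y_0, …, x_{2p-1}, y_{2p-1})`. -/

/-- Euclidean space `ℝ^{4p}`. -/
abbrev Space (p : ℕ) : Type := EuclideanSpace ℝ (Fin (4 * p))

/-- The position of `x_k` among the real coordinates. -/
def xIdx {p : ℕ} (k : Fin (2 * p)) : Fin (4 * p) := ⟨2 * k.1, by omega⟩

/-- The position of `y_k` among the real coordinates. -/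
def yIdx {p : ℕ} (k : Fin (2 * p)) : Fin (4 * p) := ⟨2 * k.1 + 1, by omega⟩

/-- The first complex index of the `j`-th quaternionic pair (`2j-1` when counting from `1`). -/
def fstIdx {p : ℕ} (j : Fin p) : Fin (2 * p) := ⟨2 * j.1, by omega⟩

/-- The second complex index of the `j`-th quaternionic pair (`2j` when counting from `1`). -/
def sndIdx {p : ℕ} (j : Fin p) : Fin (2 * p) := ⟨2 * j.1 + 1, by omega⟩

/-- The real coordinate `X_i`, as a linear form. -/
def coord {p : ℕ} (i : Fin (4 * p)) : Space p →ₗ[ℝ] ℝ := (EuclideanSpace.proj i).toLinearMap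

/-- The complex coordinate `z_k = x_k + i y_k`; being linear, it is also the one-form `dz_k`. -/
def zCoord {p : ℕ} (k : Fin (2 * p)) : Space p →ₗ[ℝ] ℂ :=
  Complex.ofRealCLM.toLinearMap ∘ₗ coord (xIdx k) +
    Complex.I • (Complex.ofRealCLM.toLinearMap ∘ₗ coord (yIdx k))

/-- The conjugate coordinate `z_k^c = x_k - i y_k`, and the one-form `dz_k^c`. -/
def zcCoord {p : ℕ} (k : Fin (2 * p)) : Space p →ₗ[ℝ] ℂ :=
  Complex.ofRealCLM.toLinearMap ∘ₗ coord (xIdx k) -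
    Complex.I • (Complex.ofRealCLM.toLinearMap ∘ₗ coord (yIdx k))

/-! ### Witt basis and vector variables -/

/-- The generators `e_i` of the Clifford algebra. -/
def eGen {p : ℕ} (i : Fin (4 * p)) : Cl p := CliffordAlgebra.ι (cliffordForm p) (Pi.single i 1)

/-- The Witt basis vector `𝔣_k`. -/
def wittF {p : ℕ} (k : Fin (2 * p)) : Cl p :=
  (-(1 / 2) : ℂ) • (eGen (xIdx k) - Complex.I • eGen (yIdx k))

/-- The Witt basis vector `𝔣_k†`. -/
def wittFd {p : ℕ} (k : Fin (2 * p)) : Cl p :=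
  (1 / 2 : ℂ) • (eGen (xIdx k) + Complex.I • eGen (yIdx k))

/-- The hermitian vector variable `z = ∑ z_k 𝔣_k`. -/
def vecZ {p : ℕ} (X : Space p) : Cl p := ∑ k, zCoord k X • wittF k

/-- The hermitian vector variable `z† = ∑ z_k^c 𝔣_k†`. -/
def vecZd {p : ℕ} (X : Space p) : Cl p := ∑ k, zcCoord k X • wittFd k

/-- The rotated vector variable `z^J`. -/
def vecZJ {p : ℕ} (X : Space p) : Cl p :=
  ∑ j : Fin p, (zCoord (sndIdx j) X • wittFd (fstIdx j) - zCoord (fstIdx j) X • wittFd (sndIdx j))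

/-- The rotated vector variable `z^{†J}`. -/
def vecZdJ {p : ℕ} (X : Space p) : Cl p :=
  ∑ j : Fin p, (zcCoord (sndIdx j) X • wittF (fstIdx j) - zcCoord (fstIdx j) X • wittF (sndIdx j))

/-! ### Differential operators -/

/-- The partial derivative with respect to the real coordinate `X_i`. -/
def pd {p : ℕ} (i : Fin (4 * p)) (F : Space p → Cl p) (X : Space p) : Cl p :=
  fderiv ℝ F X (EuclideanSpace.single i 1)

/-- `∂_{z_k} = (∂_{x_k} - i ∂_{y_k}) / 2`. -/
def dzOp {p : ℕ} (k : Fin (2 * p)) (F : Space p → Cl p) (X : Space p) : Cl p :=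
  (1 / 2 : ℂ) • (pd (xIdx k) F X - Complex.I • pd (yIdx k) F X)

/-- `∂_{z_k^c} = (∂_{x_k} + i ∂_{y_k}) / 2`. -/
def dzcOp {p : ℕ} (k : Fin (2 * p)) (F : Space p → Cl p) (X : Space p) : Cl p :=
  (1 / 2 : ℂ) • (pd (xIdx k) F X + Complex.I • pd (yIdx k) F X)

/-- The Dirac operator `∂_z`. -/
def diracZ {p : ℕ} (F : Space p → Cl p) (X : Space p) : Cl p := ∑ k, wittFd k * dzOp k F X

/-- The Dirac operator `∂_z†`. -/
def diracZd {p : ℕ} (F : Space p → Cl p) (X : Space p) : Cl p := ∑ k, wittF k * dzcOp k F X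

/-- The Dirac operator `∂_z^J`. -/
def diracZJ {p : ℕ} (F : Space p → Cl p) (X : Space p) : Cl p :=
  ∑ j : Fin p, (wittF (fstIdx j) * dzOp (sndIdx j) F X - wittF (sndIdx j) * dzOp (fstIdx j) F X)

/-- The Dirac operator `∂_z^{†J}`. -/
def diracZdJ {p : ℕ} (F : Space p → Cl p) (X : Space p) : Cl p :=
  ∑ j : Fin p, (wittFd (fstIdx j) * dzcOp (sndIdx j) F X - wittFd (sndIdx j) * dzcOp (fstIdx j) F X)

/-- The Clifford element `P = 𝔣_2 𝔣_1 + 𝔣_4 𝔣_3 + ⋯ + 𝔣_{2p} 𝔣_{2p-1}` (counting from `1`). -/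
def opP (p : ℕ) : Cl p := ∑ j : Fin p, wittF (sndIdx j) * wittF (fstIdx j)

/-- The Euler-type scalar operator
`𝓔 = ∑ z_{2j-1} ∂_{z_{2j}^c} - z_{2j} ∂_{z_{2j-1}^c}` (counting from `1`). -/
def euler {p : ℕ} (F : Space p → Cl p) (X : Space p) : Cl p :=
  ∑ j : Fin p, (zCoord (fstIdx j) X • dzcOp (sndIdx j) F X - zCoord (sndIdx j) X • dzcOp (fstIdx j) F X)

/-- `osp(4|2)`-monogenic functions in a region `Ω`. The values may be arbitrary in `ℂ_{4p}`; this
covers the functions with values in spinor space, which is a left ideal of `ℂ_{4p}`. -/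
structure IsOspMonogenic {p : ℕ} (g : Space p → Cl p) (Ω : Set (Space p)) : Prop where
  differentiableOn : DifferentiableOn ℝ g Ω
  diracZ_eq_zero : ∀ X ∈ Ω, diracZ g X = 0
  diracZd_eq_zero : ∀ X ∈ Ω, diracZd g X = 0
  diracZJ_eq_zero : ∀ X ∈ Ω, diracZJ g X = 0
  diracZdJ_eq_zero : ∀ X ∈ Ω, diracZdJ g X = 0
  opP_mul_eq_zero : ∀ X ∈ Ω, opP p * g X = 0
  euler_eq_zero : ∀ X ∈ Ω, euler g X = 0

/-! ### Bounded domains with smooth boundary -/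

/-- `ρ` is a smooth defining function of `D` in the neighbourhood `U` of the point `x`. -/
structure IsLocalDefiningFunction {p : ℕ} (D : Set (Space p)) (x : Space p) (U : Set (Space p))
    (ρ : Space p → ℝ) : Prop where
  isOpen : IsOpen U
  mem : x ∈ U
  contDiffOn : ContDiffOn ℝ ∞ ρ U
  gradient_ne_zero : ∇ ρ x ≠ 0
  inter_eq : D ∩ U = {y ∈ U | ρ y < 0}

/-- Bounded domains (open connected sets) of `ℝ^{4p}` with smooth boundary. -/
structure IsSmoothBoundedDomain {p : ℕ} (D : Set (Space p)) : Prop where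
  isOpen : IsOpen D
  isConnected : IsConnected D
  isBounded : Bornology.IsBounded D
  smooth_boundary : ∀ x ∈ frontier D, ∃ U ρ, IsLocalDefiningFunction D x U ρ

/-- `ν` is the outward unit normal of `D` at `x`: the normalized gradient of a local defining
function (which does not depend on the defining function). -/
def IsOutwardUnitNormal {p : ℕ} (D : Set (Space p)) (x ν : Space p) : Prop :=
  ∃ U ρ, IsLocalDefiningFunction D x U ρ ∧ ν = ‖∇ ρ x‖⁻¹ • ∇ ρ x

open Classical in
/-- The outward unit normal of `D` at a boundary point. -/
def outwardNormal {p : ℕ} (D : Set (Space p)) (x : Space p) : Space p :=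
  if h : ∃ ν, IsOutwardUnitNormal D x ν then h.choose else 0

/-! ### Differential forms of degree `4p - 1` and their boundary integrals -/

/-- (Values at a point of) differential forms of degree `4p-1` on `ℝ^{4p}` with values in `V`. -/
abbrev Form (p : ℕ) (V : Type) [AddCommMonoid V] [Module ℝ V] : Type :=
  (Space p) [⋀^Fin (4 * p - 1)]→ₗ[ℝ] V

/-- The increasing enumeration of the indices different from `i`. -/
def omitIdx {p : ℕ} (i : Fin (4 * p)) (a : Fin (4 * p - 1)) : Fin (4 * p) :=
  if a.1 < i.1 then ⟨a.1, by omega⟩ else ⟨a.1 + 1, by omega⟩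

/-- The wedge product `θ_0 ∧ ⋯ ∧ θ_{4p-2}` of complex one-forms:
`(v_0, …, v_{4p-2}) ↦ det (θ_b (v_a))`. -/
def wedge {p : ℕ} (θ : Fin (4 * p - 1) → (Space p →ₗ[ℝ] ℂ)) : Form p ℂ :=
  { toFun := fun v => Matrix.det (Matrix.of fun a b => θ b (v a))
    map_update_add' := by
      intro inst v a x y
      obtain rfl : inst = instDecidableEqFin _ := Subsingleton.elim _ _
      have key : ∀ w : Space p, (Matrix.of fun a' b => θ b (Function.update v a w a')) =
          (Matrix.of fun a' b => θ b (v a')).updateRow a (fun b => θ b w) := by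
        intro w; ext a' b
        by_cases h : a' = a
        · subst h; simp
        · simp [h]
      simp only [key, map_add]
      exact Matrix.det_updateRow_add _ _ _ _
    map_update_smul' := by
      intro inst v a c x
      obtain rfl : inst = instDecidableEqFin _ := Subsingleton.elim _ _
      have key : ∀ w : Space p, (Matrix.of fun a' b => θ b (Function.update v a w a')) =
          (Matrix.of fun a' b => θ b (v a')).updateRow a (fun b => θ b w) := by
        intro w; ext a' b
        by_cases h : a' = a
        · subst h; simp
        · simp [h]
      simp only [key, map_smul]
      exact Matrix.det_updateRow_smul _ _ (c : ℂ) _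
    map_eq_zero_of_eq' := by
      intro v a b hv hab
      exact Matrix.det_zero_of_row_eq hab (by ext c; simp [hv]) }

/-- The complex coframe `dz_0, dz_0^c, dz_1, dz_1^c, …` in this order. -/
def coframe {p : ℕ} (i : Fin (4 * p)) : Space p →ₗ[ℝ] ℂ :=
  if i.1 % 2 = 0 then zCoord ⟨i.1 / 2, by omega⟩ else zcCoord ⟨i.1 / 2, by omega⟩

/-- The form `\widehat{dz_k}`: the wedge product of the coframe with `dz_k` omitted. -/
def hatDz {p : ℕ} (k : Fin (2 * p)) : Form p ℂ := wedge fun a => coframe (omitIdx (xIdx k) a)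

/-- The form `\widehat{dz_k^c}`: the wedge product of the coframe with `dz_k^c` omitted. -/
def hatDzc {p : ℕ} (k : Fin (2 * p)) : Form p ℂ := wedge fun a => coframe (omitIdx (yIdx k) a)

/-- The product `c η` of a Clifford constant `c` and a complex form `η`. -/
def clForm {p : ℕ} (c : Cl p) (η : Form p ℂ) : Form p (Cl p) :=
  (LinearMap.toSpanSingleton ℂ (Cl p) c).restrictScalars ℝ |>.compAlternatingMap η

/-- The form `dσ_z = ∑ 𝔣_k† \widehat{dz_k}`. -/
def dσ {p : ℕ} : Form p (Cl p) := ∑ k, clForm (wittFd k) (hatDz k)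

/-- The form `dσ_{z†} = -∑ 𝔣_k \widehat{dz_k^c}`. -/
def dσd {p : ℕ} : Form p (Cl p) := -∑ k, clForm (wittF k) (hatDzc k)

/-- The form `dσ_{z^J}`. -/
def dσJ {p : ℕ} : Form p (Cl p) :=
  ∑ j : Fin p, (clForm (wittF (fstIdx j)) (hatDz (sndIdx j)) -
    clForm (wittF (sndIdx j)) (hatDz (fstIdx j)))

/-- The form `dσ_{z^{†J}}`. -/
def dσdJ {p : ℕ} : Form p (Cl p) :=
  -∑ j : Fin p, (clForm (wittFd (fstIdx j)) (hatDzc (sndIdx j)) -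
    clForm (wittFd (sndIdx j)) (hatDzc (fstIdx j)))

/-- The product `a η b` of a Clifford-valued form with Clifford numbers on both sides. -/
def mulForm {p : ℕ} (a : Cl p) (η : Form p (Cl p)) (b : Cl p) : Form p (Cl p) :=
  ((LinearMap.mulLeft ℝ a) ∘ₗ (LinearMap.mulRight ℝ b)).compAlternatingMap η

/-- The density of `η` with respect to surface measure on an oriented hypersurface with unit
normal `ν`, i.e. the value of `ν♭ ∧ η` on the standard basis. It equals `η (τ_1, …, τ_{4p-1})` for
every orthonormal basis `τ` of the tangent space such that `(ν, τ_1, …, τ_{4p-1})` is positively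
oriented, which is the boundary orientation when `ν` is the outward normal. -/
def density {p : ℕ} (η : Form p (Cl p)) (ν : Space p) : Cl p :=
  ∑ i : Fin (4 * p), ((-1 : ℝ) ^ i.1 * ν i) • η fun a => EuclideanSpace.single (omitIdx i a) 1

/-- `∫_{∂D} η = c`, the integral being absolutely convergent. The surface measure is the
`(4p-1)`-dimensional Hausdorff measure in its Euclidean normalization. -/
def HasBoundaryIntegral {p : ℕ} (D : Set (Space p)) (η : Space p → Form p (Cl p)) (c : Cl p) :
    Prop :=
  MeasureTheory.IntegrableOn (fun Y => density (η Y) (outwardNormal D Y)) (frontier D)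
      μHE[4 * p - 1] ∧
    ∫ Y in frontier D, density (η Y) (outwardNormal D Y) ∂μHE[4 * p - 1] = c

/-! ### Cauchy kernels -/

/-- The area `a_{4p}` of the unit sphere of `ℝ^{4p}`. -/
def sphereArea (p : ℕ) : ℝ := (μHE[4 * p - 1] (Metric.sphere (0 : Space p) 1)).toReal

/-- The kernel `E(z) = (2 / a_{4p}) z / |z|^{4p}`. -/
def kerE {p : ℕ} (X : Space p) : Cl p := (2 / sphereArea p / ‖X‖ ^ (4 * p)) • vecZ X

/-- The kernel `E†(z) = (2 / a_{4p}) z† / |z|^{4p}`. -/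
def kerEd {p : ℕ} (X : Space p) : Cl p := (2 / sphereArea p / ‖X‖ ^ (4 * p)) • vecZd X

/-- The kernel `E^J(z) = (2 / a_{4p}) z^J / |z|^{4p}`. -/
def kerEJ {p : ℕ} (X : Space p) : Cl p := (2 / sphereArea p / ‖X‖ ^ (4 * p)) • vecZJ X

/-- The kernel `E^{†J}(z) = (2 / a_{4p}) z^{†J} / |z|^{4p}`. -/
def kerEdJ {p : ℕ} (X : Space p) : Cl p := (2 / sphereArea p / ‖X‖ ^ (4 * p)) • vecZdJ X

end OspMonogenic

end

open OspMonogenic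

noncomputable section

namespace OspMonogenic

open MeasureTheory MeasureTheory.Measure Filter Topology Set
open scoped ENNReal NNReal

/-! ### Area formula for injective immersions -/

/-! All six identities come from one abstract Cauchy formula, `IsC2Domain.cauchy_formula`. Let `a
l`, `b l` be real linear maps from `ℝ^m`, `m = 2q`, to an algebra with `∑ a l x * b l x = κ|x|²`,
and let `g` be annihilated by every Dirac operator `∑ b l(e_i) ∂_i`. For `s > 0` the regularized
kernel `a l(y) (|y|² + s)^(-q)` is smooth on the whole space, and the field with components `∑_l a
l(Y-X) (|Y-X|² + s)^(-q) b l(e_i) g(Y)` has divergence `κ m s (|Y-X|² + s)^(-q-1) g(Y)`. The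
divergence theorem turns the boundary integral into the integral of `g` against an approximate
identity, and `s → 0` yields `κ M g(X)` with `M` the mass `kernelMass`. No ball around `X` has to be
removed. The constant function `1` on the unit ball identifies `M` with the area of the sphere
(`kernelMass_eq_sphere`).

The algebra enters as follows. The Witt relations give `z z† + z† z = |X|²`, and rotation by `J`
produces another Witt basis (`IsWittBasis.rotate`), so the pairs `(z, z†)` and `(z^J, z^{†J})` are
treated alike. The Dirac operators with symbols `z†` and `z` are twice `∂_z` and `∂_z†`. The forms
`dσ` have density `(-2i)^n / 2` times these symbols evaluated at the normal, because the minors of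
the complex coframe are read off its adjugate (`sum_density_hat`). This gives the two representation
formulae. The single-term identities are the case `κ = 0`, as `z†` and `z^J` have square zero. The
identities with `𝓔` follow by differentiating the Cauchy formula under the integral: `𝓔` is of first
order, commutes with right multiplication, and annihilates `g`.

The analytic basis is a divergence theorem with Hausdorff surface measure for fields that are only
differentiable with continuous divergence. It passes from boxes to half-spaces, by a shear to
subgraphs, and by a partition of unity to domains. The area formula `map_withDensity_normDet`
identifies the surface measure on graphs. -/

/-- If `f` expands distances on `A` by at most `K` relatively to `g`, then the Hausdorff measure of
`f '' A` is controlled by that of `g '' A`. -/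
theorem euclideanHausdorffMeasure_image_le_of_edist_le {X Y Z : Type*}
    [EMetricSpace Y] [MeasurableSpace Y] [BorelSpace Y]
    [EMetricSpace Z] [MeasurableSpace Z] [BorelSpace Z] {f : X → Y} {g : X → Z} {A : Set X}
    {K : ℝ≥0} (h : ∀ x ∈ A, ∀ y ∈ A, edist (f x) (f y) ≤ K * edist (g x) (g y)) (d : ℕ) :
    μHE[d] (f '' A) ≤ (K : ℝ≥0∞) ^ d * μHE[d] (g '' A) := by
  rcases A.eq_empty_or_nonempty with rfl | ⟨x₀, hx₀⟩
  · simp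
  have : Nonempty X := ⟨x₀⟩
  have hinv : ∀ x ∈ A, Function.invFunOn g A (g x) ∈ A ∧ g (Function.invFunOn g A (g x)) = g x :=
    fun x hx => ⟨Function.invFunOn_mem ⟨x, hx, rfl⟩, Function.invFunOn_eq ⟨x, hx, rfl⟩⟩
  -- `g` need not be injective on `A`: the estimate forces `f` to agree wherever `g` does, so any
  -- choice of preimages gives a Lipschitz map from `g '' A` onto `f '' A`.
  have hL : LipschitzOnWith K (f ∘ Function.invFunOn g A) (g '' A) := by
    rintro _ ⟨x, hx, rfl⟩ _ ⟨y, hy, rfl⟩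
    have := h _ (hinv x hx).1 _ (hinv y hy).1
    rwa [(hinv x hx).2, (hinv y hy).2] at this
  have himg : (f ∘ Function.invFunOn g A) '' (g '' A) = f '' A := by
    rw [image_image]
    refine image_congr fun x hx => ?_
    have := h _ (hinv x hx).1 _ hx
    rw [(hinv x hx).2, edist_self, mul_zero, nonpos_iff_eq_zero, edist_eq_zero] at this
    exact this
  have := hL.hausdorffMeasure_image_le (d := d) (by positivity)
  rw [himg, ENNReal.rpow_natCast] at this
  simp only [euclideanHausdorffMeasure_def, Measure.smul_apply, nnreal_smul_coe_apply]
  calc _ ≤ _ * ((K : ℝ≥0∞) ^ d * μH[d] (g '' A)) := by gcongr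
    _ = _ := mul_left_comm _ _ _

/-- An inequality between measures can be checked locally. -/
theorem measure_le_of_locally_le {X : Type*} [TopologicalSpace X] [SecondCountableTopology X]
    [MeasurableSpace X] [OpensMeasurableSpace X] {μ ν : Measure X}
    (h : ∀ x, ∃ V ∈ 𝓝 x, ∀ A ⊆ V, MeasurableSet A → μ A ≤ ν A) : μ ≤ ν := by
  choose V hV hVle using h
  obtain ⟨s, hs, hsU⟩ := TopologicalSpace.countable_cover_nhds fun x => interior_mem_nhds.2 (hV x)
  rcases s.eq_empty_or_nonempty with rfl | hne
  · have : IsEmpty X := by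
      rw [← univ_eq_empty_iff, ← hsU]; simp
    exact Measure.le_iff.2 fun A _ => by simp [Set.eq_empty_of_isEmpty A]
  obtain ⟨u, rfl⟩ := hs.exists_eq_range hne
  rw [biUnion_range] at hsU
  refine Measure.le_iff.2 fun A hA => ?_
  -- Disjointing a countable subcover cuts `A` into measurable pieces, each inside a single `V`.
  set W : ℕ → Set X := fun k => interior (V (u k)) with hW
  have hWm : ∀ k, MeasurableSet (disjointed W k) := fun k =>
    MeasurableSet.disjointed (fun k => isOpen_interior.measurableSet) k
  have hsplit : ∀ μ : Measure X, μ A = ∑' k, μ (A ∩ disjointed W k) := by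
    intro μ
    rw [← measure_iUnion (fun i j hij => (disjoint_disjointed W hij).mono inter_subset_right
      inter_subset_right) fun k => hA.inter (hWm k), ← inter_iUnion, iUnion_disjointed, hsU,
      inter_univ]
  rw [hsplit μ, hsplit ν]
  exact ENNReal.tsum_le_tsum fun k => hVle (u k) _
    (inter_subset_right.trans ((disjointed_subset W k).trans interior_subset)) (hA.inter (hWm k))

section AreaFormula

variable {U V : Type*} [NormedAddCommGroup U] [InnerProductSpace ℝ U] [FiniteDimensional ℝ U]
  [NormedAddCommGroup V] [InnerProductSpace ℝ V]

/-- The Jacobian is the square root of `det (L* L)`, and both the adjoint and the determinant are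
continuous. -/
theorem continuous_normDet [FiniteDimensional ℝ V] : Continuous fun L : U →L[ℝ] V => L.toLinearMap.normDet := by
  have h : (fun L : U →L[ℝ] V => L.toLinearMap.normDet) =
      fun L : U →L[ℝ] V => √((ContinuousLinearMap.adjoint L ∘L L).det) := by
    funext L
    have := L.normDet_sq
    simp only [RCLike.ofReal_real_eq_id, id_eq] at this
    rw [← this, Real.sqrt_sq (LinearMap.normDet_nonneg _)]
  rw [h]
  refine Real.continuous_sqrt.comp (ContinuousLinearMap.continuous_det.comp ?_)
  exact (ContinuousLinearMap.adjoint (𝕜 := ℝ) (E := U) (F := V)).continuous.clm_comp continuous_id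

/-- Near a point where it is strictly differentiable with injective derivative, a map distorts
distances as its derivative does, up to a factor as close to `1` as we like. -/
theorem eventually_norm_sub_comparable {f : U → V} {L : U →L[ℝ] V} {x₀ : U}
    (hf : HasStrictFDerivAt f L x₀) (hL : Function.Injective L) {K : ℝ} (hK : 1 < K) :
    ∃ N ∈ 𝓝 x₀, ∀ x ∈ N, ∀ y ∈ N,
      ‖f x - f y‖ ≤ K * ‖L x - L y‖ ∧ ‖L x - L y‖ ≤ K * ‖f x - f y‖ := by
  obtain ⟨C, hC, hanti⟩ := L.toLinearMap.exists_antilipschitzWith (LinearMap.ker_eq_bot.2 hL)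
  have hε : 0 < 1 - K⁻¹ := by
    have := inv_lt_one_of_one_lt₀ hK
    linarith
  have hCpos : (0 : ℝ) < C := hC
  -- `L` is bounded below by `1 / C`, so with this constant the error is at most `(1 - K⁻¹)` times
  -- `‖L x - L y‖`. That gives the lower bound directly, and the upper one because `1 - K⁻¹ ≤ K -
  -- 1`.
  have hlittle := hf.isLittleO.def (c := (1 - K⁻¹) / C) (by positivity)
  rw [nhds_prod_eq, Filter.eventually_prod_self_iff'] at hlittle
  obtain ⟨N, hN, hNle⟩ := hlittle
  refine ⟨N, hN, fun x hx y hy => ?_⟩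
  have h1 := hNle x hx y hy
  have h2 : ‖x - y‖ ≤ C * ‖L x - L y‖ := by
    have := hanti.le_mul_dist x y
    simpa [dist_eq_norm] using this
  have h3 : ‖f x - f y - (L x - L y)‖ ≤ (1 - K⁻¹) * ‖L x - L y‖ := by
    rw [← map_sub]
    refine h1.trans ?_
    rw [map_sub]
    calc (1 - K⁻¹) / C * ‖x - y‖ ≤ (1 - K⁻¹) / C * (C * ‖L x - L y‖) := by gcongr
      _ = _ := by field_simp
  have hKpos : 0 < K := by linarith
  have hKK : 1 - K⁻¹ ≤ K - 1 := by
    have : K⁻¹ * K = 1 := inv_mul_cancel₀ hKpos.ne'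
    nlinarith [sq_nonneg (K - 1), inv_pos.2 hKpos]
  constructor
  · have := norm_le_insert' (f x - f y) (L x - L y)
    nlinarith [norm_nonneg (L x - L y)]
  · have h4 := norm_le_insert (f x - f y) (L x - L y)
    have h5 : K⁻¹ * ‖L x - L y‖ ≤ ‖f x - f y‖ := by nlinarith
    calc ‖L x - L y‖ = K * (K⁻¹ * ‖L x - L y‖) := by field_simp
      _ ≤ _ := by gcongr

variable [MeasurableSpace U] [BorelSpace U] [MeasurableSpace V] [BorelSpace V]

/-- **Area formula** for injective immersions of class `C¹`: the push-forward of the Jacobian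
density is the Hausdorff measure on the image. -/
theorem map_withDensity_normDet [FiniteDimensional ℝ V] {f : U → V} (hf : ContDiff ℝ 1 f) (hinj : Function.Injective f)
    (hinj' : ∀ x, Function.Injective (fderiv ℝ f x)) :
    (volume.withDensity fun x => ENNReal.ofReal (fderiv ℝ f x).toLinearMap.normDet).map f =
      μHE[Module.finrank ℝ U].restrict (range f) := by
  set d := Module.finrank ℝ U with hd
  have hemb : MeasurableEmbedding f := hf.continuous.measurableEmbedding hinj
  set J : U → ℝ := fun x => (fderiv ℝ f x).toLinearMap.normDet with hJ
  have hJc : Continuous J := continuous_normDet.comp (hf.continuous_fderiv one_ne_zero)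
  have hJpos : ∀ x, 0 < J x := fun x => lt_of_le_of_ne (LinearMap.normDet_nonneg _)
    (Ne.symm (((LinearMap.normDet_ne_zero_tfae (fderiv ℝ f x).toLinearMap).out 0 4).2 (hinj' x)))
  set μ₂ : Measure U := volume.withDensity fun x => ENNReal.ofReal (J x) with hμ₂
  -- the local comparison
  have key : ∀ K : ℝ, 1 < K → ∀ x₀, ∃ N ∈ 𝓝 x₀, ∀ A ⊆ N, MeasurableSet A →
      μHE[d] (f '' A) ≤ ENNReal.ofReal (K ^ (d + 1)) * μ₂ A ∧
      μ₂ A ≤ ENNReal.ofReal (K ^ (d + 1)) * μHE[d] (f '' A) := by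
    intro K hK x₀
    have hK0 : 0 < K := by linarith
    obtain ⟨N₁, hN₁, hcomp⟩ := eventually_norm_sub_comparable
      (hf.contDiffAt.hasStrictFDerivAt one_ne_zero) (hinj' x₀) hK
    have hJ1 : ∀ᶠ x in 𝓝 x₀, J x₀ < K * J x :=
      (continuous_const.mul hJc).continuousAt.eventually (lt_mem_nhds
        (lt_mul_of_one_lt_left (hJpos x₀) hK))
    have hJ2 : ∀ᶠ x in 𝓝 x₀, J x < K * J x₀ :=
      hJc.continuousAt.eventually (gt_mem_nhds (by have := hJpos x₀; nlinarith))
    refine ⟨N₁ ∩ {x | J x₀ < K * J x ∧ J x < K * J x₀}, inter_mem hN₁ (hJ1.and hJ2),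
      fun A hA hAm => ?_⟩
    set L := fderiv ℝ f x₀ with hL
    have hLA : μHE[d] (L '' A) = ENNReal.ofReal (J x₀) * volume A :=
      LinearMap.euclideanHausdorffMeasure_image_eq_normDet_mul_volume L.toLinearMap A
    have hμA : μ₂ A = ∫⁻ x in A, ENNReal.ofReal (J x) := withDensity_apply _ hAm
    have hle1 : ENNReal.ofReal (J x₀) * volume A ≤ ENNReal.ofReal K * μ₂ A := by
      rw [hμA, ← lintegral_const_mul' _ _ ENNReal.ofReal_ne_top, ← setLIntegral_const]
      refine setLIntegral_mono' hAm fun x hx => ?_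
      rw [← ENNReal.ofReal_mul hK0.le]
      exact ENNReal.ofReal_le_ofReal (hA hx).2.1.le
    have hle2 : μ₂ A ≤ ENNReal.ofReal K * (ENNReal.ofReal (J x₀) * volume A) := by
      rw [hμA, ← mul_assoc, ← ENNReal.ofReal_mul hK0.le, ← setLIntegral_const]
      exact setLIntegral_mono' hAm fun x hx => ENNReal.ofReal_le_ofReal (hA hx).2.2.le
    have hKn : ((K.toNNReal : ℝ≥0) : ℝ≥0∞) = ENNReal.ofReal K := rfl
    have hm1 := euclideanHausdorffMeasure_image_le_of_edist_le (f := f) (g := L) (A := A)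
      (K := K.toNNReal) (fun x hx y hy => by
        rw [hKn, edist_dist, edist_dist, ← ENNReal.ofReal_mul hK0.le, dist_eq_norm, dist_eq_norm]
        exact ENNReal.ofReal_le_ofReal (hcomp x (hA hx).1 y (hA hy).1).1) d
    have hm2 := euclideanHausdorffMeasure_image_le_of_edist_le (f := L) (g := f) (A := A)
      (K := K.toNNReal) (fun x hx y hy => by
        rw [hKn, edist_dist, edist_dist, ← ENNReal.ofReal_mul hK0.le, dist_eq_norm, dist_eq_norm]
        exact ENNReal.ofReal_le_ofReal (hcomp x (hA hx).1 y (hA hy).1).2) d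
    rw [hKn, hLA] at hm1 hm2
    -- Of the `d + 1` factors `K`, `d` come from the distortion of distances and one from the
    -- variation of the Jacobian.
    rw [pow_succ, ENNReal.ofReal_mul (by positivity), ENNReal.ofReal_pow hK0.le]
    constructor
    · calc μHE[d] (f '' A) ≤ _ := hm1
        _ ≤ ENNReal.ofReal K ^ d * (ENNReal.ofReal K * μ₂ A) := by gcongr
        _ = _ := by rw [mul_assoc]
    · calc μ₂ A ≤ _ := hle2
        _ ≤ ENNReal.ofReal K * (ENNReal.ofReal K ^ d * μHE[d] (f '' A)) := by gcongr
        _ = _ := by ring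
  have hcomap : ∀ A, μHE[d].comap f A = μHE[d] (f '' A) := fun A => hemb.comap_apply _ A
  -- pass to the limit `K → 1`
  have hlim : ∀ a b : ℝ≥0∞, (∀ K : ℝ, 1 < K → a ≤ ENNReal.ofReal (K ^ (d + 1)) * b) → a ≤ b := by
    intro a b hab
    have ht : Tendsto (fun K : ℝ => ENNReal.ofReal (K ^ (d + 1)) * b) (𝓝[>] 1) (𝓝 (1 * b)) := by
      refine ENNReal.Tendsto.mul_const ?_ (Or.inl one_ne_zero)
      have : Tendsto (fun K : ℝ => K ^ (d + 1)) (𝓝[>] 1) (𝓝 1) := by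
        have := (continuous_pow (M := ℝ) (d + 1)).tendsto 1
        rw [one_pow] at this
        exact this.mono_left nhdsWithin_le_nhds
      simpa using ENNReal.tendsto_ofReal this
    rw [one_mul] at ht
    exact ge_of_tendsto ht (eventually_mem_nhdsWithin.mono hab)
  have hEq : μ₂ = μHE[d].comap f := by
    refine le_antisymm ?_ ?_
    · refine Measure.le_iff.2 fun A _ => hlim _ _ fun K hK => ?_
      have : μ₂ ≤ ENNReal.ofReal (K ^ (d + 1)) • μHE[d].comap f :=
        measure_le_of_locally_le fun x => by
          obtain ⟨N, hN, hle⟩ := key K hK x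
          refine ⟨N, hN, fun A hA hAm => ?_⟩
          rw [Measure.smul_apply, hcomap, smul_eq_mul]
          exact (hle A hA hAm).2
      exact this A
    · refine Measure.le_iff.2 fun A _ => hlim _ _ fun K hK => ?_
      have : μHE[d].comap f ≤ ENNReal.ofReal (K ^ (d + 1)) • μ₂ :=
        measure_le_of_locally_le fun x => by
          obtain ⟨N, hN, hle⟩ := key K hK x
          refine ⟨N, hN, fun A hA hAm => ?_⟩
          rw [Measure.smul_apply, hcomap, smul_eq_mul]
          exact (hle A hA hAm).1
      exact this A
  rw [hEq, hemb.map_comap]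

end AreaFormula

end OspMonogenic
end

noncomputable section

namespace OspMonogenic

open MeasureTheory MeasureTheory.Measure Filter Topology Set
open scoped ENNReal NNReal

/-! ### The divergence theorem for half-spaces and for subgraphs -/

section Subgraph

variable {n : ℕ} {V : Type*} [NormedAddCommGroup V] [NormedSpace ℝ V]

/-- The divergence theorem for compactly supported fields on the half-space `{x | x i ≤ c}`, in
coordinates. -/
theorem integral_divergence_halfSpace_pi (i : Fin (n + 1)) (c : ℝ)
    {f : Fin (n + 1) → (Fin (n + 1) → ℝ) → V} (hf : ∀ j, Differentiable ℝ (f j))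
    (hs : ∀ j, HasCompactSupport (f j))
    (hdiv : Continuous fun x => ∑ j, fderiv ℝ (f j) x (Pi.single j 1)) :
    ∫ x in {x | x i ≤ c}, ∑ j, fderiv ℝ (f j) x (Pi.single j 1) =
      ∫ y : Fin n → ℝ, f i (i.insertNth c y) := by
  obtain ⟨R₀, hR₀⟩ : ∃ R₀, ∀ j, tsupport (f j) ⊆ Metric.closedBall 0 R₀ := by
    choose R hR using fun j => (hs j).isCompact.isBounded.subset_closedBall (0 : Fin (n + 1) → ℝ)
    exact ⟨∑ j, |R j|, fun j => (hR j).trans (Metric.closedBall_subset_closedBall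
      ((le_abs_self _).trans (Finset.single_le_sum (fun k _ => abs_nonneg (R k))
        (Finset.mem_univ j))))⟩
  set R : ℝ := |R₀| + |c| + 1 with hR
  have hR0 : |R₀| < R := by have := abs_nonneg c; linarith
  have hRc : |c| < R := by have := abs_nonneg R₀; linarith
  have hRpos : 0 < R := (abs_nonneg _).trans_lt hR0
  have hmem : ∀ j x, x ∈ tsupport (f j) → ∀ k, |x k| < R := fun j x hx k => by
    have h1 : ‖x‖ ≤ R₀ := by simpa using hR₀ j hx
    exact (norm_le_pi_norm x k).trans_lt (h1.trans_lt ((le_abs_self _).trans_lt hR0))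
  have hzero : ∀ j x, (∃ k, R ≤ |x k|) → f j x = 0 := fun j x ⟨k, hk⟩ =>
    image_eq_zero_of_notMem_tsupport fun hx => (hmem j x hx k).not_ge hk
  set a : Fin (n + 1) → ℝ := fun _ => -R with ha
  -- The box has one face on `{x | x i = c}`; all its other faces lie outside the supports.
  set b : Fin (n + 1) → ℝ := Function.update (fun _ => R) i c with hb
  have hbi : b i = c := by simp [hb]
  have hbj : ∀ j, j ≠ i → b j = R := fun j hj => by simp [hb, hj]
  have hbR : ∀ j, b j ≤ R := fun j => by
    by_cases h : j = i
    · subst h; rw [hbi]; exact (le_abs_self c).trans hRc.le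
    · rw [hbj j h]
  have hle : a ≤ b := fun j => by
    by_cases h : j = i
    · subst h; rw [hbi]; exact (abs_lt.1 hRc).1.le
    · rw [hbj j h]; simp only [ha]; linarith
  -- This version needs differentiability and an integrable divergence only, not continuous partial
  -- derivatives. It is what later allows `g` to be merely differentiable.
  have key := integral_divergence_of_hasFDerivAt_off_countable' a b hle f
    (fun j x => fderiv ℝ (f j) x) ∅ countable_empty (fun j => (hf j).continuous.continuousOn)
    (fun x _ j => (hf j x).hasFDerivAt) (hdiv.continuousOn.integrableOn_compact isCompact_Icc)
  have hL : ∫ x in {x : Fin (n + 1) → ℝ | x i ≤ c}, ∑ j, fderiv ℝ (f j) x (Pi.single j 1) =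
      ∫ x in Icc a b, ∑ j, fderiv ℝ (f j) x (Pi.single j 1) := by
    refine setIntegral_eq_of_subset_of_forall_sdiff_eq_zero
      (measurableSet_le (measurable_pi_apply i) measurable_const) ?_ ?_
    · intro x hx
      have := hx.2 i
      rwa [hbi] at this
    · rintro x ⟨hxi, hx⟩
      refine Finset.sum_eq_zero fun j _ => ?_
      have : x ∉ tsupport (f j) := fun hxs => hx
        ⟨fun k => (abs_lt.1 (hmem j x hxs k)).1.le, fun k => by
          by_cases h : k = i
          · subst h; rw [hbi]; exact hxi
          · rw [hbj k h]; exact (abs_lt.1 (hmem j x hxs k)).2.le⟩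
      have h0 : fderiv ℝ (f j) x = 0 := by
        by_contra h0
        exact this (support_fderiv_subset ℝ h0)
      simp [h0]
  have hback : ∀ j (y : Fin n → ℝ), f j (j.insertNth (a j) y) = 0 := fun j y =>
    hzero j _ ⟨j, by simp [ha, abs_of_pos hRpos]⟩
  have hfront : ∀ j, j ≠ i → ∀ y : Fin n → ℝ, f j (j.insertNth (b j) y) = 0 := fun j hj y =>
    hzero j _ ⟨j, by simp [hbj j hj, abs_of_pos hRpos]⟩
  rw [hL, key, Finset.sum_eq_single i]
  · simp only [hback, integral_zero, sub_zero, hbi]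
    refine setIntegral_eq_integral_of_forall_compl_eq_zero fun y hy => hzero i _ ?_
    by_contra! hlt
    refine hy ⟨fun k => ?_, fun k => ?_⟩
    · have := hlt (i.succAbove k)
      simp only [Fin.insertNth_apply_succAbove] at this
      exact (abs_lt.1 this).1.le
    · have := hlt (i.succAbove k)
      simp only [Fin.insertNth_apply_succAbove] at this
      simp only [Function.comp, hbj _ (Fin.succAbove_ne i k)]
      exact (abs_lt.1 this).2.le
  · intro j _ hj
    simp only [hback, hfront j hj, integral_zero, sub_zero]
  · simp

/-- The divergence of a field, given by its components. -/
def divergence {m : ℕ} (F : Fin m → EuclideanSpace ℝ (Fin m) → V)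
    (x : EuclideanSpace ℝ (Fin m)) : V :=
  ∑ j, fderiv ℝ (F j) x (EuclideanSpace.single j 1)

/-- The isometric embedding of `ℝⁿ` onto the coordinate hyperplane `{x | x i = 0}` of `ℝⁿ⁺¹`. -/
def hyperplaneEmb (i : Fin (n + 1)) :
    EuclideanSpace ℝ (Fin n) →ₗᵢ[ℝ] EuclideanSpace ℝ (Fin (n + 1)) where
  toFun y := WithLp.toLp 2 (i.insertNth (0 : ℝ) y.ofLp)
  map_add' x y := by
    ext k
    refine Fin.succAboveCases i ?_ (fun k => ?_) k <;> simp
  map_smul' c y := by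
    ext k
    refine Fin.succAboveCases i ?_ (fun k => ?_) k <;> simp
  norm_map' y := by
    simp [EuclideanSpace.norm_eq, Fin.sum_univ_succAbove _ i]

/-- The projection of `ℝⁿ⁺¹` to `ℝⁿ` forgetting the `i`-th coordinate. -/
def dropCoord (i : Fin (n + 1)) :
    EuclideanSpace ℝ (Fin (n + 1)) →L[ℝ] EuclideanSpace ℝ (Fin n) :=
  LinearMap.toContinuousLinearMap
    { toFun := fun x => WithLp.toLp 2 fun k => x (i.succAbove k)
      map_add' := fun _ _ => rfl
      map_smul' := fun _ _ => rfl }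

@[simp]
theorem hyperplaneEmb_apply_self (i : Fin (n + 1)) (y : EuclideanSpace ℝ (Fin n)) :
    hyperplaneEmb i y i = 0 := by
  simp [hyperplaneEmb]

@[simp]
theorem hyperplaneEmb_apply_succAbove (i : Fin (n + 1)) (y : EuclideanSpace ℝ (Fin n))
    (k : Fin n) : hyperplaneEmb i y (i.succAbove k) = y k := by
  simp [hyperplaneEmb]

@[simp]
theorem dropCoord_apply (i : Fin (n + 1)) (x : EuclideanSpace ℝ (Fin (n + 1))) (k : Fin n) :
    dropCoord i x k = x (i.succAbove k) := rfl

@[simp]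
theorem dropCoord_hyperplaneEmb (i : Fin (n + 1)) (y : EuclideanSpace ℝ (Fin n)) :
    dropCoord i (hyperplaneEmb i y) = y := by
  ext k; simp

@[simp]
theorem dropCoord_single_self (i : Fin (n + 1)) (c : ℝ) :
    dropCoord i (EuclideanSpace.single i c) = 0 := by
  ext k; simp [Fin.succAbove_ne]

@[simp]
theorem dropCoord_single_succAbove (i : Fin (n + 1)) (k : Fin n) (c : ℝ) :
    dropCoord i (EuclideanSpace.single (i.succAbove k) c) = EuclideanSpace.single k c := by
  ext l; simp

theorem hyperplaneEmb_single (i : Fin (n + 1)) (k : Fin n) (c : ℝ) :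
    hyperplaneEmb i (EuclideanSpace.single k c) = EuclideanSpace.single (i.succAbove k) c := by
  ext l
  refine Fin.succAboveCases i ?_ (fun l => ?_) l
  · simp
  · simp

theorem hyperplaneEmb_dropCoord (i : Fin (n + 1)) (x : EuclideanSpace ℝ (Fin (n + 1))) :
    hyperplaneEmb i (dropCoord i x) + x i • EuclideanSpace.single i (1 : ℝ) = x := by
  ext l
  refine Fin.succAboveCases i ?_ (fun l => ?_) l
  · simp
  · simp [Fin.succAbove_ne]

/-- The divergence theorem for compactly supported fields on the half-space `{x | x i ≤ c}`. -/
theorem integral_divergence_halfSpace (i : Fin (n + 1)) (c : ℝ)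
    {f : Fin (n + 1) → EuclideanSpace ℝ (Fin (n + 1)) → V} (hf : ∀ j, Differentiable ℝ (f j))
    (hs : ∀ j, HasCompactSupport (f j)) (hdiv : Continuous (divergence f)) :
    ∫ x in {x | x i ≤ c}, divergence f x =
      ∫ y, f i (hyperplaneEmb i y + c • EuclideanSpace.single i 1) := by
  set e : (Fin (n + 1) → ℝ) ≃L[ℝ] EuclideanSpace ℝ (Fin (n + 1)) :=
    (EuclideanSpace.equiv (Fin (n + 1)) ℝ).symm with he
  have hfd : ∀ j x, fderiv ℝ (f j ∘ e) x (Pi.single j 1) =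
      fderiv ℝ (f j) (e x) (EuclideanSpace.single j 1) := fun j x => by
    rw [e.comp_right_fderiv]
    rfl
  have hdiv' : (fun x => ∑ j, fderiv ℝ (f j ∘ e) x (Pi.single j 1)) = divergence f ∘ e := by
    funext x
    simp only [hfd]
    rfl
  have key := integral_divergence_halfSpace_pi i c (f := fun j => f j ∘ e)
    (fun j => (hf j).comp e.differentiable)
    (fun j => (hs j).comp_homeomorph e.toHomeomorph) (by
      rw [hdiv']; exact hdiv.comp e.continuous)
  have hpres : MeasurePreserving e := PiLp.volume_preserving_toLp _
  have hpres' : MeasurePreserving (WithLp.toLp 2 : (Fin n → ℝ) → EuclideanSpace ℝ (Fin n)) :=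
    PiLp.volume_preserving_toLp _
  rw [hdiv'] at key
  rw [← hpres.setIntegral_preimage_emb e.toHomeomorph.measurableEmbedding,
    ← hpres'.integral_comp (MeasurableEquiv.toLp 2 (Fin n → ℝ)).measurableEmbedding]
  refine Eq.trans ?_ (key.trans ?_)
  · rfl
  · refine integral_congr_ae (Eventually.of_forall fun y => ?_)
    simp only [Function.comp]
    congr 1
    ext l
    refine Fin.succAboveCases i ?_ (fun l => ?_) l
    · simp [he]
    · simp [he, Fin.succAbove_ne]

/-- The integral of the divergence of a compactly supported field vanishes. -/
theorem integral_divergence_eq_zero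
    {f : Fin (n + 1) → EuclideanSpace ℝ (Fin (n + 1)) → V} (hf : ∀ j, Differentiable ℝ (f j))
    (hs : ∀ j, HasCompactSupport (f j)) (hdiv : Continuous (divergence f)) :
    ∫ x, divergence f x = 0 := by
  obtain ⟨R₀, hR₀⟩ : ∃ R₀, ∀ j, tsupport (f j) ⊆ Metric.closedBall 0 R₀ := by
    choose R hR using fun j =>
      (hs j).isCompact.isBounded.subset_closedBall (0 : EuclideanSpace ℝ (Fin (n + 1)))
    exact ⟨∑ j, |R j|, fun j => (hR j).trans (Metric.closedBall_subset_closedBall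
      ((le_abs_self _).trans (Finset.single_le_sum (fun k _ => abs_nonneg (R k))
        (Finset.mem_univ j))))⟩
  have hmem : ∀ j x, x ∈ tsupport (f j) → x 0 ≤ R₀ := fun j x hx =>
    (le_abs_self _).trans ((PiLp.norm_apply_le x 0).trans (by simpa using hR₀ j hx))
  -- The bounding hyperplane lies beyond the supports, so the half-space sees the whole integral and
  -- its boundary term vanishes.
  have key := integral_divergence_halfSpace 0 (R₀ + 1) hf hs hdiv
  rw [setIntegral_eq_integral_of_forall_compl_eq_zero] at key
  · rw [key]
    refine integral_eq_zero_of_ae (Eventually.of_forall fun y => ?_)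
    refine image_eq_zero_of_notMem_tsupport fun hx => ?_
    have := hmem _ _ hx
    simp at this
    linarith
  · intro x hx
    refine Finset.sum_eq_zero fun j _ => ?_
    have h0 : fderiv ℝ (f j) x = 0 := by
      by_contra h0
      refine hx ?_
      have := hmem j x (support_fderiv_subset ℝ h0)
      simp only [mem_ofPred_eq]
      linarith
    simp [h0]

/-! ### From half-spaces to subgraphs -/

/-- The shear `x ↦ x + γ(x') e_i`, where `x'` consists of the coordinates other than `x_i`. -/
def shear (i : Fin (n + 1)) {γ : EuclideanSpace ℝ (Fin n) → ℝ} (hγ : Continuous γ) :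
    EuclideanSpace ℝ (Fin (n + 1)) ≃ₜ EuclideanSpace ℝ (Fin (n + 1)) where
  toFun x := x + γ (dropCoord i x) • EuclideanSpace.single i (1 : ℝ)
  invFun x := x - γ (dropCoord i x) • EuclideanSpace.single i (1 : ℝ)
  left_inv x := by simp
  right_inv x := by simp
  continuous_toFun := by fun_prop
  continuous_invFun := by fun_prop

/-- On each line parallel to `e_i` the shear is a translation, so Fubini applies in the form of a
skew product. -/
theorem measurePreserving_shear (i : Fin (n + 1)) {γ : EuclideanSpace ℝ (Fin n) → ℝ}
    (hγ : Continuous γ) : MeasurePreserving (shear i hγ) := by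
  set γ' : (Fin n → ℝ) → ℝ := fun y => γ (WithLp.toLp 2 y) with hγ'
  have hγ'c : Continuous γ' := hγ.comp (PiLp.continuous_toLp 2 _)
  have h1 : MeasurePreserving (fun q : (Fin n → ℝ) × ℝ => (q.1, q.2 + γ' q.1))
      (volume.prod volume) (volume.prod volume) :=
    (MeasurePreserving.id volume).skew_product (g := fun y t => t + γ' y)
      (by unfold Function.uncurry; fun_prop)
      (Eventually.of_forall fun y => map_add_right_eq_self volume (γ' y))
  have h2 : MeasurePreserving (fun q : ℝ × (Fin n → ℝ) => (q.1 + γ' q.2, q.2))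
      (volume.prod volume) (volume.prod volume) :=
    (measurePreserving_swap.comp h1).comp measurePreserving_swap
  have he := volume_preserving_piFinSuccAbove (fun _ : Fin (n + 1) => ℝ) i
  have h3 := (he.symm.comp h2).comp he
  have h4 := ((PiLp.volume_preserving_toLp (Fin (n + 1))).comp h3).comp
    (PiLp.volume_preserving_ofLp (Fin (n + 1)))
  convert h4 using 1
  funext x
  ext l
  refine Fin.succAboveCases i ?_ (fun l => ?_) l
  · simp [shear, MeasurableEquiv.piFinSuccAbove, Fin.insertNthEquiv, γ']
    rfl
  · simp [shear, MeasurableEquiv.piFinSuccAbove, Fin.insertNthEquiv, γ']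

/-- The parametrization of the graph `{x | x i = γ(x')}`. -/
def graphMap (i : Fin (n + 1)) (γ : EuclideanSpace ℝ (Fin n) → ℝ) (y : EuclideanSpace ℝ (Fin n)) :
    EuclideanSpace ℝ (Fin (n + 1)) :=
  hyperplaneEmb i y + γ y • EuclideanSpace.single i 1

/-- The flux density of a field through a graph. -/
def graphFlux (i : Fin (n + 1)) (γ : EuclideanSpace ℝ (Fin n) → ℝ)
    (F : Fin (n + 1) → EuclideanSpace ℝ (Fin (n + 1)) → V) (y : EuclideanSpace ℝ (Fin n)) : V :=
  F i (graphMap i γ y) - ∑ k, fderiv ℝ γ y (EuclideanSpace.single k 1) •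
    F (i.succAbove k) (graphMap i γ y)

/-- The divergence theorem for compactly supported fields on a subgraph. -/
theorem integral_divergence_subgraph_le (i : Fin (n + 1)) {γ : EuclideanSpace ℝ (Fin n) → ℝ}
    (hγ : ContDiff ℝ 2 γ) {F : Fin (n + 1) → EuclideanSpace ℝ (Fin (n + 1)) → V}
    (hF : ∀ j, Differentiable ℝ (F j)) (hs : ∀ j, HasCompactSupport (F j))
    (hdiv : Continuous (divergence F)) :
    ∫ x in {x | x i ≤ γ (dropCoord i x)}, divergence F x = ∫ y, graphFlux i γ F y := by
  have hγc := hγ.continuous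
  set Φ := shear i hγc with hΦ
  set dγ : Fin n → EuclideanSpace ℝ (Fin n) → ℝ :=
    fun k y => fderiv ℝ γ y (EuclideanSpace.single k 1) with hdγ
  have hdγd : ∀ k, Differentiable ℝ (dγ k) := fun k =>
    ((hγ.fderiv_right (m := 1) (by norm_num)).differentiable one_ne_zero).clm_apply
      (differentiable_const _)
  -- This is the Piola transform of `F` under the shear, which has Jacobian one: `div f = (div F) ∘
  -- Φ`. The derivatives of `γ` enter only the `i`-th component, which is differentiated along
  -- `e_i`, where they are constant. Differentiability of `f` is what requires `γ` to be `C²`.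
  set f : Fin (n + 1) → EuclideanSpace ℝ (Fin (n + 1)) → V :=
    i.insertNth (α := fun _ => EuclideanSpace ℝ (Fin (n + 1)) → V)
      (fun x => F i (Φ x) - ∑ k, dγ k (dropCoord i x) • F (i.succAbove k) (Φ x))
      (fun k x => F (i.succAbove k) (Φ x)) with hf
  have hfi : f i = fun x => F i (Φ x) - ∑ k, dγ k (dropCoord i x) • F (i.succAbove k) (Φ x) := by
    simp [hf]
  have hfk : ∀ k, f (i.succAbove k) = fun x => F (i.succAbove k) (Φ x) := fun k => by simp [hf]
  have hΦ' : ∀ x, HasFDerivAt Φ (ContinuousLinearMap.id ℝ _ +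
      ((fderiv ℝ γ (dropCoord i x)).comp (dropCoord i)).smulRight
        (EuclideanSpace.single i (1 : ℝ))) x := fun x => by
    have h1 : HasFDerivAt (fun x => γ (dropCoord i x))
        ((fderiv ℝ γ (dropCoord i x)).comp (dropCoord i)) x :=
      ((hγ.differentiable two_ne_zero (dropCoord i x)).hasFDerivAt).comp x
        (dropCoord i).hasFDerivAt
    exact (hasFDerivAt_id x).add (h1.smul_const _)
  have hFΦ : ∀ j x, HasFDerivAt (fun x => F j (Φ x)) ((fderiv ℝ (F j) (Φ x)).comp
      (ContinuousLinearMap.id ℝ _ + ((fderiv ℝ γ (dropCoord i x)).comp (dropCoord i)).smulRight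
        (EuclideanSpace.single i (1 : ℝ)))) x := fun j x =>
    ((hF j (Φ x)).hasFDerivAt).comp x (hΦ' x)
  have hdk : ∀ k x, HasFDerivAt (fun x => dγ k (dropCoord i x))
      ((fderiv ℝ (dγ k) (dropCoord i x)).comp (dropCoord i)) x := fun k x =>
    ((hdγd k (dropCoord i x)).hasFDerivAt).comp x (dropCoord i).hasFDerivAt
  have hfi' : ∀ x, HasFDerivAt (f i) _ x := fun x => by
    rw [hfi]
    exact (hFΦ i x).sub (HasFDerivAt.fun_sum fun k _ => (hdk k x).smul (hFΦ (i.succAbove k) x))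
  have hfdiff : ∀ j, Differentiable ℝ (f j) := fun j => by
    refine Fin.succAboveCases i ?_ (fun k => ?_) j
    · exact fun x => (hfi' x).differentiableAt
    · rw [hfk]
      exact fun x => (hFΦ _ x).differentiableAt
  have hdivf : divergence f = divergence F ∘ Φ := by
    funext x
    simp only [divergence, Function.comp, Fin.sum_univ_succAbove _ i, hfk]
    rw [(hfi' x).fderiv]
    simp only [(hFΦ _ x).fderiv]
    simp [Finset.sum_add_distrib, hdγ]
  have hsΦ : ∀ j, HasCompactSupport (fun x => F j (Φ x)) := fun j => (hs j).comp_homeomorph Φ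
  have hfs : ∀ j, HasCompactSupport (f j) := fun j => by
    refine Fin.succAboveCases i ?_ (fun k => ?_) j
    · rw [hfi]
      refine HasCompactSupport.intro (isCompact_iUnion fun j => hsΦ j) fun x hx => ?_
      simp only [mem_iUnion, not_exists] at hx
      have h0 : ∀ j, F j (Φ x) = 0 := fun j => 
        image_eq_zero_of_notMem_tsupport (f := fun x => F j (Φ x)) (hx j)
      simp [h0]
    · rw [hfk]
      exact hsΦ _
  have key := integral_divergence_halfSpace i 0 hfdiff hfs (by
    rw [hdivf]; exact hdiv.comp Φ.continuous)
  rw [← (measurePreserving_shear i hγc).setIntegral_preimage_emb Φ.measurableEmbedding]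
  rw [hdivf] at key
  refine Eq.trans ?_ (key.trans ?_)
  · congr 2
    ext x
    simp [shear]
  · refine integral_congr_ae (Eventually.of_forall fun y => ?_)
    simp [hfi, hΦ, shear, graphFlux, graphMap, hdγ]

/-- The shear carries a coordinate hyperplane to the graph. -/
theorem volume_graph_eq_zero (i : Fin (n + 1)) {γ : EuclideanSpace ℝ (Fin n) → ℝ}
    (hγ : Continuous γ) :
    volume {x : EuclideanSpace ℝ (Fin (n + 1)) | x i = γ (dropCoord i x)} = 0 := by
  rw [← (measurePreserving_shear i hγ).measure_preimage_emb (shear i hγ).measurableEmbedding,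
    ← (PiLp.volume_preserving_toLp (Fin (n + 1))).measure_preimage_emb
      (MeasurableEquiv.toLp 2 (Fin (n + 1) → ℝ)).measurableEmbedding]
  have hset : (WithLp.toLp 2 ⁻¹' (shear i hγ ⁻¹' {x | x.ofLp i = γ (dropCoord i x)}) :
      Set (Fin (n + 1) → ℝ)) = {f | f i = 0} := by
    ext x
    simp [shear]
  rw [hset]
  exact Measure.pi_hyperplane (fun _ : Fin (n + 1) => (volume : Measure ℝ)) i 0

theorem measurableSet_subgraph (i : Fin (n + 1)) {γ : EuclideanSpace ℝ (Fin n) → ℝ}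
    (hγ : Continuous γ) :
    MeasurableSet {x : EuclideanSpace ℝ (Fin (n + 1)) | x i ≤ γ (dropCoord i x)} :=
  (isClosed_le (by fun_prop) (by fun_prop)).measurableSet

theorem hasCompactSupport_divergence {m : ℕ} {F : Fin m → EuclideanSpace ℝ (Fin m) → V}
    (hs : ∀ j, HasCompactSupport (F j)) : HasCompactSupport (divergence F) := by
  refine HasCompactSupport.intro (isCompact_iUnion fun j => hs j) fun x hx => ?_
  simp only [mem_iUnion, not_exists] at hx
  refine Finset.sum_eq_zero fun j _ => ?_
  have h0 : fderiv ℝ (F j) x = 0 := by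
    by_contra h0
    exact hx j (support_fderiv_subset ℝ h0)
  simp [h0]

theorem integral_divergence_subgraph_lt (i : Fin (n + 1)) {γ : EuclideanSpace ℝ (Fin n) → ℝ}
    (hγ : ContDiff ℝ 2 γ) {F : Fin (n + 1) → EuclideanSpace ℝ (Fin (n + 1)) → V}
    (hF : ∀ j, Differentiable ℝ (F j)) (hs : ∀ j, HasCompactSupport (F j))
    (hdiv : Continuous (divergence F)) :
    ∫ x in {x | x i < γ (dropCoord i x)}, divergence F x = ∫ y, graphFlux i γ F y := by
  rw [← integral_divergence_subgraph_le i hγ hF hs hdiv]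
  refine setIntegral_congr_set (eventuallyEq_set.2 ?_)
  filter_upwards [measure_eq_zero_iff_ae_notMem.1 (volume_graph_eq_zero i hγ.continuous)] with x hx
  exact ⟨fun h => le_of_lt h, fun h => lt_of_le_of_ne h hx⟩

/-- The total integral of the divergence is zero, so the complement of the closed subgraph
contributes the opposite value. -/
theorem integral_divergence_supergraph_lt (i : Fin (n + 1)) {γ : EuclideanSpace ℝ (Fin n) → ℝ}
    (hγ : ContDiff ℝ 2 γ) {F : Fin (n + 1) → EuclideanSpace ℝ (Fin (n + 1)) → V}
    (hF : ∀ j, Differentiable ℝ (F j)) (hs : ∀ j, HasCompactSupport (F j))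
    (hdiv : Continuous (divergence F)) :
    ∫ x in {x | γ (dropCoord i x) < x i}, divergence F x = -∫ y, graphFlux i γ F y := by
  have h := integral_add_compl (measurableSet_subgraph i hγ.continuous)
    (hdiv.integrable_of_hasCompactSupport (μ := volume) (hasCompactSupport_divergence hs))
  rw [integral_divergence_eq_zero hF hs hdiv,
    integral_divergence_subgraph_le i hγ hF hs hdiv] at h
  have hc : {x : EuclideanSpace ℝ (Fin (n + 1)) | x i ≤ γ (dropCoord i x)}ᶜ =
      {x | γ (dropCoord i x) < x i} := by
    ext x; simp
  rw [← hc]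
  exact eq_neg_of_add_eq_zero_right h

/-! ### Surface measure on graphs -/

/-- The Jacobian of the parametrization of a graph. -/
theorem normDet_graph (i : Fin (n + 1)) (a : EuclideanSpace ℝ (Fin n) →L[ℝ] ℝ) :
    ((hyperplaneEmb i).toContinuousLinearMap +
      a.smulRight (EuclideanSpace.single i (1 : ℝ))).toLinearMap.normDet =
      √(1 + ∑ k, a (EuclideanSpace.single k 1) ^ 2) := by
  set L := (hyperplaneEmb i).toContinuousLinearMap +
    a.smulRight (EuclideanSpace.single i (1 : ℝ)) with hL
  have h := L.toLinearMap.normDet_sq_eq_det_gram (EuclideanSpace.basisFun (Fin n) ℝ)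
  set u : Fin n → ℝ := fun k => a (EuclideanSpace.single k 1) with hu
  -- The Gram matrix is `1 + u uᵀ` with `u` the vector of values of `a`; a rank-one update has
  -- determinant `1 + |u|²`.
  have hg : Matrix.gram ℝ (fun k => L.toLinearMap (EuclideanSpace.basisFun (Fin n) ℝ k)) =
      1 + Matrix.replicateCol Unit u * Matrix.replicateRow Unit u := by
    ext k l
    have hE : ∀ k, L.toLinearMap (EuclideanSpace.basisFun (Fin n) ℝ k) =
        EuclideanSpace.single (i.succAbove k) (1 : ℝ) + u k • EuclideanSpace.single i 1 :=
      fun k => by simp [hL, hu, hyperplaneEmb_single]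
    simp only [Matrix.gram_apply, hE]
    simp [inner_add_left, inner_add_right, inner_smul_left, inner_smul_right, Matrix.one_apply,
      Matrix.mul_apply, EuclideanSpace.inner_single_left, Fin.succAbove_ne,
      (Fin.succAbove_ne i _).symm, mul_comm]
  rw [hg, Matrix.det_one_add_replicateCol_mul_replicateRow] at h
  simp only [RCLike.ofReal_real_eq_id, id_eq] at h
  rw [← Real.sqrt_sq (LinearMap.normDet_nonneg L.toLinearMap), h]
  simp [dotProduct, hu, sq]

theorem hasFDerivAt_graphMap (i : Fin (n + 1)) {γ : EuclideanSpace ℝ (Fin n) → ℝ}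
    {y : EuclideanSpace ℝ (Fin n)} (hγ : DifferentiableAt ℝ γ y) :
    HasFDerivAt (graphMap i γ) ((hyperplaneEmb i).toContinuousLinearMap +
      (fderiv ℝ γ y).smulRight (EuclideanSpace.single i (1 : ℝ))) y :=
  (hyperplaneEmb i).toContinuousLinearMap.hasFDerivAt.add (hγ.hasFDerivAt.smul_const _)

theorem dropCoord_graphMap (i : Fin (n + 1)) (γ : EuclideanSpace ℝ (Fin n) → ℝ)
    (y : EuclideanSpace ℝ (Fin n)) : dropCoord i (graphMap i γ y) = y := by
  simp [graphMap]

theorem graphMap_apply_self (i : Fin (n + 1)) (γ : EuclideanSpace ℝ (Fin n) → ℝ)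
    (y : EuclideanSpace ℝ (Fin n)) : graphMap i γ y i = γ y := by
  simp [graphMap]

theorem range_graphMap (i : Fin (n + 1)) (γ : EuclideanSpace ℝ (Fin n) → ℝ) :
    range (graphMap i γ) = {x | x i = γ (dropCoord i x)} := by
  ext x
  constructor
  · rintro ⟨y, rfl⟩
    simp [graphMap_apply_self, dropCoord_graphMap]
  · intro hx
    refine ⟨dropCoord i x, ?_⟩
    rw [graphMap, ← (show x i = γ (dropCoord i x) from hx), hyperplaneEmb_dropCoord]

/-- Integration over a graph with respect to the Hausdorff measure, in terms of the
parametrization of the graph. -/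
theorem map_graphMap (i : Fin (n + 1)) {γ : EuclideanSpace ℝ (Fin n) → ℝ} (hγ : ContDiff ℝ 1 γ) :
    (volume.withDensity fun y => ENNReal.ofReal
      (√(1 + ∑ k, fderiv ℝ γ y (EuclideanSpace.single k 1) ^ 2))).map (graphMap i γ) =
      μHE[n].restrict {x | x i = γ (dropCoord i x)} := by
  have hd : ∀ y, fderiv ℝ (graphMap i γ) y = (hyperplaneEmb i).toContinuousLinearMap +
      (fderiv ℝ γ y).smulRight (EuclideanSpace.single i (1 : ℝ)) := fun y =>
    (hasFDerivAt_graphMap i (hγ.differentiable one_ne_zero y)).fderiv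
  have hsm : ContDiff ℝ 1 (graphMap i γ) :=
    (hyperplaneEmb i).contDiff.add (hγ.smul contDiff_const)
  have key := map_withDensity_normDet hsm
    (Function.LeftInverse.injective (dropCoord_graphMap i γ)) (fun y => by
      rw [hd]
      refine Function.LeftInverse.injective (g := dropCoord i) fun v => ?_
      simp)
  simp only [hd, normDet_graph, range_graphMap, finrank_euclideanSpace, Fintype.card_fin] at key
  exact key

end Subgraph

end OspMonogenic
end

noncomputable section

namespace OspMonogenic

open MeasureTheory MeasureTheory.Measure Filter Topology Set
open scoped ENNReal NNReal

/-! ### Defining functions and local graph representations -/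

/-- `ρ` is a defining function of class `C²` of `D` in the neighbourhood `U` of the point `x`. -/
structure IsDefiningFunctionAt {m : ℕ} (D : Set (EuclideanSpace ℝ (Fin m)))
    (x : EuclideanSpace ℝ (Fin m)) (U : Set (EuclideanSpace ℝ (Fin m)))
    (ρ : EuclideanSpace ℝ (Fin m) → ℝ) : Prop where
  isOpen : IsOpen U
  mem : x ∈ U
  contDiffOn : ContDiffOn ℝ 2 ρ U
  gradient_ne_zero : ∇ ρ x ≠ 0
  inter_eq : D ∩ U = {y ∈ U | ρ y < 0}

/-! ### Uniqueness of the outward normal -/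

namespace IsDefiningFunctionAt

variable {m : ℕ} {D U U' : Set (EuclideanSpace ℝ (Fin m))} {x : EuclideanSpace ℝ (Fin m)}
  {ρ ρ' : EuclideanSpace ℝ (Fin m) → ℝ}

theorem mem_iff (h : IsDefiningFunctionAt D x U ρ) {y : EuclideanSpace ℝ (Fin m)} (hy : y ∈ U) :
    y ∈ D ↔ ρ y < 0 :=
  ⟨fun hyD => ((h.inter_eq ▸ (⟨hyD, hy⟩ : y ∈ D ∩ U) : y ∈ {y ∈ U | ρ y < 0})).2,
    fun hlt => (h.inter_eq.symm ▸ (⟨hy, hlt⟩ : y ∈ {y ∈ U | ρ y < 0}) : y ∈ D ∩ U).1⟩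

theorem contDiffAt (h : IsDefiningFunctionAt D x U ρ) {y : EuclideanSpace ℝ (Fin m)}
    (hy : y ∈ U) : ContDiffAt ℝ 2 ρ y :=
  h.contDiffOn.contDiffAt (h.isOpen.mem_nhds hy)

theorem apply_eq_zero (h : IsDefiningFunctionAt D x U ρ) (hD : IsOpen D) (hx : x ∈ frontier D) :
    ρ x = 0 := by
  have hxD : x ∉ D := fun hxD => hx.2 (hD.interior_eq.symm ▸ hxD)
  refine le_antisymm (not_lt.1 fun hpos => ?_) (not_lt.1 fun hneg => hxD ((h.mem_iff h.mem).2 hneg))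
  have h1 : ∀ᶠ y in 𝓝 x, 0 < ρ y := (h.contDiffAt h.mem).continuousAt.eventually (lt_mem_nhds hpos)
  have h2 : ∀ᶠ y in 𝓝 x, y ∈ U := h.isOpen.mem_nhds h.mem
  obtain ⟨y, ⟨hy1, hy2⟩, hyD⟩ := mem_closure_iff_nhds.1 hx.1 _ (h1.and h2)
  exact lt_asymm hy1 ((h.mem_iff hy2).1 hyD)

theorem hasDerivAt_line (h : IsDefiningFunctionAt D x U ρ) (w : EuclideanSpace ℝ (Fin m)) :
    HasDerivAt (fun t : ℝ => ρ (x + t • w)) (inner ℝ (∇ ρ x) w) 0 := by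
  have h1 : HasFDerivAt ρ (fderiv ℝ ρ x) (x + (0 : ℝ) • w) := by
    simpa using ((h.contDiffAt h.mem).differentiableAt two_ne_zero).hasFDerivAt
  have h2 : HasDerivAt (fun t : ℝ => x + t • w) w 0 := by
    simpa using ((hasDerivAt_id (0 : ℝ)).smul_const w).const_add x
  have := h1.comp_hasDerivAt 0 h2
  rwa [inner_gradient_left]

theorem eventually_line_mem (h : IsDefiningFunctionAt D x U ρ) (w : EuclideanSpace ℝ (Fin m)) :
    ∀ᶠ t : ℝ in 𝓝[>] 0, x + t • w ∈ U := by
  have hc : ContinuousAt (fun t : ℝ => x + t • w) 0 := by fun_prop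
  have : ∀ᶠ t : ℝ in 𝓝 0, x + t • w ∈ U :=
    hc.eventually (by simpa using h.isOpen.mem_nhds h.mem)
  exact this.filter_mono nhdsWithin_le_nhds

/-- Membership in `D`, unlike the values of `ρ`, does not depend on the defining function.
First-order information phrased through `D` can therefore be compared between two defining functions
in `normal_unique`. -/
theorem eventually_line_pos (h : IsDefiningFunctionAt D x U ρ) (hD : IsOpen D)
    (hx : x ∈ frontier D) {w : EuclideanSpace ℝ (Fin m)} (hw : 0 < inner ℝ (∇ ρ x) w) :
    ∀ᶠ t : ℝ in 𝓝[>] 0, x + t • w ∉ D := by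
  have hslope := (hasDerivAt_iff_tendsto_slope.1 (h.hasDerivAt_line w)).mono_left
    (nhdsWithin_mono _ fun t (ht : (0 : ℝ) < t) => ht.ne')
  filter_upwards [hslope.eventually (lt_mem_nhds hw), h.eventually_line_mem w,
    eventually_mem_nhdsWithin] with t ht htU ht0 hmem
  have hneg := (h.mem_iff htU).1 hmem
  rw [slope_def_field] at ht
  simp only [zero_smul, add_zero, sub_zero, h.apply_eq_zero hD hx] at ht
  exact absurd ht (not_lt.2 (div_nonpos_of_nonpos_of_nonneg hneg.le (le_of_lt ht0)))

theorem eventually_line_neg (h : IsDefiningFunctionAt D x U ρ) (hD : IsOpen D)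
    (hx : x ∈ frontier D) {w : EuclideanSpace ℝ (Fin m)} (hw : inner ℝ (∇ ρ x) w < 0) :
    ∀ᶠ t : ℝ in 𝓝[>] 0, x + t • w ∈ D := by
  have hslope := (hasDerivAt_iff_tendsto_slope.1 (h.hasDerivAt_line w)).mono_left
    (nhdsWithin_mono _ fun t (ht : (0 : ℝ) < t) => ht.ne')
  filter_upwards [hslope.eventually (gt_mem_nhds hw), h.eventually_line_mem w,
    eventually_mem_nhdsWithin] with t ht htU ht0
  rw [h.mem_iff htU]
  rw [slope_def_field] at ht
  simp only [zero_smul, add_zero, sub_zero, h.apply_eq_zero hD hx] at ht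
  by_contra hge
  exact absurd ht (not_lt.2 (div_nonneg (not_lt.1 hge) (le_of_lt ht0)))

/-- The outward unit normal does not depend on the defining function. -/
theorem normal_unique (h : IsDefiningFunctionAt D x U ρ) (h' : IsDefiningFunctionAt D x U' ρ')
    (hD : IsOpen D) (hx : x ∈ frontier D) :
    ‖∇ ρ x‖⁻¹ • ∇ ρ x = ‖∇ ρ' x‖⁻¹ • ∇ ρ' x := by
  set ν := ‖∇ ρ x‖⁻¹ • ∇ ρ x with hν
  set ν' := ‖∇ ρ' x‖⁻¹ • ∇ ρ' x with hν'
  have hpos : 0 < ‖∇ ρ x‖ := norm_pos_iff.2 h.gradient_ne_zero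
  have hpos' : 0 < ‖∇ ρ' x‖ := norm_pos_iff.2 h'.gradient_ne_zero
  have h1 : ‖ν‖ = 1 := by simp [hν, norm_smul, hpos.ne']
  have h1' : ‖ν'‖ = 1 := by simp [hν', norm_smul, hpos'.ne']
  by_contra hne
  have hlt : inner ℝ ν ν' < 1 := (inner_lt_one_iff_real_of_norm_eq_one h1 h1').2 hne
  have e : ∇ ρ x = ‖∇ ρ x‖ • ν := by simp [hν, smul_smul, hpos.ne']
  have e' : ∇ ρ' x = ‖∇ ρ' x‖ • ν' := by simp [hν', smul_smul, hpos'.ne']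
  -- If the normals differ, `ρ` decreases and `ρ'` increases in the direction `ν' - ν`, so the ray
  -- from `x` would start both inside and outside `D`.
  have hw : inner ℝ (∇ ρ x) (ν' - ν) < 0 := by
    rw [e, inner_smul_left, inner_sub_right, real_inner_self_eq_norm_sq, h1]
    exact mul_neg_of_pos_of_neg (by simpa using h.gradient_ne_zero) (by linarith)
  have hw' : 0 < inner ℝ (∇ ρ' x) (ν' - ν) := by
    rw [e', inner_smul_left, inner_sub_right, real_inner_self_eq_norm_sq, h1',
      real_inner_comm]
    exact mul_pos (by simpa using h'.gradient_ne_zero) (by linarith)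
  obtain ⟨t, ht, ht'⟩ := ((h.eventually_line_neg hD hx hw).and
    (h'.eventually_line_pos hD hx hw')).exists
  exact ht' ht

end IsDefiningFunctionAt

/-! ### Local representation as a subgraph -/

/-- A function of class `C^k` near a point agrees there with a globally `C^k` function. -/
theorem exists_contDiff_eventuallyEq {E F : Type*} [NormedAddCommGroup E] [InnerProductSpace ℝ E]
    [FiniteDimensional ℝ E] [NormedAddCommGroup F] [NormedSpace ℝ F] {k : ℕ} {ψ : E → F} {x : E}
    (h : ContDiffAt ℝ k ψ x) : ∃ γ : E → F, ContDiff ℝ k γ ∧ γ =ᶠ[𝓝 x] ψ := by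
  obtain ⟨r, hr, hball⟩ := Metric.eventually_nhds_iff_ball.1 (h.eventually (by simp))
  -- The outer radius `r / 2` keeps the support of the cutoff inside the ball where `ψ` is regular,
  -- so the extension by zero is of class `C^k`.
  let f : ContDiffBump x := ⟨r / 4, r / 2, by positivity, by linarith⟩
  refine ⟨fun y => f y • ψ y, contDiff_iff_contDiffAt.2 fun y => ?_, ?_⟩
  · by_cases hy : y ∈ Metric.ball x r
    · exact f.contDiffAt.smul (hball y hy)
    · have hy' : y ∉ tsupport f := fun hmem => hy (by
        rw [f.tsupport_eq] at hmem
        exact Metric.closedBall_subset_ball (by change r / 2 < r; linarith) hmem)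
      have h0 : (fun y => f y • ψ y) =ᶠ[𝓝 y] fun _ => 0 := by
        filter_upwards [notMem_tsupport_iff_eventuallyEq.1 hy'] with z hz
        simp [hz]
      exact contDiffAt_const.congr_of_eventuallyEq h0
  · filter_upwards [f.eventuallyEq_one] with y hy
    simp [hy]

/-- In the open set `W`, the set `D` is the strict subgraph (`σ = 1`) or the strict supergraph
(`σ = -1`) of `γ` with respect to the `i`-th coordinate. -/
structure IsLocalSubgraph {n : ℕ} (D W : Set (EuclideanSpace ℝ (Fin (n + 1)))) (i : Fin (n + 1))
    (σ : ℝ) (γ : EuclideanSpace ℝ (Fin n) → ℝ) : Prop where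
  isOpen : IsOpen W
  contDiff : ContDiff ℝ 2 γ
  sign : σ = 1 ∨ σ = -1
  mem_iff : ∀ y ∈ W, y ∈ D ↔ σ * (y i - γ (dropCoord i y)) < 0

theorem fderiv_apply_single {m : ℕ} (ρ : EuclideanSpace ℝ (Fin m) → ℝ)
    (x : EuclideanSpace ℝ (Fin m)) (i : Fin m) :
    fderiv ℝ ρ x (EuclideanSpace.single i 1) = ∇ ρ x i := by
  rw [← inner_gradient_left, EuclideanSpace.inner_single_right]
  simp

/-- Near a boundary point, a domain with a defining function is a subgraph. -/
theorem IsDefiningFunctionAt.exists_isLocalSubgraph {n : ℕ}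
    {D U : Set (EuclideanSpace ℝ (Fin (n + 1)))} {x : EuclideanSpace ℝ (Fin (n + 1))}
    {ρ : EuclideanSpace ℝ (Fin (n + 1)) → ℝ} (h : IsDefiningFunctionAt D x U ρ) (hD : IsOpen D)
    (hx : x ∈ frontier D) : ∃ W i σ γ, x ∈ W ∧ IsLocalSubgraph D W i σ γ := by
  obtain ⟨i, hi⟩ : ∃ i, ∇ ρ x i ≠ 0 := by
    by_contra! h0
    exact h.gradient_ne_zero (by ext i; simpa using h0 i)
  set e : EuclideanSpace ℝ (Fin (n + 1)) := EuclideanSpace.single i 1 with he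
  have hc : fderiv ℝ ρ x e ≠ 0 := by rwa [he, fderiv_apply_single]
  -- the implicit function
  set T : EuclideanSpace ℝ (Fin n) × ℝ →L[ℝ] EuclideanSpace ℝ (Fin (n + 1)) :=
    (hyperplaneEmb i).toContinuousLinearMap.coprod
      ((ContinuousLinearMap.id ℝ ℝ).smulRight e) with hT
  set u : EuclideanSpace ℝ (Fin n) × ℝ := (dropCoord i x, x i) with hu
  have hTu : T u = x := by
    simp only [hT, hu, he]
    simpa using hyperplaneEmb_dropCoord i x
  have hcd : ContDiffAt ℝ 2 (ρ ∘ T) u :=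
    ContDiffAt.comp u (by rw [hTu]; exact h.contDiffAt h.mem) T.contDiff.contDiffAt
  have hfd : fderiv ℝ (ρ ∘ T) u = (fderiv ℝ ρ x).comp T := by
    have h1 : DifferentiableAt ℝ ρ (T u) := by
      rw [hTu]; exact (h.contDiffAt h.mem).differentiableAt two_ne_zero
    rw [fderiv_comp u h1 T.differentiableAt, hTu, T.fderiv]
  have hinv : (fderiv ℝ (ρ ∘ T) u ∘L .inr ℝ (EuclideanSpace ℝ (Fin n)) ℝ).IsInvertible := by
    refine ⟨ContinuousLinearEquiv.unitsEquivAut ℝ (Units.mk0 _ hc), ?_⟩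
    ext
    rw [hfd]
    simp [hT]
  set ψ := hcd.implicitFunction two_ne_zero hinv with hψ
  -- The implicit function is regular only near the base point. A global `C²` function with the same
  -- germ is used instead, since the shear is defined on the whole space.
  obtain ⟨γ, hγ, hγψ⟩ := exists_contDiff_eventuallyEq (k := 2)
    (hcd.contDiffAt_implicitFunction two_ne_zero hinv)
  have hγu : γ (dropCoord i x) = x i := by
    rw [hγψ.self_of_nhds]
    exact hcd.implicitFunction_apply_self two_ne_zero hinv
  have hzero : ∀ᶠ y in 𝓝 (dropCoord i x), ρ (graphMap i γ y) = 0 := by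
    filter_upwards [hγψ, hcd.eventually_apply_implicitFunction two_ne_zero hinv] with y hy1 hy2
    have : (ρ ∘ T) u = 0 := by simp only [Function.comp, hTu]; exact h.apply_eq_zero hD hx
    rw [this] at hy2
    rw [← hy2, graphMap, hy1]
    simp [hT, he]
  -- the sign of the derivative
  obtain ⟨σ, hσ, hσc⟩ : ∃ σ : ℝ, (σ = 1 ∨ σ = -1) ∧ 0 < σ * fderiv ℝ ρ x e := by
    rcases lt_or_gt_of_ne hc with hneg | hpos
    · exact ⟨-1, Or.inr rfl, by linarith⟩
    · exact ⟨1, Or.inl rfl, by linarith⟩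
  have hcont : ContinuousAt (fun y => σ * fderiv ℝ ρ y e) x := by
    have h1 : ContinuousAt (fderiv ℝ ρ) x :=
      ((h.contDiffAt h.mem).fderiv_right (m := 1) (by norm_num)).continuousAt
    exact continuousAt_const.mul (h1.clm_apply continuousAt_const)
  obtain ⟨r, hr, hball⟩ := Metric.eventually_nhds_iff_ball.1
    ((hcont.eventually (lt_mem_nhds hσc)).and (h.isOpen.mem_nhds h.mem))
  set G : EuclideanSpace ℝ (Fin (n + 1)) → EuclideanSpace ℝ (Fin (n + 1)) :=
    fun y => graphMap i γ (dropCoord i y) with hG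
  have hGc : Continuous G := by
    have := hγ.continuous
    have := (hyperplaneEmb i).continuous
    simp only [hG, graphMap]
    fun_prop
  have hGx : G x = x := by
    simp only [hG, graphMap, hγu]
    exact hyperplaneEmb_dropCoord i x
  have hev : ∀ᶠ y in 𝓝 x, y ∈ Metric.ball x r ∧ G y ∈ Metric.ball x r ∧ ρ (G y) = 0 := by
    refine Eventually.and (Metric.ball_mem_nhds x hr) (.and ?_ ?_)
    · exact hGc.continuousAt.eventually (by rw [hGx]; exact Metric.ball_mem_nhds x hr)
    · exact (dropCoord i).continuous.continuousAt.eventually hzero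
  obtain ⟨W, hW, hWo, hxW⟩ := eventually_nhds_iff.1 hev
  refine ⟨W, i, σ, γ, hxW, hWo, hγ, hσ, fun y hy => ?_⟩
  obtain ⟨hyB, hGB, hG0⟩ := hW y hy
  rw [h.mem_iff (hball y hyB).2]
  -- Mean value theorem between `y` and the point `G y` of the graph on the same line parallel to
  -- `e`: since `ρ (G y) = 0`, `ρ y` is the height above the graph times a derivative whose sign on
  -- the ball is `σ`.
  obtain ⟨z, hz, hzeq⟩ := domain_mvt (f := ρ) (s := Metric.ball x r) (f' := fun z => fderiv ℝ ρ z)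
    (fun z hz => ((h.contDiffAt (hball z hz).2).differentiableAt
      two_ne_zero).hasFDerivAt.hasFDerivWithinAt) (convex_ball x r) hGB hyB
  have hzB : z ∈ Metric.ball x r := (convex_ball x r).segment_subset hGB hyB hz
  have hdiff : y - G y = (y i - γ (dropCoord i y)) • e := by
    conv_lhs => rw [← hyperplaneEmb_dropCoord i y]
    simp only [hG, graphMap, he, map_add, dropCoord_hyperplaneEmb, map_smul,
      dropCoord_single_self, smul_zero, add_zero]
    rw [sub_smul]; abel
  rw [hdiff, hG0, sub_zero, map_smul, smul_eq_mul] at hzeq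
  have hzpos := (hball z hzB).1
  rw [hzeq]
  set τ := y i - γ (dropCoord i y)
  set c := fderiv ℝ ρ z e
  have hσσ : σ * σ = 1 := by rcases hσ with rfl | rfl <;> norm_num
  have hprod : τ * c = (σ * τ) * (σ * c) := by
    calc τ * c = (σ * σ) * (τ * c) := by rw [hσσ, one_mul]
      _ = _ := by ring
  rw [hprod]
  exact ⟨fun hlt => by by_contra hge; exact absurd hlt (not_lt.2 (mul_nonneg (not_lt.1 hge) hzpos.le)),
    fun hlt => mul_neg_of_neg_of_pos hlt hzpos⟩

end OspMonogenic
end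

noncomputable section

namespace OspMonogenic

open MeasureTheory MeasureTheory.Measure Filter Topology Set
open scoped ENNReal NNReal

/-! ### The divergence theorem for domains with `C²` boundary -/

/-- `N` is the outward unit normal of `D` at all boundary points that have a defining function. -/
def IsOutwardNormalField {m : ℕ} (D : Set (EuclideanSpace ℝ (Fin m)))
    (N : EuclideanSpace ℝ (Fin m) → EuclideanSpace ℝ (Fin m)) : Prop :=
  ∀ x ∈ frontier D, ∀ U ρ, IsDefiningFunctionAt D x U ρ → N x = ‖∇ ρ x‖⁻¹ • ∇ ρ x

/-! ### The divergence theorem in one coordinate patch -/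

namespace IsLocalSubgraph

variable {n : ℕ} {D W : Set (EuclideanSpace ℝ (Fin (n + 1)))} {i : Fin (n + 1)} {σ : ℝ}
  {γ : EuclideanSpace ℝ (Fin n) → ℝ} {V : Type*} [NormedAddCommGroup V] [NormedSpace ℝ V]

theorem mono (h : IsLocalSubgraph D W i σ γ) {W' : Set (EuclideanSpace ℝ (Fin (n + 1)))}
    (hW' : IsOpen W') (hsub : W' ⊆ W) : IsLocalSubgraph D W' i σ γ :=
  ⟨hW', h.contDiff, h.sign, fun y hy => h.mem_iff y (hsub hy)⟩

theorem sign_mul_self (h : IsLocalSubgraph D W i σ γ) : σ * σ = 1 := by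
  rcases h.sign with rfl | rfl <;> norm_num

theorem hasFDerivAt (h : IsLocalSubgraph D W i σ γ) (y : EuclideanSpace ℝ (Fin (n + 1))) :
    HasFDerivAt (fun y : EuclideanSpace ℝ (Fin (n + 1)) => σ * (y i - γ (dropCoord i y)))
      (σ • (EuclideanSpace.proj i - (fderiv ℝ γ (dropCoord i y)).comp (dropCoord i))) y := by
  have h1 : HasFDerivAt (fun x => γ (dropCoord i x))
      ((fderiv ℝ γ (dropCoord i y)).comp (dropCoord i)) y :=
    ((h.contDiff.differentiable two_ne_zero (dropCoord i y)).hasFDerivAt).comp y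
      (dropCoord i).hasFDerivAt
  exact ((EuclideanSpace.proj (𝕜 := ℝ) (i := i)).hasFDerivAt.sub h1).const_mul σ

theorem gradient_apply_self (h : IsLocalSubgraph D W i σ γ)
    (y : EuclideanSpace ℝ (Fin (n + 1))) :
    (∇ (fun y : EuclideanSpace ℝ (Fin (n + 1)) => σ * (y i - γ (dropCoord i y))) y) i = σ := by
  rw [← fderiv_apply_single, (h.hasFDerivAt y).fderiv]
  simp

theorem gradient_apply_succAbove (h : IsLocalSubgraph D W i σ γ)
    (y : EuclideanSpace ℝ (Fin (n + 1))) (k : Fin n) :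
    (∇ (fun y : EuclideanSpace ℝ (Fin (n + 1)) => σ * (y i - γ (dropCoord i y))) y)
      (i.succAbove k) = -σ * fderiv ℝ γ (dropCoord i y) (EuclideanSpace.single k 1) := by
  rw [← fderiv_apply_single, (h.hasFDerivAt y).fderiv]
  simp

theorem norm_gradient (h : IsLocalSubgraph D W i σ γ) (y : EuclideanSpace ℝ (Fin (n + 1))) :
    ‖∇ (fun y : EuclideanSpace ℝ (Fin (n + 1)) => σ * (y i - γ (dropCoord i y))) y‖ =
      √(1 + ∑ k, fderiv ℝ γ (dropCoord i y) (EuclideanSpace.single k 1) ^ 2) := by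
  rw [EuclideanSpace.norm_eq, Fin.sum_univ_succAbove _ i]
  simp only [h.gradient_apply_self, h.gradient_apply_succAbove, Real.norm_eq_abs, sq_abs, mul_pow,
    neg_sq]
  simp [sq σ, h.sign_mul_self]

theorem isDefiningFunctionAt (h : IsLocalSubgraph D W i σ γ)
    {y : EuclideanSpace ℝ (Fin (n + 1))} (hy : y ∈ W) :
    IsDefiningFunctionAt D y W fun y => σ * (y i - γ (dropCoord i y)) where
  isOpen := h.isOpen
  mem := hy
  contDiffOn := by
    refine ContDiff.contDiffOn ?_
    have := h.contDiff
    fun_prop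
  gradient_ne_zero := by
    rw [← norm_pos_iff, h.norm_gradient]
    positivity
  inter_eq := by
    ext z
    exact ⟨fun hz => ⟨hz.2, (h.mem_iff z hz.2).1 hz.1⟩, fun hz => ⟨(h.mem_iff z hz.1).2 hz.2, hz.1⟩⟩

theorem mem_frontier_iff (h : IsLocalSubgraph D W i σ γ) (hD : IsOpen D)
    {y : EuclideanSpace ℝ (Fin (n + 1))} (hy : y ∈ W) :
    y ∈ frontier D ↔ y i = γ (dropCoord i y) := by
  have hσ0 : σ ≠ 0 := by rcases h.sign with rfl | rfl <;> norm_num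
  constructor
  · intro hyF
    have := (h.isDefiningFunctionAt hy).apply_eq_zero hD hyF
    rcases mul_eq_zero.1 this with h0 | h0
    · exact absurd h0 hσ0
    · linarith
  · intro hyeq
    have hyD : y ∉ D := by
      rw [h.mem_iff y hy, hyeq]; simp
    refine ⟨?_, by rwa [hD.interior_eq]⟩
    -- Moving from `y` in the direction `-σ e_i` enters `D`, whichever side of the graph `D` lies
    -- on.
    have hc : Tendsto (fun t : ℝ => y - (t * σ) • EuclideanSpace.single i (1 : ℝ)) (𝓝[>] 0)
        (𝓝 y) := by
      have : ContinuousAt (fun t : ℝ => y - (t * σ) • EuclideanSpace.single i (1 : ℝ)) 0 := by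
        fun_prop
      have := this.tendsto
      simp only [zero_mul, zero_smul, sub_zero] at this
      exact this.mono_left nhdsWithin_le_nhds
    refine mem_closure_of_tendsto hc ?_
    filter_upwards [hc.eventually (h.isOpen.mem_nhds hy), eventually_mem_nhdsWithin] with t htW ht
    rw [h.mem_iff _ htW]
    have ht' : (0 : ℝ) < t := ht
    have hσ := h.sign_mul_self
    have : σ * ((y - (t * σ) • EuclideanSpace.single i (1 : ℝ)) i -
        γ (dropCoord i (y - (t * σ) • EuclideanSpace.single i (1 : ℝ)))) = -t := by
      simp [hyeq]
      linear_combination t * hσ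
    rw [this]
    linarith

/-- The flux density through the graph, extended to the whole space. -/
def extendedFlux (i : Fin (n + 1)) (σ : ℝ) (γ : EuclideanSpace ℝ (Fin n) → ℝ)
    (F : Fin (n + 1) → EuclideanSpace ℝ (Fin (n + 1)) → V)
    (x : EuclideanSpace ℝ (Fin (n + 1))) : V :=
  (σ / √(1 + ∑ k, fderiv ℝ γ (dropCoord i x) (EuclideanSpace.single k 1) ^ 2)) •
    (F i x - ∑ k, fderiv ℝ γ (dropCoord i x) (EuclideanSpace.single k 1) • F (i.succAbove k) x)

/-- `σ (y_i - γ(y'))` is itself a defining function in `W`, so `N` is its normalized gradient. -/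
theorem normal_sum_eq (h : IsLocalSubgraph D W i σ γ)
    {N : EuclideanSpace ℝ (Fin (n + 1)) → EuclideanSpace ℝ (Fin (n + 1))}
    (hN : IsOutwardNormalField D N) (F : Fin (n + 1) → EuclideanSpace ℝ (Fin (n + 1)) → V)
    {y : EuclideanSpace ℝ (Fin (n + 1))} (hy : y ∈ W) (hyF : y ∈ frontier D) :
    ∑ j, N y j • F j y = extendedFlux i σ γ F y := by
  rw [hN y hyF _ _ (h.isDefiningFunctionAt hy), Fin.sum_univ_succAbove _ i]
  simp only [PiLp.smul_apply, h.gradient_apply_self, h.gradient_apply_succAbove, h.norm_gradient,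
    extendedFlux, smul_eq_mul]
  rw [smul_sub, Finset.smul_sum, sub_eq_add_neg, ← Finset.sum_neg_distrib]
  congr 1
  · congr 1; ring
  · refine Finset.sum_congr rfl fun k _ => ?_
    rw [smul_smul, ← neg_smul]
    congr 1; ring

/-- The divergence theorem for fields supported in a coordinate patch. -/
theorem divergence_theorem (h : IsLocalSubgraph D W i σ γ) (hD : IsOpen D)
    {N : EuclideanSpace ℝ (Fin (n + 1)) → EuclideanSpace ℝ (Fin (n + 1))}
    (hN : IsOutwardNormalField D N) {F : Fin (n + 1) → EuclideanSpace ℝ (Fin (n + 1)) → V}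
    (hF : ∀ j, Differentiable ℝ (F j)) (hs : ∀ j, HasCompactSupport (F j))
    (hW : ∀ j, tsupport (F j) ⊆ W) (hdiv : Continuous (divergence F)) :
    IntegrableOn (fun y => ∑ j, N y j • F j y) (frontier D) μHE[n] ∧
      ∫ y in frontier D, ∑ j, N y j • F j y ∂μHE[n] = ∫ x in D, divergence F x := by
  have hzero : ∀ y ∉ W, ∀ j, F j y = 0 := fun y hy j =>
    image_eq_zero_of_notMem_tsupport fun hy' => hy (hW j hy')
  have hzero' : ∀ y ∉ W, extendedFlux i σ γ F y = 0 := fun y hy => by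
    simp [extendedFlux, hzero y hy]
  have heq : EqOn (fun y => ∑ j, N y j • F j y) (extendedFlux i σ γ F) (frontier D) :=
    fun y hyF => by
      by_cases hy : y ∈ W
      · exact h.normal_sum_eq hN F hy hyF
      · rw [hzero' y hy]; simp [hzero y hy]
  have hγ := h.contDiff
  set S : Set (EuclideanSpace ℝ (Fin (n + 1))) := {x | x i = γ (dropCoord i x)} with hS
  have hSc : IsClosed S := isClosed_eq (by fun_prop) (hγ.continuous.comp (dropCoord i).continuous)
  have hFrW : frontier D ∩ W = S ∩ W := by
    ext y
    exact ⟨fun hy => ⟨(h.mem_frontier_iff hD hy.2).1 hy.1, hy.2⟩,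
      fun hy => ⟨(h.mem_frontier_iff hD hy.2).2 hy.1, hy.2⟩⟩
  -- the integral over the graph in terms of its parametrization
  set J : EuclideanSpace ℝ (Fin n) → ℝ := fun y =>
    √(1 + ∑ k, fderiv ℝ γ y (EuclideanSpace.single k 1) ^ 2) with hJ
  have hJpos : ∀ y, 0 < J y := fun y => by simp only [hJ]; positivity
  have hdγ : ∀ k : Fin n, Continuous fun y => fderiv ℝ γ y (EuclideanSpace.single k 1) := fun k =>
    (hγ.continuous_fderiv two_ne_zero).clm_apply continuous_const
  have hJc : Continuous J := by
    simp only [hJ]; fun_prop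
  have hmap : (volume.withDensity fun y => ((J y).toNNReal : ℝ≥0∞)).map (graphMap i γ) =
      μHE[n].restrict S := map_graphMap i (hγ.of_le (by norm_num))
  have hGc : Continuous (graphMap i γ) := by
    have := hγ.continuous
    have := (hyperplaneEmb i).continuous
    unfold graphMap
    fun_prop
  have hGe : MeasurableEmbedding (graphMap i γ) :=
    hGc.measurableEmbedding (Function.LeftInverse.injective (dropCoord_graphMap i γ))
  -- The square root normalizing the gradient is also the surface element of the graph, so the two
  -- cancel.
  have hflux : ∀ y, J y • extendedFlux i σ γ F (graphMap i γ y) = σ • graphFlux i γ F y :=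
    fun y => by
      simp only [extendedFlux, dropCoord_graphMap, graphFlux]
      rw [smul_smul]
      congr 1
      have := (hJpos y).ne'
      simp only [hJ] at this ⊢
      field_simp
  have hfc : Continuous (graphFlux i γ F) := by
    have := fun j => (hF j).continuous
    unfold graphFlux
    fun_prop
  have hfs : HasCompactSupport (graphFlux i γ F) := by
    refine HasCompactSupport.intro ((isCompact_iUnion fun j => hs j).image (dropCoord i).continuous)
      fun y hy => ?_
    have h0 : ∀ j, F j (graphMap i γ y) = 0 := fun j =>
      image_eq_zero_of_notMem_tsupport fun hmem => hy
        ⟨_, mem_iUnion.2 ⟨j, hmem⟩, dropCoord_graphMap i γ y⟩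
    simp [graphFlux, h0]
  have hJm : Measurable fun y => (J y).toNNReal := hJc.measurable.real_toNNReal
  have hintS : IntegrableOn (extendedFlux i σ γ F) S μHE[n] := by
    rw [IntegrableOn, ← hmap, hGe.integrable_map_iff,
      integrable_withDensity_iff_integrable_smul hJm]
    refine ((hfc.integrable_of_hasCompactSupport (μ := volume) hfs).smul σ).congr
      (Eventually.of_forall fun y => ?_)
    simp only [Function.comp, NNReal.smul_def, Real.coe_toNNReal _ (hJpos y).le, hflux,
      Pi.smul_apply]
  have hvalS : ∫ y in S, extendedFlux i σ γ F y ∂μHE[n] = σ • ∫ y, graphFlux i γ F y := by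
    rw [← hmap, hGe.integral_map, ← integral_smul]
    refine (integral_withDensity_eq_integral_smul hJm _).trans ?_
    refine integral_congr_ae (Eventually.of_forall fun y => ?_)
    simp only [NNReal.smul_def, Real.coe_toNNReal _ (hJpos y).le, hflux]
  have hFrm : MeasurableSet (frontier D) := isClosed_frontier.measurableSet
  have hWm : MeasurableSet W := h.isOpen.measurableSet
  refine ⟨?_, ?_⟩
  · refine IntegrableOn.congr_fun ?_ heq.symm hFrm
    refine IntegrableOn.of_forall_sdiff_eq_zero (s := frontier D ∩ W) ?_ hFrm ?_
    · rw [hFrW]; exact hintS.mono_set inter_subset_left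
    · rintro y ⟨hyF, hy⟩
      exact hzero' y fun hyW => hy ⟨hyF, hyW⟩
  -- The flux vanishes off `W`, and inside `W` the frontier is the graph. Hence the frontier may be
  -- replaced by the whole graph; `D` is replaced below by the whole subgraph or supergraph in the
  -- same way.
  · rw [setIntegral_congr_fun hFrm heq,
      setIntegral_eq_of_subset_of_forall_sdiff_eq_zero hFrm inter_subset_left
        (fun y hy => hzero' y fun hyW => hy.2 ⟨hy.1, hyW⟩), hFrW,
      ← setIntegral_eq_of_subset_of_forall_sdiff_eq_zero hSc.measurableSet inter_subset_left
        (fun y hy => hzero' y fun hyW => hy.2 ⟨hy.1, hyW⟩), hvalS]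
    have hdzero : ∀ y ∉ W, divergence F y = 0 := fun y hy => by
      refine Finset.sum_eq_zero fun j _ => ?_
      have h0 : fderiv ℝ (F j) y = 0 := by
        by_contra h0
        exact hy (hW j (support_fderiv_subset ℝ h0))
      simp [h0]
    rw [setIntegral_eq_of_subset_of_forall_sdiff_eq_zero hD.measurableSet
      (inter_subset_left (t := W)) (fun y hy => hdzero y fun hyW => hy.2 ⟨hy.1, hyW⟩)]
    set G : Set (EuclideanSpace ℝ (Fin (n + 1))) := {y | σ * (y i - γ (dropCoord i y)) < 0} with hG
    have hDW : D ∩ W = G ∩ W := by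
      ext y
      exact ⟨fun hy => ⟨(h.mem_iff y hy.2).1 hy.1, hy.2⟩, fun hy => ⟨(h.mem_iff y hy.2).2 hy.1, hy.2⟩⟩
    have hGo : IsOpen G := by
      have := hγ.continuous
      exact isOpen_lt (by fun_prop) continuous_const
    rw [hDW, ← setIntegral_eq_of_subset_of_forall_sdiff_eq_zero hGo.measurableSet
      (inter_subset_left (t := W)) (fun y hy => hdzero y fun hyW => hy.2 ⟨hy.1, hyW⟩)]
    rcases h.sign with rfl | rfl
    · have : G = {x | x i < γ (dropCoord i x)} := by
        ext y; simp [hG]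
      rw [this, integral_divergence_subgraph_lt i hγ hF hs hdiv, one_smul]
    · have : G = {x | γ (dropCoord i x) < x i} := by
        ext y; simp [hG]
      rw [this, integral_divergence_supergraph_lt i hγ hF hs hdiv, neg_one_smul]

end IsLocalSubgraph

/-! ### Cutting off fields and gluing the patches -/

section PartitionOfUnity

variable {m : ℕ} {V : Type*} [NormedAddCommGroup V] [NormedSpace ℝ V]
  {Ω : Set (EuclideanSpace ℝ (Fin m))} {φ : EuclideanSpace ℝ (Fin m) → ℝ}
  {F : Fin m → EuclideanSpace ℝ (Fin m) → V}

theorem differentiable_smul_of_tsupport_subset (hφ : Differentiable ℝ φ) (hs : tsupport φ ⊆ Ω)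
    {f : EuclideanSpace ℝ (Fin m) → V} (hf : ∀ x ∈ Ω, DifferentiableAt ℝ f x) :
    Differentiable ℝ fun x => φ x • f x := by
  intro x
  by_cases hx : x ∈ tsupport φ
  · exact (hφ x).smul (hf x (hs hx))
  · have h0 : (fun x => φ x • f x) =ᶠ[𝓝 x] fun _ => 0 := by
      filter_upwards [notMem_tsupport_iff_eventuallyEq.1 hx] with z hz
      simp [hz]
    exact (differentiableAt_const 0).congr_of_eventuallyEq h0

/-- `div (φ F) = φ div F + ∇φ · F` contains no individual derivative of `F`, so a cutoff preserves
continuity of the divergence even for fields that are not `C¹`. -/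
theorem continuous_divergence_smul (hΩ : IsOpen Ω) (hφ : ContDiff ℝ 1 φ) (hs : tsupport φ ⊆ Ω)
    (hF : ∀ j, ∀ x ∈ Ω, DifferentiableAt ℝ (F j) x) (hdiv : ContinuousOn (divergence F) Ω) :
    Continuous (divergence fun j x => φ x • F j x) := by
  have hφd := hφ.differentiable one_ne_zero
  refine continuous_iff_continuousAt.2 fun x => ?_
  by_cases hx : x ∈ tsupport φ
  · have hev : (divergence fun j x => φ x • F j x) =ᶠ[𝓝 x] fun x => φ x • divergence F x +
        ∑ j, fderiv ℝ φ x (EuclideanSpace.single j 1) • F j x := by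
      filter_upwards [hΩ.mem_nhds (hs hx)] with y hy
      simp only [divergence, Finset.smul_sum, ← Finset.sum_add_distrib]
      refine Finset.sum_congr rfl fun j _ => ?_
      rw [fderiv_fun_smul (hφd y) (hF j y hy)]
      simp
    refine ContinuousAt.congr ?_ hev.symm
    refine (hφ.continuous.continuousAt.smul (hdiv.continuousAt (hΩ.mem_nhds (hs hx)))).add ?_
    refine tendsto_finsetSum _ fun j _ => ContinuousAt.smul ?_ (hF j x (hs hx)).continuousAt
    exact ((hφ.continuous_fderiv one_ne_zero).clm_apply continuous_const).continuousAt
  · have hev : (divergence fun j x => φ x • F j x) =ᶠ[𝓝 x] fun _ => 0 := by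
      filter_upwards [(isClosed_tsupport φ).isOpen_compl.mem_nhds hx] with y hy
      refine Finset.sum_eq_zero fun j _ => ?_
      have h0 : (fun x => φ x • F j x) =ᶠ[𝓝 y] fun _ => 0 := by
        filter_upwards [notMem_tsupport_iff_eventuallyEq.1 hy] with z hz
        simp [hz]
      rw [h0.fderiv_eq]
      simp
    exact continuousAt_const.congr hev.symm

end PartitionOfUnity

/-- **Divergence theorem** for bounded open sets with `C²` boundary and differentiable fields with
continuous divergence. -/
theorem divergence_theorem {n : ℕ} {D Ω : Set (EuclideanSpace ℝ (Fin (n + 1)))} {V : Type*}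
    [NormedAddCommGroup V] [NormedSpace ℝ V] (hD : IsOpen D) (hDb : Bornology.IsBounded D)
    (hdef : ∀ x ∈ frontier D, ∃ U ρ, IsDefiningFunctionAt D x U ρ)
    {N : EuclideanSpace ℝ (Fin (n + 1)) → EuclideanSpace ℝ (Fin (n + 1))}
    (hN : IsOutwardNormalField D N) (hΩ : IsOpen Ω) (hDΩ : closure D ⊆ Ω)
    {F : Fin (n + 1) → EuclideanSpace ℝ (Fin (n + 1)) → V}
    (hF : ∀ j, ∀ x ∈ Ω, DifferentiableAt ℝ (F j) x) (hdiv : ContinuousOn (divergence F) Ω) :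
    IntegrableOn (fun y => ∑ j, N y j • F j y) (frontier D) μHE[n] ∧
      ∫ y in frontier D, ∑ j, N y j • F j y ∂μHE[n] = ∫ x in D, divergence F x := by
  -- Boundedness of `Ω` makes the supports of the partition functions compact.
  wlog hΩb : Bornology.IsBounded Ω generalizing Ω
  · obtain ⟨R, hR⟩ := hDb.closure.subset_ball 0
    exact this (hΩ.inter Metric.isOpen_ball) (subset_inter hDΩ hR)
      (fun j x hx => hF j x hx.1) (hdiv.mono inter_subset_left)
      (Metric.isBounded_ball.subset inter_subset_right)
  have hcompact : IsCompact (closure D) := hDb.isCompact_closure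
  -- a cover of the closure by `D` and coordinate patches
  have hpatch : ∀ x ∈ closure D, ∃ W, IsOpen W ∧ x ∈ W ∧ W ⊆ Ω ∧
      (W = D ∨ ∃ i σ γ, IsLocalSubgraph D W i σ γ) := by
    intro x hx
    by_cases hxD : x ∈ D
    · exact ⟨D, hD, hxD, subset_closure.trans hDΩ, Or.inl rfl⟩
    · have hxF : x ∈ frontier D := ⟨hx, by rwa [hD.interior_eq]⟩
      obtain ⟨U, ρ, hρ⟩ := hdef x hxF
      obtain ⟨W, i, σ, γ, hxW, hW⟩ := hρ.exists_isLocalSubgraph hD hxF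
      exact ⟨W ∩ Ω, hW.isOpen.inter hΩ, ⟨hxW, hDΩ hx⟩, inter_subset_right,
        Or.inr ⟨i, σ, γ, hW.mono (hW.isOpen.inter hΩ) inter_subset_left⟩⟩
  choose! W hWo hxW hWΩ hWtype using hpatch
  obtain ⟨t, htD, htcov⟩ := hcompact.elim_nhds_subcover W
    fun x hx => (hWo x hx).mem_nhds (hxW x hx)
  obtain ⟨f, hf⟩ := SmoothPartitionOfUnity.exists_isSubordinate
    (modelWithCornersSelf ℝ (EuclideanSpace ℝ (Fin (n + 1)))) isClosed_closure
    (fun x : t => W x) (fun x => hWo x (htD x x.2)) (fun y hy => by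
      obtain ⟨x, hx, hy'⟩ := mem_iUnion₂.1 (htcov hy)
      exact mem_iUnion.2 ⟨⟨x, hx⟩, hy'⟩)
  have hfs : ∀ k : t, ContDiff ℝ 1 (f k) := fun k =>
    (f k).contMDiff.contDiff.of_le (by norm_cast)
  have hfΩ : ∀ k : t, tsupport (f k) ⊆ Ω := fun k => (hf k).trans (hWΩ k (htD k k.2))
  have hfc : ∀ k : t, HasCompactSupport (f k) := fun k =>
    Metric.isCompact_of_isClosed_isBounded (isClosed_tsupport _) (hΩb.subset (hfΩ k))
  have hfsum : ∀ x ∈ closure D, ∑ k : t, f k x = 1 := fun x hx => by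
    rw [← finsum_eq_sum_of_fintype]; exact f.sum_eq_one hx
  set G : t → Fin (n + 1) → EuclideanSpace ℝ (Fin (n + 1)) → V :=
    fun k j x => f k x • F j x with hG
  have hGd : ∀ k j, Differentiable ℝ (G k j) := fun k j =>
    differentiable_smul_of_tsupport_subset ((hfs k).differentiable one_ne_zero) (hfΩ k) (hF j)
  have hGc : ∀ k j, HasCompactSupport (G k j) := fun k j => (hfc k).smul_right
  have hGs : ∀ k j, tsupport (G k j) ⊆ W k := fun k j =>
    (closure_mono (Function.support_smul_subset_left _ _)).trans (hf k)
  have hGdiv : ∀ k, Continuous (divergence (G k)) := fun k =>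
    continuous_divergence_smul hΩ (hfs k) (hfΩ k) hF hdiv
  have hloc : ∀ k, IntegrableOn (fun y => ∑ j, N y j • G k j y) (frontier D) μHE[n] ∧
      ∫ y in frontier D, ∑ j, N y j • G k j y ∂μHE[n] = ∫ x in D, divergence (G k) x := by
    intro k
    rcases hWtype k (htD k k.2) with hWD | ⟨i, σ, γ, hsub⟩
    -- Interior patch: the field has compact support in `D`, so both sides are zero.
    · have hz : ∀ y ∉ D, ∀ j, G k j y = 0 := fun y hy j =>
        image_eq_zero_of_notMem_tsupport fun hmem => hy (hWD ▸ hGs k j hmem)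
      have hz' : EqOn (fun y => ∑ j, N y j • G k j y) (fun _ => 0) (frontier D) := fun y hy => by
        have hyD : y ∉ D := fun hyD => hy.2 (hD.interior_eq.symm ▸ hyD)
        simp [hz y hyD]
      have hFrm : MeasurableSet (frontier D) := isClosed_frontier.measurableSet
      refine ⟨integrableOn_zero.congr_fun hz'.symm hFrm, ?_⟩
      rw [setIntegral_congr_fun hFrm hz', integral_zero,
        setIntegral_eq_integral_of_forall_compl_eq_zero,
        integral_divergence_eq_zero (hGd k) (hGc k) (hGdiv k)]
      intro y hy
      refine Finset.sum_eq_zero fun j _ => ?_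
      have h0 : fderiv ℝ (G k j) y = 0 := by
        by_contra h0
        exact hy (hWD ▸ hGs k j (support_fderiv_subset ℝ h0))
      simp [h0]
    · exact hsub.divergence_theorem hD hN (hGd k) (hGc k) (hGs k) (hGdiv k)
  have hsum : ∀ x ∈ closure D, ∀ j, ∑ k, G k j x = F j x := fun x hx j => by
    simp only [hG, ← Finset.sum_smul, hfsum x hx, one_smul]
  have hFrm : MeasurableSet (frontier D) := isClosed_frontier.measurableSet
  have heq : EqOn (fun y => ∑ k, ∑ j, N y j • G k j y) (fun y => ∑ j, N y j • F j y)
      (frontier D) := fun y hy => by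
    simp only
    rw [Finset.sum_comm]
    exact Finset.sum_congr rfl fun j _ => by rw [← Finset.smul_sum, hsum y hy.1 j]
  have hdiveq : EqOn (fun x => ∑ k, divergence (G k) x) (divergence F) D := fun x hx => by
    simp only [divergence]
    rw [Finset.sum_comm]
    refine Finset.sum_congr rfl fun j _ => ?_
    have hev : (fun x => ∑ k, G k j x) =ᶠ[𝓝 x] F j := by
      filter_upwards [hD.mem_nhds hx] with y hy using hsum y (subset_closure hy) j
    rw [← hev.fderiv_eq, fderiv_fun_sum fun k _ => hGd k j x, _root_.sum_apply]
  refine ⟨IntegrableOn.congr_fun (integrable_finsetSum _ fun k _ => (hloc k).1) heq hFrm, ?_⟩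
  rw [← setIntegral_congr_fun hFrm heq, ← setIntegral_congr_fun hD.measurableSet hdiveq,
    integral_finsetSum _ fun k _ => (hloc k).1, integral_finsetSum]
  · exact Finset.sum_congr rfl fun k _ => (hloc k).2
  · intro k _
    exact ((hGdiv k).integrable_of_hasCompactSupport (μ := volume)
      (hasCompactSupport_divergence (hGc k))).integrableOn

end OspMonogenic
end

noncomputable section

namespace OspMonogenic

open MeasureTheory MeasureTheory.Measure Filter Topology Set
open scoped ENNReal NNReal

/-! ### Regularized Cauchy kernels -/

/-- The function `(|y|² + s)^{-q}`; for `s = 0` it is the radial factor of the Cauchy kernels. -/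
def radialFactor {m : ℕ} (q : ℕ) (s : ℝ) (y : EuclideanSpace ℝ (Fin m)) : ℝ :=
  ((‖y‖ ^ 2 + s) ^ q)⁻¹

section Kernel

variable {m : ℕ} {q : ℕ}

theorem hasFDerivAt_radialFactor {s : ℝ} {y : EuclideanSpace ℝ (Fin m)} (hy : ‖y‖ ^ 2 + s ≠ 0) :
    HasFDerivAt (radialFactor q s) ((-2 * q * ((‖y‖ ^ 2 + s) ^ (q + 1))⁻¹) • innerSL ℝ y) y := by
  have h1 : HasFDerivAt (fun y : EuclideanSpace ℝ (Fin m) => ‖y‖ ^ 2 + s) (2 • innerSL ℝ y) y :=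
    (hasStrictFDerivAt_norm_sq y).hasFDerivAt.add_const s
  have h2 := (hasDerivAt_zpow (-(q : ℤ)) (‖y‖ ^ 2 + s) (Or.inl hy)).comp_hasFDerivAt y h1
  have hfun : radialFactor q s = (fun t : ℝ => t ^ (-(q : ℤ))) ∘
      fun y : EuclideanSpace ℝ (Fin m) => ‖y‖ ^ 2 + s := by
    funext y
    simp [radialFactor, zpow_neg]
  have hz : (‖y‖ ^ 2 + s) ^ (-(q : ℤ) - 1) = ((‖y‖ ^ 2 + s) ^ (q + 1))⁻¹ := by
    have : -(q : ℤ) - 1 = -((q + 1 : ℕ) : ℤ) := by push_cast; ring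
    rw [this, zpow_neg, zpow_natCast]
  rw [hfun]
  refine h2.congr_fderiv ?_
  rw [hz]
  ext v
  simp
  ring

theorem contDiffOn_radialFactor {s : ℝ} :
    ContDiffOn ℝ 2 (radialFactor (m := m) q s) {y | ‖y‖ ^ 2 + s ≠ 0} := by
  unfold radialFactor
  refine ContDiffOn.inv ?_ fun y hy => pow_ne_zero _ hy
  exact (((contDiff_norm_sq ℝ).add contDiff_const).pow q).contDiffOn

variable {A : Type*} [NormedRing A] [NormedAlgebra ℝ A] {ι : Type*} [Fintype ι]

/-- The regularized kernel `a(y) (|y|² + s)^{-q}`. -/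
def cauchyKernel (q : ℕ) (s : ℝ) (a : EuclideanSpace ℝ (Fin m) →L[ℝ] A)
    (y : EuclideanSpace ℝ (Fin m)) : A :=
  radialFactor q s y • a y

/-- The Dirac operator with symbol `b`, applied to the derivative of a function. -/
def diracSymbol (b : EuclideanSpace ℝ (Fin m) →L[ℝ] A)
    (g' : EuclideanSpace ℝ (Fin m) →L[ℝ] A) : A :=
  ∑ i, b (EuclideanSpace.single i 1) * g' (EuclideanSpace.single i 1)

theorem sum_smul_single (y : EuclideanSpace ℝ (Fin m)) :
    ∑ i, y i • EuclideanSpace.single i (1 : ℝ) = y := by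
  ext k
  simp [Finset.sum_apply, Pi.single_apply]

theorem hasFDerivAt_cauchyKernel {s : ℝ} (a : EuclideanSpace ℝ (Fin m) →L[ℝ] A)
    {y : EuclideanSpace ℝ (Fin m)} (hy : ‖y‖ ^ 2 + s ≠ 0) :
    HasFDerivAt (cauchyKernel q s a) (radialFactor q s y • a +
      ((-2 * q * ((‖y‖ ^ 2 + s) ^ (q + 1))⁻¹) • innerSL ℝ y).smulRight (a y)) y :=
  (hasFDerivAt_radialFactor hy).smul a.hasFDerivAt

/-- The right Dirac operator applied to the regularized kernel. -/
theorem divergence_cauchyKernel (hm : m = 2 * q) {a b : ι → EuclideanSpace ℝ (Fin m) →L[ℝ] A}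
    {κ : ℝ} (hab : ∀ x, ∑ l, a l x * b l x = (κ * ‖x‖ ^ 2) • (1 : A)) {s : ℝ} (hs : 0 < s)
    {g : EuclideanSpace ℝ (Fin m) → A} (X : EuclideanSpace ℝ (Fin m))
    {Y : EuclideanSpace ℝ (Fin m)} (hg : DifferentiableAt ℝ g Y)
    (hdirac : ∀ l, diracSymbol (b l) (fderiv ℝ g Y) = 0) :
    divergence (fun i Y => ∑ l, cauchyKernel q s (a l) (Y - X) *
      (b l (EuclideanSpace.single i 1) * g Y)) Y =
      (κ * (m * s * radialFactor (q + 1) s (Y - X))) • g Y := by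
  set y := Y - X with hy
  set t := ‖y‖ ^ 2 + s with ht
  have ht0 : t ≠ 0 := by positivity
  have hK : ∀ l, HasFDerivAt (fun Y => cauchyKernel q s (a l) (Y - X)) (radialFactor q s y • a l +
      ((-2 * q * (t ^ (q + 1))⁻¹) • innerSL ℝ y).smulRight (a l y)) Y := fun l => by
    have h1 : HasFDerivAt (cauchyKernel q s (a l)) _ (Y - X) := hasFDerivAt_cauchyKernel (a l) ht0
    exact h1.comp Y ((hasFDerivAt_id Y).sub_const X)
  -- The product rule gives three terms: the derivative of `g` vanishes after summation by the Dirac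
  -- equations, while the derivatives of `a l` and of the radial factor are both evaluated by `hab`.
  have hF : ∀ i, fderiv ℝ (fun Y => ∑ l, cauchyKernel q s (a l) (Y - X) *
      (b l (EuclideanSpace.single i 1) * g Y)) Y (EuclideanSpace.single i 1) =
      ∑ l, cauchyKernel q s (a l) y *
        (b l (EuclideanSpace.single i 1) * fderiv ℝ g Y (EuclideanSpace.single i 1)) +
      (radialFactor q s y • ∑ l, a l (EuclideanSpace.single i 1) * b l (EuclideanSpace.single i 1)) *
        g Y +
      ((-2 * q * (t ^ (q + 1))⁻¹) • ∑ l, a l y * b l (y i • EuclideanSpace.single i 1)) * g Y := by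
    intro i
    have h1 := HasFDerivAt.fun_sum (u := Finset.univ) fun l (_ : l ∈ Finset.univ) =>
      (hK l).fun_mul' (hg.hasFDerivAt.const_mul (b l (EuclideanSpace.single i 1)))
    rw [h1.fderiv]
    simp only [_root_.sum_apply, Finset.smul_sum, Finset.sum_mul, ← Finset.sum_add_distrib]
    refine Finset.sum_congr rfl fun l _ => ?_
    simp only [EuclideanSpace.inner_single_right, _root_.add_apply,
      _root_.smul_apply, ContinuousLinearMap.smulRight_apply, smul_eq_mul,
      innerSL_apply_apply, map_smul]
    rw [op_smul_eq_mul, add_mul, add_assoc]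
    simp only [conj_trivial, one_mul, smul_mul_assoc, mul_smul_comm, smul_smul, mul_assoc]
    rfl
  simp only [divergence, hF, Finset.sum_add_distrib]
  have e1 : ∑ i, ∑ l, cauchyKernel q s (a l) y *
      (b l (EuclideanSpace.single i 1) * fderiv ℝ g Y (EuclideanSpace.single i 1)) = 0 := by
    rw [Finset.sum_comm]
    refine Finset.sum_eq_zero fun l _ => ?_
    rw [← Finset.mul_sum]
    have := hdirac l
    rw [diracSymbol] at this
    rw [this, mul_zero]
  have e2 : ∑ i, (radialFactor q s y • ∑ l, a l (EuclideanSpace.single i 1) *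
      b l (EuclideanSpace.single i 1)) * g Y = (radialFactor q s y * κ * m) • g Y := by
    simp only [hab]
    simp [smul_smul]
    rw [← nsmul_eq_mul, ← Nat.cast_smul_eq_nsmul ℝ, smul_smul]
  have e3 : ∑ i, ((-2 * q * (t ^ (q + 1))⁻¹) • ∑ l, a l y *
      b l (y i • EuclideanSpace.single i 1)) * g Y =
      (-2 * q * (t ^ (q + 1))⁻¹ * (κ * ‖y‖ ^ 2)) • g Y := by
    rw [← Finset.sum_mul, ← Finset.smul_sum, Finset.sum_comm]
    simp only [← Finset.mul_sum, ← _root_.map_sum, sum_smul_single, hab, smul_smul]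
    simp
  rw [e1, e2, e3, zero_add, ← add_smul]
  congr 1
  -- With `t = |y|² + s` and `m = 2q`, the two remaining terms combine through `m t - 2 q |y|² = m
  -- s`. Only the error due to the regularization survives.
  simp only [radialFactor, ← ht]
  have hn : ‖y‖ ^ 2 = t - s := by rw [ht]; ring
  rw [hn, hm]
  push_cast
  field_simp
  ring

theorem contDiffOn_cauchyKernel {s : ℝ} (a : EuclideanSpace ℝ (Fin m) →L[ℝ] A) :
    ContDiffOn ℝ 2 (cauchyKernel q s a) {y | ‖y‖ ^ 2 + s ≠ 0} :=
  contDiffOn_radialFactor.smul a.contDiff.contDiffOn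

theorem radialFactor_nonneg {s : ℝ} (hs : 0 ≤ s) (y : EuclideanSpace ℝ (Fin m)) :
    0 ≤ radialFactor q s y := by
  unfold radialFactor; positivity

/-- Provides the dominating function for the limit `s → 0` on the boundary. -/
theorem norm_cauchyKernel_le {s : ℝ} (hs : 0 ≤ s) (a : EuclideanSpace ℝ (Fin m) →L[ℝ] A)
    {y : EuclideanSpace ℝ (Fin m)} (hy : y ≠ 0) :
    ‖cauchyKernel q s a y‖ ≤ ‖cauchyKernel q 0 a y‖ := by
  have hy' : 0 < ‖y‖ := norm_pos_iff.2 hy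
  simp only [cauchyKernel, norm_smul, Real.norm_eq_abs, abs_of_nonneg (radialFactor_nonneg hs y),
    abs_of_nonneg (radialFactor_nonneg le_rfl y)]
  gcongr
  unfold radialFactor
  gcongr

/-! ### The approximate identity -/

/-- The total mass of the approximate identity given by the divergence of the kernels. -/
def kernelMass (m q : ℕ) : ℝ :=
  ∫ u : EuclideanSpace ℝ (Fin m), m * radialFactor (q + 1) 1 u

theorem continuous_radialFactor {s : ℝ} (hs : 0 < s) :
    Continuous (radialFactor (m := m) q s) := by
  unfold radialFactor
  refine Continuous.inv₀ (by fun_prop) fun y => ?_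
  positivity

/-- The function decays like `|u|^(-2q-2)`, and `2q + 2` exceeds the dimension `m = 2q`. -/
theorem integrable_radialFactor (hm : m = 2 * q) :
    Integrable (radialFactor (m := m) (q + 1) 1) := by
  have h := integrable_rpow_neg_one_add_norm_sq (E := EuclideanSpace ℝ (Fin m)) (μ := volume)
    (r := 2 * q + 2) (by rw [finrank_euclideanSpace, Fintype.card_fin, hm]; push_cast; linarith)
  refine h.congr (Eventually.of_forall fun x => ?_)
  have h0 : 0 ≤ 1 + ‖x‖ ^ 2 := by positivity
  simp only [radialFactor]
  have : -(2 * (q : ℝ) + 2) / 2 = -((q + 1 : ℕ) : ℝ) := by push_cast; ring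
  rw [this, Real.rpow_neg h0, Real.rpow_natCast, add_comm]

theorem kernelMass_pos (hm : m = 2 * q) (hq : 0 < q) : 0 < kernelMass m q := by
  have hmpos : 0 < m := by omega
  rw [kernelMass, integral_pos_iff_support_of_nonneg]
  · have : Function.support (fun u : EuclideanSpace ℝ (Fin m) => m * radialFactor (q + 1) 1 u) =
        univ := by
      ext u
      simp only [Function.mem_support, mem_univ, iff_true, radialFactor]
      positivity
    rw [this]
    exact Measure.measure_univ_pos.2 (NeZero.ne _)
  · intro u
    exact mul_nonneg (Nat.cast_nonneg _) (radialFactor_nonneg zero_le_one u)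
  · exact (integrable_radialFactor hm).const_mul _

/-- With `s = c⁻²` the weight is `c^m φ(c(X - Y))` for `φ(u) = m (|u|² + 1)^(-q-1)`. Since `|u|^m
φ(u) → 0` at infinity, it concentrates at `X` against any integrable function continuous there. -/
theorem tendsto_approximateIdentity (hm : m = 2 * q) (hq : 0 < q)
    {D : Set (EuclideanSpace ℝ (Fin m))} (hD : IsOpen D) {V : Type*} [NormedAddCommGroup V]
    [NormedSpace ℝ V] [CompleteSpace V] {g : EuclideanSpace ℝ (Fin m) → V}
    {X : EuclideanSpace ℝ (Fin m)} (hX : X ∈ D) (hg : IntegrableOn g D) (hgX : ContinuousAt g X) :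
    Tendsto (fun c : ℝ => ∫ Y in D, (m * (c ^ 2)⁻¹ * radialFactor (q + 1) (c ^ 2)⁻¹ (Y - X)) • g Y)
      atTop (𝓝 (kernelMass m q • g X)) := by
  set M := kernelMass m q with hM
  have hMpos : 0 < M := kernelMass_pos hm hq
  have hfin : Module.finrank ℝ (EuclideanSpace ℝ (Fin m)) = m := by simp
  have hdecay : Tendsto (fun x : EuclideanSpace ℝ (Fin m) =>
      ‖x‖ ^ Module.finrank ℝ (EuclideanSpace ℝ (Fin m)) * (M⁻¹ * (m * radialFactor (q + 1) 1 x)))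
      (Bornology.cobounded _) (𝓝 0) := by
    have h1 : Tendsto (fun x : EuclideanSpace ℝ (Fin m) => M⁻¹ * m * (‖x‖ ^ 2 + 1)⁻¹)
        (Bornology.cobounded _) (𝓝 (M⁻¹ * m * 0)) :=
      (tendsto_inv_atTop_zero.comp (tendsto_atTop_add_const_right _ _
        ((tendsto_pow_atTop two_ne_zero).comp tendsto_norm_cobounded_atTop))).const_mul _
    rw [mul_zero] at h1
    refine squeeze_zero (fun x => ?_) (fun x => ?_) h1
    · have := radialFactor_nonneg (q := q + 1) zero_le_one x
      positivity
    · have hpow : ‖x‖ ^ m = (‖x‖ ^ 2) ^ q := by rw [← pow_mul, ← hm]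
      rw [hfin, hpow, radialFactor, pow_succ (‖x‖ ^ 2 + 1) q, mul_inv]
      have h2 : (‖x‖ ^ 2) ^ q * ((‖x‖ ^ 2 + 1) ^ q)⁻¹ ≤ 1 := by
        rw [← div_eq_mul_inv, div_le_one (by positivity)]
        gcongr
        linarith
      calc _ = M⁻¹ * m * (‖x‖ ^ 2 + 1)⁻¹ *
            ((‖x‖ ^ 2) ^ q * ((‖x‖ ^ 2 + 1) ^ q)⁻¹) := by ring
        _ ≤ _ := mul_le_of_le_one_right (by positivity) h2
  have key := tendsto_integral_comp_smul_smul_of_integrable'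
    (μ := (volume : Measure (EuclideanSpace ℝ (Fin m))))
    (φ := fun x => M⁻¹ * (m * radialFactor (q + 1) 1 x)) (fun x => by
      have := radialFactor_nonneg (q := q + 1) zero_le_one x
      positivity) (by
      rw [integral_const_mul]
      exact inv_mul_cancel₀ hMpos.ne') hdecay
    (g := D.indicator g) (x₀ := X) (by rwa [integrable_indicator_iff hD.measurableSet])
    (hgX.congr (by
      filter_upwards [hD.mem_nhds hX] with y hy
      rw [indicator_of_mem hy]))
  have key' := key.const_smul M
  rw [indicator_of_mem hX] at key'
  refine key'.congr' ?_
  filter_upwards [eventually_gt_atTop 0] with c hc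
  rw [← integral_smul, ← integral_indicator hD.measurableSet]
  refine integral_congr_ae (Eventually.of_forall fun Y => ?_)
  by_cases hY : Y ∈ D
  · simp only [indicator_of_mem hY, smul_smul]
    congr 1
    -- The scaling identity behind `s = c⁻²`; the powers of `c` balance because `m = 2q`.
    have hn : ‖c • (X - Y)‖ ^ 2 + 1 = c ^ 2 * (‖Y - X‖ ^ 2 + (c ^ 2)⁻¹) := by
      rw [norm_smul, Real.norm_eq_abs, abs_of_pos hc, norm_sub_rev]
      field_simp
    have hpos : 0 < ‖Y - X‖ ^ 2 + (c ^ 2)⁻¹ := by positivity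
    simp only [radialFactor]
    have hpow : c ^ m = (c ^ 2) ^ q := by rw [← pow_mul, ← hm]
    rw [hn, hfin, hpow, mul_pow, mul_inv]
    field_simp
    ring
  · simp [indicator_of_notMem hY]

end Kernel

end OspMonogenic
end

noncomputable section

namespace OspMonogenic

open MeasureTheory MeasureTheory.Measure Filter Topology Set
open scoped ENNReal NNReal

/-! ### Cauchy formulae -/

/-- `D` is a bounded open set with boundary of class `C²` and outward unit normal `N`. -/
structure IsC2Domain {m : ℕ} (D : Set (EuclideanSpace ℝ (Fin m)))
    (N : EuclideanSpace ℝ (Fin m) → EuclideanSpace ℝ (Fin m)) : Prop where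
  isOpen : IsOpen D
  isBounded : Bornology.IsBounded D
  exists_defining : ∀ x ∈ frontier D, ∃ U ρ, IsDefiningFunctionAt D x U ρ
  normal : IsOutwardNormalField D N

variable {m q : ℕ} {D Ω : Set (EuclideanSpace ℝ (Fin m))}
  {N : EuclideanSpace ℝ (Fin m) → EuclideanSpace ℝ (Fin m)}

theorem IsC2Domain.divergence_theorem (hD : IsC2Domain D N) (hm : 0 < m) {V : Type*}
    [NormedAddCommGroup V] [NormedSpace ℝ V] (hΩ : IsOpen Ω) (hDΩ : closure D ⊆ Ω)
    {F : Fin m → EuclideanSpace ℝ (Fin m) → V}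
    (hF : ∀ j, ∀ x ∈ Ω, DifferentiableAt ℝ (F j) x) (hdiv : ContinuousOn (divergence F) Ω) :
    IntegrableOn (fun y => ∑ j, N y j • F j y) (frontier D) μHE[m - 1] ∧
      ∫ y in frontier D, ∑ j, N y j • F j y ∂μHE[m - 1] = ∫ x in D, divergence F x := by
  obtain ⟨n, rfl⟩ := Nat.exists_eq_succ_of_ne_zero hm.ne'
  exact OspMonogenic.divergence_theorem hD.isOpen hD.isBounded hD.exists_defining hD.normal hΩ hDΩ
    hF hdiv

theorem IsC2Domain.isCompact_frontier (hD : IsC2Domain D N) : IsCompact (frontier D) :=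
  hD.isBounded.isCompact_closure.of_isClosed_subset isClosed_frontier frontier_subset_closure

theorem IsC2Domain.notMem_frontier (hD : IsC2Domain D N) {X : EuclideanSpace ℝ (Fin m)}
    (hX : X ∈ D) : X ∉ frontier D := fun h => h.2 (hD.isOpen.interior_eq.symm ▸ hX)

variable {A : Type*} [NormedRing A] [NormedAlgebra ℝ A] {ι : Type*} [Fintype ι]
  {a b : ι → EuclideanSpace ℝ (Fin m) →L[ℝ] A} {g : EuclideanSpace ℝ (Fin m) → A}

theorem sum_smul_mul (c : EuclideanSpace ℝ (Fin m) →L[ℝ] A) (ν : EuclideanSpace ℝ (Fin m))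
    (t : A) : ∑ i, ν i • (c (EuclideanSpace.single i 1) * t) = c ν * t := by
  conv_rhs => rw [← sum_smul_single ν]
  simp only [_root_.map_sum, map_smul, Finset.sum_mul, smul_mul_assoc]

/-- Links the Dirac equation to the divergence theorem. -/
theorem divergence_symbol_mul {c : EuclideanSpace ℝ (Fin m) →L[ℝ] A}
    {Y : EuclideanSpace ℝ (Fin m)} (hg : DifferentiableAt ℝ g Y) :
    divergence (fun i Y => c (EuclideanSpace.single i 1) * g Y) Y =
      diracSymbol c (fderiv ℝ g Y) := by
  refine Finset.sum_congr rfl fun i _ => ?_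
  rw [(hg.hasFDerivAt.const_mul (c (EuclideanSpace.single i 1))).fderiv]
  simp

/-- No measurability of the field `N` is assumed. Integrability is read off the divergence theorem
for the field `c(e_i) g`, whose divergence is zero by the Dirac equation. -/
theorem IsC2Domain.integrableOn_normal_mul (hD : IsC2Domain D N) (hm : 0 < m) (hΩ : IsOpen Ω)
    (hDΩ : closure D ⊆ Ω) {c : EuclideanSpace ℝ (Fin m) →L[ℝ] A}
    (hg : ∀ x ∈ Ω, DifferentiableAt ℝ g x)
    (hdirac : ∀ x ∈ Ω, diracSymbol c (fderiv ℝ g x) = 0) :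
    IntegrableOn (fun Y => c (N Y) * g Y) (frontier D) μHE[m - 1] := by
  have h := (hD.divergence_theorem hm hΩ hDΩ
    (F := fun i Y => c (EuclideanSpace.single i 1) * g Y)
    (fun j x hx => (hg x hx).const_mul _) (by
      refine (continuousOn_const (c := (0 : A))).congr fun x hx => ?_
      rw [divergence_symbol_mul (hg x hx), hdirac x hx])).1
  simpa only [sum_smul_mul] using h

theorem continuousOn_cauchyKernel_sub {s : ℝ} (hs : 0 ≤ s) (c : EuclideanSpace ℝ (Fin m) →L[ℝ] A)
    {S : Set (EuclideanSpace ℝ (Fin m))} {X : EuclideanSpace ℝ (Fin m)} (hX : X ∉ S) :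
    ContinuousOn (fun Y => cauchyKernel q s c (Y - X)) S := by
  refine (contDiffOn_cauchyKernel c).continuousOn.comp (by fun_prop) fun Y hY => ?_
  have : 0 < ‖Y - X‖ := norm_pos_iff.2 (sub_ne_zero.2 fun h => hX (h ▸ hY))
  have h2 : 0 < ‖Y - X‖ ^ 2 + s := by positivity
  exact h2.ne'

theorem IsC2Domain.integrableOn_kernel_mul (hD : IsC2Domain D N) {s : ℝ} (hs : 0 ≤ s)
    (c : EuclideanSpace ℝ (Fin m) →L[ℝ] A) {X : EuclideanSpace ℝ (Fin m)} (hX : X ∈ D)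
    {T : EuclideanSpace ℝ (Fin m) → A} (hT : IntegrableOn T (frontier D) μHE[m - 1]) :
    IntegrableOn (fun Y => cauchyKernel q s c (Y - X) * T Y) (frontier D) μHE[m - 1] :=
  hT.continuousOn_mul (continuousOn_cauchyKernel_sub hs c (hD.notMem_frontier hX))
    hD.isCompact_frontier

/-- For `s > 0` the kernel has no singularity, so the divergence theorem applies on all of `D`, for
any position of `X`. -/
theorem IsC2Domain.regularized_cauchy_formula (hD : IsC2Domain D N) (hm : m = 2 * q) (hq : 0 < q)
    (hΩ : IsOpen Ω) (hDΩ : closure D ⊆ Ω) {κ : ℝ}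
    (hab : ∀ x, ∑ l, a l x * b l x = (κ * ‖x‖ ^ 2) • (1 : A))
    (hg : ∀ x ∈ Ω, DifferentiableAt ℝ g x)
    (hdirac : ∀ l, ∀ x ∈ Ω, diracSymbol (b l) (fderiv ℝ g x) = 0) {s : ℝ} (hs : 0 < s)
    (X : EuclideanSpace ℝ (Fin m)) :
    ∫ Y in frontier D, ∑ l, cauchyKernel q s (a l) (Y - X) * (b l (N Y) * g Y) ∂μHE[m - 1] =
      κ • ∫ Y in D, (m * s * radialFactor (q + 1) s (Y - X)) • g Y := by
  have hk : ∀ l Y, DifferentiableAt ℝ (fun Y => cauchyKernel q s (a l) (Y - X)) Y := fun l Y => by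
    have h1 := (hasFDerivAt_cauchyKernel (q := q) (s := s) (a l) (y := Y - X)
      (by positivity)).differentiableAt
    exact h1.comp Y (differentiableAt_id.sub_const X)
  have hdivF : ∀ Y ∈ Ω, divergence (fun i Y => ∑ l, cauchyKernel q s (a l) (Y - X) *
      (b l (EuclideanSpace.single i 1) * g Y)) Y =
      (κ * (m * s * radialFactor (q + 1) s (Y - X))) • g Y := fun Y hY =>
    divergence_cauchyKernel hm hab hs X (hg Y hY) fun l => hdirac l Y hY
  have h := (hD.divergence_theorem (by omega) hΩ hDΩ (F := fun i Y => ∑ l,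
    cauchyKernel q s (a l) (Y - X) * (b l (EuclideanSpace.single i 1) * g Y))
    (fun j x hx => DifferentiableAt.fun_sum fun l _ =>
      (hk l x).fun_mul ((hg x hx).const_mul _)) (by
      refine ContinuousOn.congr ?_ hdivF
      refine ContinuousOn.smul ?_ fun x hx => (hg x hx).continuousAt.continuousWithinAt
      have := continuous_radialFactor (m := m) (q := q + 1) hs
      fun_prop)).2
  rw [setIntegral_congr_fun hD.isOpen.measurableSet
    fun Y hY => hdivF Y (hDΩ (subset_closure hY))] at h
  rw [← integral_smul]
  simp only [mul_smul] at h ⊢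
  rw [← h]
  congr 1
  funext Y
  simp only [Finset.smul_sum, ← mul_smul_comm]
  rw [Finset.sum_comm]
  refine Finset.sum_congr rfl fun l _ => ?_
  rw [← Finset.mul_sum]
  simp only [mul_smul_comm]
  rw [sum_smul_mul]

/-- **Cauchy's formula** for pairs of linear maps `a`, `b` such that `∑ a(x) b(x) = κ |x|²`. -/
theorem IsC2Domain.cauchy_formula [CompleteSpace A] (hD : IsC2Domain D N) (hm : m = 2 * q)
    (hq : 0 < q) (hΩ : IsOpen Ω) (hDΩ : closure D ⊆ Ω) {κ : ℝ}
    (hab : ∀ x, ∑ l, a l x * b l x = (κ * ‖x‖ ^ 2) • (1 : A))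
    (hg : ∀ x ∈ Ω, DifferentiableAt ℝ g x)
    (hdirac : ∀ l, ∀ x ∈ Ω, diracSymbol (b l) (fderiv ℝ g x) = 0)
    {X : EuclideanSpace ℝ (Fin m)} (hX : X ∈ D) :
    ∫ Y in frontier D, ∑ l, cauchyKernel q 0 (a l) (Y - X) * (b l (N Y) * g Y) ∂μHE[m - 1] =
      (κ * kernelMass m q) • g X := by
  have hT : ∀ l, IntegrableOn (fun Y => b l (N Y) * g Y) (frontier D) μHE[m - 1] := fun l =>
    hD.integrableOn_normal_mul (by omega) hΩ hDΩ hg (hdirac l)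
  have hgD : IntegrableOn g D :=
    (ContinuousOn.integrableOn_compact hD.isBounded.isCompact_closure fun x hx =>
      (hg x (hDΩ hx)).continuousAt.continuousWithinAt).mono_set subset_closure
  have hvol := (tendsto_approximateIdentity hm hq hD.isOpen hX hgD
    (hg X (hDΩ (subset_closure hX))).continuousAt).const_smul κ
  rw [smul_smul] at hvol
  have hs0 : Tendsto (fun c : ℝ => (c ^ 2)⁻¹) atTop (𝓝 0) :=
    tendsto_inv_atTop_zero.comp (tendsto_pow_atTop two_ne_zero)
  have hbd : Tendsto (fun c : ℝ => ∫ Y in frontier D, ∑ l,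
      cauchyKernel q (c ^ 2)⁻¹ (a l) (Y - X) * (b l (N Y) * g Y) ∂μHE[m - 1]) atTop
      (𝓝 (∫ Y in frontier D, ∑ l,
        cauchyKernel q 0 (a l) (Y - X) * (b l (N Y) * g Y) ∂μHE[m - 1])) := by
    have hFrm : MeasurableSet (frontier D) := isClosed_frontier.measurableSet
    -- `X` lies off the compact frontier, so the singular kernel is bounded there; it dominates all
    -- regularized ones.
    refine tendsto_integral_filter_of_dominated_convergence
      (fun Y => ∑ l, ‖cauchyKernel q 0 (a l) (Y - X)‖ * ‖b l (N Y) * g Y‖) ?_ ?_ ?_ ?_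
    · filter_upwards [eventually_gt_atTop 0] with c hc
      exact (integrable_finsetSum _ fun l _ => hD.integrableOn_kernel_mul (by positivity) (a l) hX
        (hT l)).aestronglyMeasurable
    · filter_upwards [eventually_gt_atTop 0] with c hc
      filter_upwards [ae_restrict_mem hFrm] with Y hY
      refine (norm_sum_le _ _).trans (Finset.sum_le_sum fun l _ => (norm_mul_le _ _).trans ?_)
      gcongr
      exact norm_cauchyKernel_le (by positivity) _
        (sub_ne_zero.2 fun h => hD.notMem_frontier hX (h ▸ hY))
    · refine integrable_finsetSum _ fun l _ => ?_
      exact IntegrableOn.continuousOn_mul (continuousOn_cauchyKernel_sub le_rfl (a l)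
        (hD.notMem_frontier hX)).norm (hT l).norm hD.isCompact_frontier
    · filter_upwards [ae_restrict_mem hFrm] with Y hY
      refine tendsto_finsetSum _ fun l _ => Tendsto.mul_const _ ?_
      have hne : ‖Y - X‖ ^ 2 + 0 ≠ 0 := by
        have : 0 < ‖Y - X‖ :=
          norm_pos_iff.2 (sub_ne_zero.2 fun h => hD.notMem_frontier hX (h ▸ hY))
        positivity
      refine Tendsto.smul_const ?_ _
      have hc : ContinuousAt (fun s : ℝ => radialFactor q s (Y - X)) 0 := by
        unfold radialFactor
        exact ContinuousAt.inv₀ (by fun_prop) (pow_ne_zero _ hne)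
      exact hc.tendsto.comp hs0
  refine tendsto_nhds_unique hbd (hvol.congr' ?_)
  filter_upwards [eventually_gt_atTop 0] with c hc
  exact (hD.regularized_cauchy_formula hm hq hΩ hDΩ hab hg hdirac (by positivity) X).symm

end OspMonogenic
end

noncomputable section

namespace OspMonogenic

open MeasureTheory MeasureTheory.Measure Filter Topology Set
open scoped ENNReal NNReal

/-! ### Differentiation of the Cauchy formula -/

section

variable {m q : ℕ} {D Ω : Set (EuclideanSpace ℝ (Fin m))}
  {N : EuclideanSpace ℝ (Fin m) → EuclideanSpace ℝ (Fin m)}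
  {A : Type*} [NormedRing A] [NormedAlgebra ℝ A] {ι : Type*} [Fintype ι]
  {a b : ι → EuclideanSpace ℝ (Fin m) →L[ℝ] A} {g : EuclideanSpace ℝ (Fin m) → A}

theorem setOf_norm_sq_add_zero_ne_zero :
    {y : EuclideanSpace ℝ (Fin m) | ‖y‖ ^ 2 + 0 ≠ 0} = {0}ᶜ := by
  ext y
  simp [Set.mem_ofPred_eq]

theorem differentiableAt_cauchyKernel_zero (c : EuclideanSpace ℝ (Fin m) →L[ℝ] A)
    {y : EuclideanSpace ℝ (Fin m)} (hy : y ≠ 0) : DifferentiableAt ℝ (cauchyKernel q 0 c) y :=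
  (hasFDerivAt_cauchyKernel c (by simpa using hy)).differentiableAt

theorem continuousOn_fderiv_cauchyKernel (c : EuclideanSpace ℝ (Fin m) →L[ℝ] A) :
    ContinuousOn (fderiv ℝ (cauchyKernel q 0 c)) {0}ᶜ := by
  have h := contDiffOn_cauchyKernel (q := q) (s := 0) c
  rw [setOf_norm_sq_add_zero_ne_zero] at h
  exact h.continuousOn_fderiv_of_isOpen isOpen_compl_singleton (by norm_num)

theorem hasFDerivAt_cauchyKernel_sub (c : EuclideanSpace ℝ (Fin m) →L[ℝ] A)
    {X Y : EuclideanSpace ℝ (Fin m)} (h : Y - X ≠ 0) :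
    HasFDerivAt (fun X' => cauchyKernel q 0 c (Y - X'))
      (-fderiv ℝ (cauchyKernel q 0 c) (Y - X)) X := by
  have h1 := (differentiableAt_cauchyKernel_zero (q := q) c h).hasFDerivAt.comp X
    ((hasFDerivAt_id X).const_sub Y)
  refine h1.congr_fderiv ?_
  ext v
  simp

theorem norm_mul_flip_comp_le (t : A) (f : EuclideanSpace ℝ (Fin m) →L[ℝ] A) :
    ‖(ContinuousLinearMap.mul ℝ A).flip t ∘L f‖ ≤ ‖f‖ * ‖t‖ := by
  refine ContinuousLinearMap.opNorm_le_bound _ (by positivity) fun v => ?_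
  simp only [ContinuousLinearMap.comp_apply, ContinuousLinearMap.flip_apply,
    ContinuousLinearMap.mul_apply']
  calc ‖f v * t‖ ≤ ‖f v‖ * ‖t‖ := norm_mul_le _ _
    _ ≤ ‖f‖ * ‖v‖ * ‖t‖ := by gcongr; exact f.le_opNorm v
    _ = _ := by ring

/-- Applying to the Cauchy formula a first order operator that commutes with right multiplications
and annihilates the function. -/
theorem IsC2Domain.cauchy_formula_derivation [CompleteSpace A] (hD : IsC2Domain D N)
    (hm : m = 2 * q) (hq : 0 < q) (hΩ : IsOpen Ω) (hDΩ : closure D ⊆ Ω) {κ : ℝ}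
    (hab : ∀ x, ∑ l, a l x * b l x = (κ * ‖x‖ ^ 2) • (1 : A))
    (hg : ∀ x ∈ Ω, DifferentiableAt ℝ g x)
    (hdirac : ∀ l, ∀ x ∈ Ω, diracSymbol (b l) (fderiv ℝ g x) = 0)
    {X : EuclideanSpace ℝ (Fin m)} (hX : X ∈ D)
    (Λ : (EuclideanSpace ℝ (Fin m) →L[ℝ] A) →L[ℝ] A)
    (hΛ : ∀ f t, Λ ((ContinuousLinearMap.mul ℝ A).flip t ∘L f) = Λ f * t)
    (hΛg : Λ (fderiv ℝ g X) = 0) :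
    IntegrableOn (fun Y => ∑ l, Λ (fderiv ℝ (fun X' => cauchyKernel q 0 (a l) (Y - X')) X) *
        (b l (N Y) * g Y)) (frontier D) μHE[m - 1] ∧
      ∫ Y in frontier D, ∑ l, Λ (fderiv ℝ (fun X' => cauchyKernel q 0 (a l) (Y - X')) X) *
        (b l (N Y) * g Y) ∂μHE[m - 1] = 0 := by
  have hT : ∀ l, IntegrableOn (fun Y => b l (N Y) * g Y) (frontier D) μHE[m - 1] := fun l =>
    hD.integrableOn_normal_mul (by omega) hΩ hDΩ hg (hdirac l)
  have hFrm : MeasurableSet (frontier D) := isClosed_frontier.measurableSet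
  obtain ⟨δ, hδ, hball⟩ := Metric.nhds_basis_closedBall.mem_iff.1 (hD.isOpen.mem_nhds hX)
  have hne : ∀ X' ∈ D, ∀ Y ∈ frontier D, Y - X' ≠ 0 := fun X' hX' Y hY =>
    sub_ne_zero.2 fun h => hD.notMem_frontier hX' (h ▸ hY)
  -- The closed ball and the frontier are disjoint compact sets, so `Y - X'` stays away from the
  -- singularity and the derivatives are uniformly bounded. This is the domination needed to
  -- differentiate under the integral.
  have hbound : ∀ l, ∃ C, ∀ X' ∈ Metric.closedBall X δ, ∀ Y ∈ frontier D,
      ‖-fderiv ℝ (cauchyKernel q 0 (a l)) (Y - X')‖ ≤ C := fun l => by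
    obtain ⟨C, hC⟩ := ((isCompact_closedBall X δ).prod hD.isCompact_frontier).exists_bound_of_continuousOn
      (f := fun w => -fderiv ℝ (cauchyKernel q 0 (a l)) (w.2 - w.1))
      (((continuousOn_fderiv_cauchyKernel (a l)).comp (by fun_prop)
        fun w hw => hne w.1 (hball hw.1) w.2 hw.2).neg)
    exact ⟨C, fun X' hX' Y hY => hC (X', Y) ⟨hX', hY⟩⟩
  choose C hC using hbound
  set F' : EuclideanSpace ℝ (Fin m) → EuclideanSpace ℝ (Fin m) →
      EuclideanSpace ℝ (Fin m) →L[ℝ] A := fun X' Y => ∑ l,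
    (ContinuousLinearMap.mul ℝ A).flip (b l (N Y) * g Y) ∘L
      (-fderiv ℝ (cauchyKernel q 0 (a l)) (Y - X')) with hF'
  have hF'm : AEStronglyMeasurable (F' X) (μHE[m - 1].restrict (frontier D)) := by
    refine Finset.aestronglyMeasurable_fun_sum _ fun l _ => ?_
    have h1 : AEStronglyMeasurable (fun Y => -fderiv ℝ (cauchyKernel q 0 (a l)) (Y - X))
        (μHE[m - 1].restrict (frontier D)) :=
      (((continuousOn_fderiv_cauchyKernel (a l)).comp (by fun_prop)
        fun Y hY => hne X hX Y hY).neg).aestronglyMeasurable hFrm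
    have h2 := ((ContinuousLinearMap.mul ℝ A).flip).continuous.comp_aestronglyMeasurable
      (hT l).aestronglyMeasurable
    exact (ContinuousLinearMap.compL ℝ _ A A).aestronglyMeasurable_comp₂ h2 h1
  have hF'b : ∀ X' ∈ Metric.closedBall X δ, ∀ Y ∈ frontier D,
      ‖F' X' Y‖ ≤ ∑ l, C l * ‖b l (N Y) * g Y‖ := fun X' hX' Y hY =>
    (norm_sum_le _ _).trans (Finset.sum_le_sum fun l _ => (norm_mul_flip_comp_le _ _).trans
      (mul_le_mul_of_nonneg_right (hC l X' hX' Y hY) (norm_nonneg _)))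
  have hbi : IntegrableOn (fun Y => ∑ l, C l * ‖b l (N Y) * g Y‖) (frontier D) μHE[m - 1] :=
    integrable_finsetSum _ fun l _ => (hT l).norm.const_mul (C l)
  have hFi : ∀ X' ∈ D, IntegrableOn (fun Y => ∑ l, cauchyKernel q 0 (a l) (Y - X') *
      (b l (N Y) * g Y)) (frontier D) μHE[m - 1] := fun X' hX' =>
    integrable_finsetSum _ fun l _ => hD.integrableOn_kernel_mul le_rfl (a l) hX' (hT l)
  have hF'i : IntegrableOn (F' X) (frontier D) μHE[m - 1] := by
    refine Integrable.mono' hbi hF'm ?_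
    filter_upwards [ae_restrict_mem hFrm] with Y hY
    exact hF'b X (Metric.mem_closedBall_self hδ.le) Y hY
  have hderiv := hasFDerivAt_integral_of_dominated_of_fderiv_le (𝕜 := ℝ)
    (μ := μHE[m - 1].restrict (frontier D))
    (F := fun X' Y => ∑ l, cauchyKernel q 0 (a l) (Y - X') * (b l (N Y) * g Y)) (F' := F')
    (Metric.closedBall_mem_nhds X hδ)
    (by
      filter_upwards [hD.isOpen.mem_nhds hX] with X' hX'
      exact (hFi X' hX').aestronglyMeasurable) (hFi X hX) hF'm
    (by
      filter_upwards [ae_restrict_mem hFrm] with Y hY X' hX'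
      exact hF'b X' hX' Y hY) hbi
    (by
      filter_upwards [ae_restrict_mem hFrm] with Y hY X' hX'
      refine HasFDerivAt.fun_sum fun l _ => ?_
      exact ((ContinuousLinearMap.mul ℝ A).flip (b l (N Y) * g Y)).hasFDerivAt.comp X'
        (hasFDerivAt_cauchyKernel_sub (a l) (hne X' (hball hX') Y hY)))
  have hg' : HasFDerivAt (fun X' => ∫ Y in frontier D, ∑ l, cauchyKernel q 0 (a l) (Y - X') *
      (b l (N Y) * g Y) ∂μHE[m - 1]) ((κ * kernelMass m q) • fderiv ℝ g X) X := by
    refine ((hg X (hDΩ (subset_closure hX))).hasFDerivAt.const_smul _).congr_of_eventuallyEq ?_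
    filter_upwards [hD.isOpen.mem_nhds hX] with X' hX'
    exact hD.cauchy_formula hm hq hΩ hDΩ hab hg hdirac hX'
  -- Near `X` the integral equals a multiple of `g`, so its derivative is computed in two ways;
  -- applying `Λ` annihilates the side with `g`.
  have heq := hderiv.unique hg'
  have hΛF : ∀ Y ∈ frontier D, Λ (F' X Y) =
      ∑ l, Λ (fderiv ℝ (fun X' => cauchyKernel q 0 (a l) (Y - X')) X) * (b l (N Y) * g Y) := by
    intro Y hY
    simp only [hF', _root_.map_sum, hΛ]
    refine Finset.sum_congr rfl fun l _ => ?_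
    rw [(hasFDerivAt_cauchyKernel_sub (a l) (hne X hX Y hY)).fderiv]
  have hint : IntegrableOn (fun Y => Λ (F' X Y)) (frontier D) μHE[m - 1] :=
    Λ.integrable_comp hF'i
  refine ⟨hint.congr_fun hΛF hFrm, ?_⟩
  rw [← setIntegral_congr_fun hFrm hΛF, Λ.integral_comp_comm hF'i, heq, map_smul, hΛg, smul_zero]

end

/-! ### The area of the unit sphere -/

section

variable {m q : ℕ}

theorem isDefiningFunctionAt_ball {x : EuclideanSpace ℝ (Fin m)} (hx : x ≠ 0) :
    IsDefiningFunctionAt (Metric.ball 0 1) x univ (fun y => ‖y‖ ^ 2 - 1) ∧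
      ∇ (fun y : EuclideanSpace ℝ (Fin m) => ‖y‖ ^ 2 - 1) x = (2 : ℝ) • x := by
  have hgrad : ∇ (fun y : EuclideanSpace ℝ (Fin m) => ‖y‖ ^ 2 - 1) x = (2 : ℝ) • x := by
    refine HasGradientAt.gradient ?_
    rw [hasGradientAt_iff_hasFDerivAt]
    refine ((hasStrictFDerivAt_norm_sq x).hasFDerivAt.sub_const 1).congr_fderiv ?_
    ext v
    simp
  refine ⟨⟨isOpen_univ, mem_univ x, ((contDiff_norm_sq ℝ).sub contDiff_const).contDiffOn, ?_, ?_⟩,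
    hgrad⟩
  · rw [hgrad]
    exact smul_ne_zero two_ne_zero hx
  · ext y
    simp [Set.mem_ofPred_eq, sq_lt_one_iff_abs_lt_one]

theorem isC2Domain_ball :
    IsC2Domain (Metric.ball (0 : EuclideanSpace ℝ (Fin m)) 1) id := by
  have hne : ∀ x ∈ frontier (Metric.ball (0 : EuclideanSpace ℝ (Fin m)) 1), ‖x‖ = 1 ∧ x ≠ 0 := by
    intro x hx
    rw [frontier_ball _ one_ne_zero, mem_sphere_zero_iff_norm] at hx
    exact ⟨hx, norm_ne_zero_iff.1 (by rw [hx]; exact one_ne_zero)⟩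
  refine ⟨Metric.isOpen_ball, Metric.isBounded_ball, fun x hx =>
    ⟨_, _, (isDefiningFunctionAt_ball (hne x hx).2).1⟩, fun x hx U ρ h => ?_⟩
  obtain ⟨h1, h2⟩ := isDefiningFunctionAt_ball (hne x hx).2
  rw [h.normal_unique h1 Metric.isOpen_ball hx, h2, norm_smul, (hne x hx).1]
  simp

/-- Cauchy's formula at the centre of the unit ball, with real scalars, `a l = b l` the coordinates
and `g = 1`: on the sphere the integrand `∑ Y_l² / |Y|^m` is `1`. -/
theorem kernelMass_eq_sphere (hm : m = 2 * q) (hq : 0 < q) :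
    (μHE[m - 1] (Metric.sphere (0 : EuclideanSpace ℝ (Fin m)) 1)).toReal = kernelMass m q := by
  have h := (isC2Domain_ball (m := m)).cauchy_formula (A := ℝ) (ι := Fin m)
    (a := fun l => EuclideanSpace.proj l) (b := fun l => EuclideanSpace.proj l) (g := fun _ => 1)
    (κ := 1) (X := 0) hm hq isOpen_univ (subset_univ _)
    (fun x => by simp [EuclideanSpace.norm_sq_eq, ← pow_two]) (fun x _ => by fun_prop)
    (fun l x _ => by simp [diracSymbol]) (Metric.mem_ball_self one_pos)
  rw [frontier_ball _ one_ne_zero] at h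
  rw [setIntegral_congr_fun (g := fun _ => (1 : ℝ)) Metric.isClosed_sphere.measurableSet] at h
  · simpa [measureReal_def] using h
  · intro Y hY
    rw [mem_sphere_zero_iff_norm] at hY
    have : ∑ i, Y i * Y i = 1 := by
      have := EuclideanSpace.norm_sq_eq Y
      simpa [hY, ← pow_two] using this.symm
    simpa [cauchyKernel, radialFactor, hY] using this

end

end OspMonogenic
end

noncomputable section

namespace OspMonogenic

open MeasureTheory MeasureTheory.Measure Filter Topology Set
open scoped ENNReal NNReal

/-! ### Pairs of indices -/

/-- The enumeration `(a, k) ↦ 2k + a` of an even number of indices by pairs. -/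
def pairEquiv {n N : ℕ} (h : N = 2 * n) : Fin 2 × Fin n ≃ Fin N where
  toFun x := ⟨2 * x.2.1 + x.1.1, by omega⟩
  invFun i := (⟨i.1 % 2, by omega⟩, ⟨i.1 / 2, by omega⟩)
  left_inv x := by
    ext
    · simp; omega
    · simp; omega
  right_inv i := by
    ext
    simp; omega

theorem sum_pairs {n N : ℕ} (h : N = 2 * n) {M : Type*} [AddCommMonoid M] (F : Fin N → M) :
    ∑ i, F i = ∑ k, (F (pairEquiv h (0, k)) + F (pairEquiv h (1, k))) := by
  rw [← (pairEquiv h).sum_comp, Fintype.sum_prod_type, Fin.sum_univ_two, Finset.sum_add_distrib]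

variable {p : ℕ}

theorem sum_coordinates {M : Type*} [AddCommMonoid M] (F : Fin (4 * p) → M) :
    ∑ i, F i = ∑ k, (F (xIdx k) + F (yIdx k)) :=
  sum_pairs (n := 2 * p) (by omega) F

theorem sum_quaternionic {M : Type*} [AddCommMonoid M] (F : Fin (2 * p) → M) :
    ∑ k, F k = ∑ j, (F (fstIdx j) + F (sndIdx j)) :=
  sum_pairs (n := p) rfl F

/-! ### Complex coordinates -/

theorem zCoord_apply (k : Fin (2 * p)) (X : Space p) :
    zCoord k X = X (xIdx k) + Complex.I * X (yIdx k) := rfl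

theorem zcCoord_apply (k : Fin (2 * p)) (X : Space p) :
    zcCoord k X = X (xIdx k) - Complex.I * X (yIdx k) := rfl

theorem conj_zCoord (k : Fin (2 * p)) (X : Space p) :
    (starRingEnd ℂ) (zCoord k X) = zcCoord k X := by
  simp [zCoord_apply, zcCoord_apply, sub_eq_add_neg]

theorem conj_zcCoord (k : Fin (2 * p)) (X : Space p) :
    (starRingEnd ℂ) (zcCoord k X) = zCoord k X := by
  rw [← conj_zCoord, Complex.conj_conj]

theorem coframe_xIdx (k : Fin (2 * p)) : coframe (xIdx k) = zCoord k := by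
  have h : (xIdx k).1 % 2 = 0 := by simp [xIdx]
  rw [coframe, if_pos h]
  congr 1
  ext
  simp [xIdx]

theorem coframe_yIdx (k : Fin (2 * p)) : coframe (yIdx k) = zcCoord k := by
  have h : ¬ (yIdx k).1 % 2 = 0 := by simp [yIdx]
  rw [coframe, if_neg h]
  congr 1
  ext
  simp [yIdx]
  omega

theorem sum_zCoord_mul_zcCoord (X : Space p) :
    ∑ k, zCoord k X * zcCoord k X = ((‖X‖ ^ 2 : ℝ) : ℂ) := by
  rw [EuclideanSpace.norm_sq_eq, sum_coordinates]
  push_cast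
  refine Finset.sum_congr rfl fun k _ => ?_
  rw [zCoord_apply, zcCoord_apply]
  simp only [Real.norm_eq_abs, ← Complex.ofReal_pow, sq_abs]
  push_cast
  linear_combination (-(X (yIdx k) : ℂ) ^ 2) * Complex.I_sq

/-! ### Determinant and minors of the complex coframe -/

/-- The matrix of the complex coframe with respect to the standard basis. -/
def coframeMatrix (p : ℕ) : Matrix (Fin (4 * p)) (Fin (4 * p)) ℂ :=
  Matrix.of fun i j => coframe j (EuclideanSpace.single i 1)

theorem xIdx_injective : Function.Injective (xIdx (p := p)) := fun k l h => by
  simp only [xIdx, Fin.mk.injEq] at h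
  ext; omega

theorem yIdx_injective : Function.Injective (yIdx (p := p)) := fun k l h => by
  simp only [yIdx, Fin.mk.injEq] at h
  ext; omega

theorem xIdx_ne_yIdx (k l : Fin (2 * p)) : xIdx k ≠ yIdx l := fun h => by
  simp only [xIdx, yIdx, Fin.mk.injEq] at h
  omega

theorem zCoord_single_xIdx (k l : Fin (2 * p)) :
    zCoord k (EuclideanSpace.single (xIdx l) 1) = if k = l then 1 else 0 := by
  simp [zCoord_apply, (xIdx_ne_yIdx l k).symm, xIdx_injective.eq_iff, apply_ite Complex.ofReal]

theorem zCoord_single_yIdx (k l : Fin (2 * p)) :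
    zCoord k (EuclideanSpace.single (yIdx l) 1) = if k = l then Complex.I else 0 := by
  simp [zCoord_apply, (xIdx_ne_yIdx k l), yIdx_injective.eq_iff, apply_ite Complex.ofReal]

theorem zcCoord_single_xIdx (k l : Fin (2 * p)) :
    zcCoord k (EuclideanSpace.single (xIdx l) 1) = if k = l then 1 else 0 := by
  rw [← conj_zCoord, zCoord_single_xIdx]
  split <;> simp

theorem zcCoord_single_yIdx (k l : Fin (2 * p)) :
    zcCoord k (EuclideanSpace.single (yIdx l) 1) = if k = l then -Complex.I else 0 := by
  rw [← conj_zCoord, zCoord_single_yIdx]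
  split <;> simp

theorem coframeMatrix_reindex : (coframeMatrix p).submatrix (pairEquiv (n := 2 * p) (by omega))
    (pairEquiv (n := 2 * p) (by omega)) =
      Matrix.blockDiagonal fun _ => !![1, 1; Complex.I, -Complex.I] := by
  have hx : ∀ k : Fin (2 * p), pairEquiv (N := 4 * p) (by omega) (0, k) = xIdx k := fun k => rfl
  have hy : ∀ k : Fin (2 * p), pairEquiv (N := 4 * p) (by omega) (1, k) = yIdx k := fun k => rfl
  ext ⟨i, k⟩ ⟨j, l⟩
  fin_cases i <;> fin_cases j <;>
    simp [Matrix.blockDiagonal_apply, coframeMatrix, hx, hy, coframe_xIdx, coframe_yIdx,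
      zCoord_single_xIdx, zCoord_single_yIdx, zcCoord_single_xIdx, zcCoord_single_yIdx,
      eq_comm (a := l)]

theorem det_coframeMatrix : (coframeMatrix p).det = (-2 * Complex.I) ^ (2 * p) := by
  rw [← Matrix.det_submatrix_equiv_self (pairEquiv (n := 2 * p) (by omega)), coframeMatrix_reindex,
    Matrix.det_blockDiagonal]
  simp only [Matrix.det_fin_two_of, Finset.prod_const, Finset.card_univ, Fintype.card_fin]
  congr 1
  ring

/-- Each `2 × 2` block satisfies `B B* = 2`, so the inverse is half the conjugate transpose. -/
theorem coframeMatrix_mul_conjTranspose :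
    coframeMatrix p * ((1 / 2 : ℂ) • (coframeMatrix p).conjTranspose) = 1 := by
  ext i i'
  rw [Matrix.mul_apply, sum_coordinates]
  simp only [coframeMatrix, Matrix.smul_apply, Matrix.conjTranspose_apply, Matrix.of_apply,
    coframe_xIdx, coframe_yIdx, RCLike.star_def, conj_zCoord, conj_zcCoord, smul_eq_mul]
  obtain ⟨⟨a, k⟩, rfl⟩ := (pairEquiv (n := 2 * p) (N := 4 * p) (by omega)).surjective i
  obtain ⟨⟨a', k'⟩, rfl⟩ := (pairEquiv (n := 2 * p) (N := 4 * p) (by omega)).surjective i'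
  have hx : ∀ k : Fin (2 * p), pairEquiv (N := 4 * p) (by omega) (0, k) = xIdx k := fun k => rfl
  have hy : ∀ k : Fin (2 * p), pairEquiv (N := 4 * p) (by omega) (1, k) = yIdx k := fun k => rfl
  fin_cases a <;> fin_cases a' <;>
    simp [hx, hy, zCoord_single_xIdx, zCoord_single_yIdx, zcCoord_single_xIdx,
      zcCoord_single_yIdx, Matrix.one_apply, xIdx_injective.eq_iff, yIdx_injective.eq_iff,
      xIdx_ne_yIdx, (xIdx_ne_yIdx _ _).symm, Finset.sum_add_distrib, eq_comm (a := k')]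
  · split <;> norm_num
  · split <;> ring
  · split
    · linear_combination -Complex.I_sq
    · simp

/-- The forms with one omitted factor have minors of the coframe as values on basis vectors; the
adjugate collects all these minors at once, as determinant times inverse. -/
theorem adjugate_coframeMatrix : (coframeMatrix p).adjugate =
    (-2 * Complex.I) ^ (2 * p) • ((1 / 2 : ℂ) • (coframeMatrix p).conjTranspose) := by
  rw [← det_coframeMatrix]
  calc (coframeMatrix p).adjugate = (coframeMatrix p).adjugate *
        (coframeMatrix p * ((1 / 2 : ℂ) • (coframeMatrix p).conjTranspose)) := by
        rw [coframeMatrix_mul_conjTranspose, mul_one]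
    _ = _ := by rw [← mul_assoc, Matrix.adjugate_mul, Matrix.smul_mul, one_mul]

/-- The row and column maps are described only by their values. The cofactor formula thus applies to
`omitIdx`, where the size `4 * p` is not presented as a successor. -/
theorem adjugate_eq_det_submatrix {R : Type*} [CommRing R] {N : ℕ} (C : Matrix (Fin N) (Fin N) R)
    (i j : Fin N) (r c : Fin (N - 1) → Fin N)
    (hr : ∀ a, (r a).1 = if a.1 < i.1 then a.1 else a.1 + 1)
    (hc : ∀ a, (c a).1 = if a.1 < j.1 then a.1 else a.1 + 1) :
    C.adjugate j i = (-1) ^ (i.1 + j.1) * (C.submatrix r c).det := by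
  obtain ⟨n, rfl⟩ := Nat.exists_eq_succ_of_ne_zero (Fin.pos i).ne'
  have hr' : r = i.succAbove := by
    funext a
    ext
    rw [hr a]
    simp [Fin.succAbove, Fin.lt_def, apply_ite Fin.val]
  have hc' : c = j.succAbove := by
    funext a
    ext
    rw [hc a]
    simp [Fin.succAbove, Fin.lt_def, apply_ite Fin.val]
  rw [Matrix.adjugate_fin_succ_eq_det_submatrix, hr', hc']

end OspMonogenic
end

noncomputable section

namespace OspMonogenic

open MeasureTheory MeasureTheory.Measure Filter Topology Set
open scoped ENNReal NNReal

/-! ### Witt bases -/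

variable {p : ℕ}

instance : CompleteSpace (Cl p) := FiniteDimensional.complete ℂ (Cl p)

theorem eGen_anticomm (i j : Fin (4 * p)) :
    eGen i * eGen j + eGen j * eGen i = (if i = j then -2 else 0 : ℂ) • (1 : Cl p) := by
  have h : QuadraticMap.polar (cliffordForm p) (Pi.single i 1) (Pi.single j 1) =
      if i = j then -2 else 0 := by
    simp only [QuadraticMap.polar, cliffordForm, QuadraticMap.weightedSumSquares_apply,
      ← Finset.sum_sub_distrib]
    have : ∀ k, (-1 : ℂ) • ((Pi.single i 1 + Pi.single j 1 : Fin (4 * p) → ℂ) k *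
        (Pi.single i 1 + Pi.single j 1 : Fin (4 * p) → ℂ) k) -
        (-1 : ℂ) • ((Pi.single i 1 : Fin (4 * p) → ℂ) k * (Pi.single i 1 : Fin (4 * p) → ℂ) k) -
        (-1 : ℂ) • ((Pi.single j 1 : Fin (4 * p) → ℂ) k * (Pi.single j 1 : Fin (4 * p) → ℂ) k) =
        (-2 * (Pi.single j 1 : Fin (4 * p) → ℂ) k) * (Pi.single i 1 : Fin (4 * p) → ℂ) k := by
      intro k
      simp only [Pi.add_apply, smul_eq_mul]
      ring
    simp only [this]
    simp [Pi.single_apply]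
  rw [← h, ← Algebra.algebraMap_eq_smul_one]
  exact CliffordAlgebra.ι_mul_ι_add_swap _ _

theorem anticomm_smul_add_smul (α β γ ε : ℂ) (u v s t : Cl p) :
    (α • (u + β • v)) * (γ • (s + ε • t)) + (γ • (s + ε • t)) * (α • (u + β • v)) =
      (α * γ) • ((u * s + s * u) + ε • (u * t + t * u) + β • (v * s + s * v) +
        (β * ε) • (v * t + t * v)) := by
  simp only [smul_mul_assoc, mul_smul_comm, mul_add, add_mul]
  module

/-- The canonical anticommutation relations of Witt bases. -/
structure IsWittBasis (w w' : Fin (2 * p) → Cl p) : Prop where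
  anticomm : ∀ k l, w k * w l + w l * w k = 0
  anticomm' : ∀ k l, w' k * w' l + w' l * w' k = 0
  anticomm_dual : ∀ k l, w k * w' l + w' l * w k = if k = l then 1 else 0

theorem isWittBasis_wittF : IsWittBasis (wittF (p := p)) wittFd := by
  have hF : ∀ k : Fin (2 * p), wittF k =
      (-(1 / 2) : ℂ) • (eGen (xIdx k) + (-Complex.I) • eGen (yIdx k)) := fun k => by
    rw [wittF, neg_smul Complex.I, sub_eq_add_neg]
  refine ⟨fun k l => ?_, fun k l => ?_, fun k l => ?_⟩
  · rw [hF, hF, anticomm_smul_add_smul]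
    simp only [eGen_anticomm, xIdx_injective.eq_iff, yIdx_injective.eq_iff, xIdx_ne_yIdx,
      (xIdx_ne_yIdx _ _).symm]
    split <;> simp
  · rw [wittFd, wittFd, anticomm_smul_add_smul]
    simp only [eGen_anticomm, xIdx_injective.eq_iff, yIdx_injective.eq_iff, xIdx_ne_yIdx,
      (xIdx_ne_yIdx _ _).symm]
    split <;> simp
  · rw [hF, wittFd, anticomm_smul_add_smul]
    simp only [eGen_anticomm, xIdx_injective.eq_iff, yIdx_injective.eq_iff, xIdx_ne_yIdx,
      (xIdx_ne_yIdx _ _).symm]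
    split
    · simp [smul_smul]
      rw [← add_smul]
      norm_num
    · simp

/-- The quaternionic rotation `w ↦ w^J` of a family of Clifford numbers. -/
def rotate (w : Fin (2 * p) → Cl p) (k : Fin (2 * p)) : Cl p :=
  if h : k.1 % 2 = 0 then -w ⟨k.1 + 1, by omega⟩ else w ⟨k.1 - 1, by omega⟩

theorem rotate_fstIdx (w : Fin (2 * p) → Cl p) (j : Fin p) :
    rotate w (fstIdx j) = -w (sndIdx j) :=
  dif_pos (by simp [fstIdx])

theorem rotate_sndIdx (w : Fin (2 * p) → Cl p) (j : Fin p) :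
    rotate w (sndIdx j) = w (fstIdx j) :=
  dif_neg (by simp [sndIdx])

theorem eq_fstIdx_or_eq_sndIdx (k : Fin (2 * p)) : ∃ j, k = fstIdx j ∨ k = sndIdx j := by
  refine ⟨⟨k.1 / 2, by omega⟩, ?_⟩
  simp only [fstIdx, sndIdx, Fin.ext_iff]
  omega

theorem fstIdx_inj {j j' : Fin p} : fstIdx j = fstIdx j' ↔ sndIdx j = sndIdx j' := by
  simp [fstIdx, sndIdx, Fin.ext_iff]

theorem fstIdx_ne_sndIdx (j j' : Fin p) : fstIdx j ≠ sndIdx j' := by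
  simp only [fstIdx, sndIdx, ne_eq, Fin.ext_iff]
  omega

namespace IsWittBasis

variable {w w' : Fin (2 * p) → Cl p}

theorem symm (h : IsWittBasis w w') : IsWittBasis w' w :=
  ⟨h.anticomm', h.anticomm, fun k l => by
    rw [add_comm, h.anticomm_dual l k]
    simp only [eq_comm]⟩

/-- The rotation permutes indices within each pair and puts the same sign on `w k` and `w' k`, so
signs cancel in the dual relations. It reduces the formulae with `J` to those without. -/
theorem rotate (h : IsWittBasis w w') :
    IsWittBasis (OspMonogenic.rotate w) (OspMonogenic.rotate w') := by
  constructor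
  all_goals
    intro k l
    obtain ⟨j, rfl | rfl⟩ := eq_fstIdx_or_eq_sndIdx k <;>
    obtain ⟨j', rfl | rfl⟩ := eq_fstIdx_or_eq_sndIdx l <;>
    simp only [rotate_fstIdx, rotate_sndIdx, neg_mul, mul_neg, neg_neg, ← neg_add, h.anticomm,
      h.anticomm', h.anticomm_dual, neg_zero, fstIdx_ne_sndIdx, (fstIdx_ne_sndIdx _ _).symm,
      fstIdx_inj, if_false]

end IsWittBasis

/-! ### Vector variables and Dirac operators -/

/-- The linear map `X ↦ ∑ z_k w_k`. -/
def zSum (w : Fin (2 * p) → Cl p) : Space p →L[ℝ] Cl p :=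
  LinearMap.toContinuousLinearMap
    (∑ k, (LinearMap.toSpanSingleton ℂ (Cl p) (w k)).restrictScalars ℝ ∘ₗ zCoord k)

/-- The linear map `X ↦ ∑ z_k^c w_k`. -/
def zcSum (w : Fin (2 * p) → Cl p) : Space p →L[ℝ] Cl p :=
  LinearMap.toContinuousLinearMap
    (∑ k, (LinearMap.toSpanSingleton ℂ (Cl p) (w k)).restrictScalars ℝ ∘ₗ zcCoord k)

theorem zSum_apply (w : Fin (2 * p) → Cl p) (X : Space p) : zSum w X = ∑ k, zCoord k X • w k := by
  simp [zSum]

theorem zcSum_apply (w : Fin (2 * p) → Cl p) (X : Space p) :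
    zcSum w X = ∑ k, zcCoord k X • w k := by
  simp [zcSum]

theorem vecZ_eq (X : Space p) : vecZ X = zSum wittF X := (zSum_apply _ _).symm

theorem vecZd_eq (X : Space p) : vecZd X = zcSum wittFd X := (zcSum_apply _ _).symm

theorem vecZJ_eq (X : Space p) : vecZJ X = zSum (rotate wittFd) X := by
  rw [zSum_apply, sum_quaternionic, vecZJ]
  refine Finset.sum_congr rfl fun j _ => ?_
  rw [rotate_fstIdx, rotate_sndIdx, smul_neg]
  abel

theorem vecZdJ_eq (X : Space p) : vecZdJ X = zcSum (rotate wittF) X := by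
  rw [zcSum_apply, sum_quaternionic, vecZdJ]
  refine Finset.sum_congr rfl fun j _ => ?_
  rw [rotate_fstIdx, rotate_sndIdx, smul_neg]
  abel

theorem sum_smul_anticomm (α β : Fin (2 * p) → ℂ) (w w' : Fin (2 * p) → Cl p) :
    (∑ k, α k • w k) * (∑ l, β l • w' l) + (∑ l, β l • w' l) * (∑ k, α k • w k) =
      ∑ k, ∑ l, (α k * β l) • (w k * w' l + w' l * w k) := by
  rw [Finset.sum_mul_sum, Finset.sum_mul_sum,
    Finset.sum_comm (f := fun l k => β l • w' l * α k • w k), ← Finset.sum_add_distrib]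
  refine Finset.sum_congr rfl fun k _ => ?_
  rw [← Finset.sum_add_distrib]
  refine Finset.sum_congr rfl fun l _ => ?_
  simp only [smul_mul_assoc, mul_smul_comm]
  module

/-- Off-diagonal terms cancel by anticommutation and the diagonal leaves `∑ z_k z_k^c`. This is the
hypothesis `∑ a b = κ |x|²` of the Cauchy formula. -/
theorem IsWittBasis.zSum_zcSum {w w' : Fin (2 * p) → Cl p} (h : IsWittBasis w w') (X : Space p) :
    zSum w X * zcSum w' X + zcSum w' X * zSum w X = (‖X‖ ^ 2) • (1 : Cl p) := by
  rw [zSum_apply, zcSum_apply, sum_smul_anticomm]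
  simp only [h.anticomm_dual, smul_ite, smul_zero, Finset.sum_ite_eq, Finset.mem_univ, if_true]
  rw [← Finset.sum_smul, sum_zCoord_mul_zcCoord]
  exact Complex.coe_smul _ _

/-- Twice the square is a combination of anticommutators, all zero. Such isotropic symbols produce
the single-term identities. -/
theorem sum_smul_mul_self {w : Fin (2 * p) → Cl p} (h : ∀ k l, w k * w l + w l * w k = 0)
    (α : Fin (2 * p) → ℂ) : (∑ k, α k • w k) * (∑ k, α k • w k) = 0 := by
  have h2 := sum_smul_anticomm α α w w
  simp only [h, smul_zero, Finset.sum_const_zero] at h2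
  rw [← two_smul ℂ] at h2
  exact (smul_eq_zero.1 h2).resolve_left two_ne_zero

theorem zcSum_mul_self {w : Fin (2 * p) → Cl p} (h : ∀ k l, w k * w l + w l * w k = 0)
    (X : Space p) : zcSum w X * zcSum w X = 0 := by
  rw [zcSum_apply, sum_smul_mul_self h]

theorem zSum_mul_self {w : Fin (2 * p) → Cl p} (h : ∀ k l, w k * w l + w l * w k = 0)
    (X : Space p) : zSum w X * zSum w X = 0 := by
  rw [zSum_apply, sum_smul_mul_self h]

/-- The conjugate variable sends the basis vectors of `x_k` and `y_k` to `w k` and `-i w k`, and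
`∂_x - i ∂_y = 2 ∂_z`. Hence the symbol with `z^c` gives derivatives in `z`, and conversely. -/
theorem diracSymbol_zcSum (w : Fin (2 * p) → Cl p) (F : Space p → Cl p) (X : Space p) :
    diracSymbol (zcSum w) (fderiv ℝ F X) = (2 : ℂ) • ∑ k, w k * dzOp k F X := by
  rw [diracSymbol, sum_coordinates, Finset.smul_sum]
  refine Finset.sum_congr rfl fun k _ => ?_
  simp only [zcSum_apply, zcCoord_single_xIdx, zcCoord_single_yIdx, ite_smul, zero_smul,
    Finset.sum_ite_eq', Finset.mem_univ, if_true, dzOp, pd, mul_smul_comm, mul_sub, smul_mul_assoc]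
  module

theorem diracSymbol_zSum (w : Fin (2 * p) → Cl p) (F : Space p → Cl p) (X : Space p) :
    diracSymbol (zSum w) (fderiv ℝ F X) = (2 : ℂ) • ∑ k, w k * dzcOp k F X := by
  rw [diracSymbol, sum_coordinates, Finset.smul_sum]
  refine Finset.sum_congr rfl fun k _ => ?_
  simp only [zSum_apply, zCoord_single_xIdx, zCoord_single_yIdx, ite_smul, zero_smul,
    Finset.sum_ite_eq', Finset.mem_univ, if_true, dzcOp, pd, mul_smul_comm, mul_add, smul_mul_assoc]
  module

theorem diracZJ_eq (F : Space p → Cl p) (X : Space p) :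
    diracZJ F X = ∑ k, rotate wittF k * dzOp k F X := by
  rw [sum_quaternionic, diracZJ]
  refine Finset.sum_congr rfl fun j _ => ?_
  rw [rotate_fstIdx, rotate_sndIdx, neg_mul]
  abel

theorem diracZdJ_eq (F : Space p → Cl p) (X : Space p) :
    diracZdJ F X = ∑ k, rotate wittFd k * dzcOp k F X := by
  rw [sum_quaternionic, diracZdJ]
  refine Finset.sum_congr rfl fun j _ => ?_
  rw [rotate_fstIdx, rotate_sndIdx, neg_mul]
  abel

/-- The principal part of the operator `𝓔` at the point `X`. -/
def eulerSymbol (X : Space p) : (Space p →L[ℝ] Cl p) →L[ℝ] Cl p :=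
  ∑ j : Fin p,
    (zCoord (fstIdx j) X • (1 / 2 : ℂ) •
        (ContinuousLinearMap.apply ℝ (Cl p) (EuclideanSpace.single (xIdx (sndIdx j)) 1) +
          Complex.I • ContinuousLinearMap.apply ℝ (Cl p)
            (EuclideanSpace.single (yIdx (sndIdx j)) 1)) -
      zCoord (sndIdx j) X • (1 / 2 : ℂ) •
        (ContinuousLinearMap.apply ℝ (Cl p) (EuclideanSpace.single (xIdx (fstIdx j)) 1) +
          Complex.I • ContinuousLinearMap.apply ℝ (Cl p)
            (EuclideanSpace.single (yIdx (fstIdx j)) 1)))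

theorem euler_eq (F : Space p → Cl p) (X : Space p) :
    euler F X = eulerSymbol X (fderiv ℝ F X) := by
  simp [euler, eulerSymbol, dzcOp, pd, _root_.sum_apply]

theorem eulerSymbol_mul (X : Space p) (f : Space p →L[ℝ] Cl p) (t : Cl p) :
    eulerSymbol X ((ContinuousLinearMap.mul ℝ (Cl p)).flip t ∘L f) = eulerSymbol X f * t := by
  simp [eulerSymbol, _root_.sum_apply, Finset.sum_mul, sub_mul, add_mul]

/-! ### Densities of the differential forms -/

/-- The alternating sum is, up to `(-1)^j`, the `j`-th row of the adjugate applied to `ν`. The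
conjugate transpose in that adjugate is why omitting `dz_k` yields `z_k^c(ν)`. -/
theorem sum_density_hat (ν : Space p) (j : Fin (4 * p)) :
    ∑ i : Fin (4 * p), ((-1 : ℝ) ^ i.1 * ν i) •
      wedge (fun a => coframe (omitIdx j a)) (fun a => EuclideanSpace.single (omitIdx i a) 1) =
      (-1) ^ j.1 * ((-2 * Complex.I) ^ (2 * p) / 2) * (starRingEnd ℂ) (coframe j ν) := by
  have hval : ∀ i a, (omitIdx (p := p) i a).1 = if a.1 < i.1 then a.1 else a.1 + 1 := by
    intro i a
    rw [omitIdx]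
    split <;> rfl
  have hminor : ∀ i : Fin (4 * p), wedge (fun a => coframe (omitIdx j a))
      (fun a => EuclideanSpace.single (omitIdx i a) 1) =
      (-1) ^ (i.1 + j.1) * ((-2 * Complex.I) ^ (2 * p) / 2) *
        (starRingEnd ℂ) (coframe j (EuclideanSpace.single i 1)) := by
    intro i
    have h := adjugate_eq_det_submatrix (coframeMatrix p) i j (omitIdx i) (omitIdx j)
      (hval i) (hval j)
    rw [adjugate_coframeMatrix] at h
    have hw : wedge (fun a => coframe (omitIdx j a))
        (fun a => EuclideanSpace.single (omitIdx i a) 1) =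
        ((coframeMatrix p).submatrix (omitIdx i) (omitIdx j)).det := rfl
    have hs : ((-1 : ℂ) ^ (i.1 + j.1)) * (-1) ^ (i.1 + j.1) = 1 := by
      rw [← mul_pow]; simp
    simp only [Matrix.smul_apply, Matrix.conjTranspose_apply, smul_eq_mul, coframeMatrix,
      Matrix.of_apply, RCLike.star_def] at h
    rw [hw, coframeMatrix]
    linear_combination (-(-1 : ℂ) ^ (i.1 + j.1)) * h -
      (Matrix.submatrix (Matrix.of fun i j => coframe j (EuclideanSpace.single i 1)) (omitIdx i)
        (omitIdx j)).det * hs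
  have hν : coframe j ν = ∑ i, (ν i : ℂ) * coframe j (EuclideanSpace.single i 1) := by
    conv_lhs => rw [← sum_smul_single ν]
    simp [_root_.map_sum]
  rw [hν, _root_.map_sum, Finset.mul_sum]
  refine Finset.sum_congr rfl fun i _ => ?_
  rw [hminor, map_mul, Complex.conj_ofReal, Complex.real_smul]
  have hs : ((-1 : ℂ) ^ i.1) * (-1) ^ i.1 = 1 := by
    rw [← mul_pow]; simp
  push_cast
  rw [pow_add]
  linear_combination (ν i * (-1) ^ j.1 * ((-2 * Complex.I) ^ (2 * p) / 2) *
        (starRingEnd ℂ) (coframe j (EuclideanSpace.single i 1))) * hs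

theorem density_mulForm (a b : Cl p) (η : Form p (Cl p)) (ν : Space p) :
    density (mulForm a η b) ν = a * (density η ν * b) := by
  simp only [density, Finset.sum_mul, Finset.mul_sum, smul_mul_assoc, mul_smul_comm]
  rfl

theorem density_add (η θ : Form p (Cl p)) (ν : Space p) :
    density (η + θ) ν = density η ν + density θ ν := by
  simp [density, Finset.sum_add_distrib]

theorem density_smul (c : ℂ) (η : Form p (Cl p)) (ν : Space p) :
    density (c • η) ν = c • density η ν := by
  simp only [density, Finset.smul_sum]
  refine Finset.sum_congr rfl fun i _ => ?_
  rw [smul_comm]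
  rfl

theorem density_sum_clForm (w : Fin (2 * p) → Cl p) (η : Fin (2 * p) → Form p ℂ) (ν : Space p) :
    density (∑ k, clForm (w k) (η k)) ν = ∑ k, (∑ i : Fin (4 * p), ((-1 : ℝ) ^ i.1 * ν i) •
      η k fun a => EuclideanSpace.single (omitIdx i a) 1) • w k := by
  have hsum : ∀ v, (∑ k, clForm (w k) (η k)) v = ∑ k, η k v • w k := fun v =>
    _root_.map_sum (AddMonoidHom.mk' (fun θ : Form p (Cl p) => θ v) fun _ _ => rfl) _ _
  simp only [density, Finset.sum_smul, hsum, Finset.smul_sum]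
  rw [Finset.sum_comm]
  refine Finset.sum_congr rfl fun k _ => Finset.sum_congr rfl fun i _ => ?_
  rw [smul_assoc]

theorem density_hatDz (w : Fin (2 * p) → Cl p) (ν : Space p) :
    density (∑ k, clForm (w k) (hatDz k)) ν = ((-2 * Complex.I) ^ (2 * p) / 2) • zcSum w ν := by
  rw [density_sum_clForm, zcSum_apply, Finset.smul_sum]
  refine Finset.sum_congr rfl fun k _ => ?_
  rw [hatDz, sum_density_hat, coframe_xIdx, conj_zCoord, smul_smul]
  simp [xIdx]

/-- The omitted `dz_k^c` has odd position, which gives a sign `-1`; the minus sign in front of the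
sum compensates it. -/
theorem density_hatDzc (w : Fin (2 * p) → Cl p) (ν : Space p) :
    density (-∑ k, clForm (w k) (hatDzc k)) ν = ((-2 * Complex.I) ^ (2 * p) / 2) • zSum w ν := by
  rw [← neg_one_smul ℂ (∑ k, _), density_smul, density_sum_clForm, zSum_apply, Finset.smul_sum,
    Finset.smul_sum]
  refine Finset.sum_congr rfl fun k _ => ?_
  rw [hatDzc, sum_density_hat, coframe_yIdx, conj_zcCoord, smul_smul, smul_smul]
  simp [yIdx, pow_succ]

theorem density_dσ (ν : Space p) :
    density dσ ν = ((-2 * Complex.I) ^ (2 * p) / 2) • zcSum wittFd ν :=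
  density_hatDz _ _

theorem density_dσd (ν : Space p) :
    density dσd ν = ((-2 * Complex.I) ^ (2 * p) / 2) • zSum wittF ν :=
  density_hatDzc _ _

theorem clForm_neg (c : Cl p) (η : Form p ℂ) : clForm (-c) η = -clForm c η := by
  ext v
  exact smul_neg (η v) c

theorem density_dσJ (ν : Space p) :
    density dσJ ν = ((-2 * Complex.I) ^ (2 * p) / 2) • zcSum (rotate wittF) ν := by
  rw [← density_hatDz, sum_quaternionic, dσJ]
  congr 1
  refine Finset.sum_congr rfl fun j _ => ?_
  rw [rotate_fstIdx, rotate_sndIdx, clForm_neg]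
  abel

theorem density_dσdJ (ν : Space p) :
    density dσdJ ν = ((-2 * Complex.I) ^ (2 * p) / 2) • zSum (rotate wittFd) ν := by
  rw [← density_hatDzc, sum_quaternionic, dσdJ]
  congr 2
  refine Finset.sum_congr rfl fun j _ => ?_
  rw [rotate_fstIdx, rotate_sndIdx, clForm_neg]
  abel

end OspMonogenic
end

noncomputable section

namespace OspMonogenic

open MeasureTheory MeasureTheory.Measure Filter Topology Set
open scoped ENNReal NNReal

/-! ### Boundary integrals -/

variable {p : ℕ} {D Ω : Set (Space p)}

theorem IsLocalDefiningFunction.isDefiningFunctionAt {x : Space p} {U : Set (Space p)}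
    {ρ : Space p → ℝ} (h : IsLocalDefiningFunction D x U ρ) : IsDefiningFunctionAt D x U ρ :=
  ⟨h.isOpen, h.mem, contDiffOn_infty.1 h.contDiffOn 2, h.gradient_ne_zero, h.inter_eq⟩

theorem IsSmoothBoundedDomain.isC2Domain (hD : IsSmoothBoundedDomain D) :
    IsC2Domain D (outwardNormal D) := by
  refine ⟨hD.isOpen, hD.isBounded, fun x hx => ?_, fun x hx U ρ h => ?_⟩
  · obtain ⟨U, ρ, h⟩ := hD.smooth_boundary x hx
    exact ⟨U, ρ, h.isDefiningFunctionAt⟩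
  · obtain ⟨U₀, ρ₀, h₀⟩ := hD.smooth_boundary x hx
    have hex : ∃ ν, IsOutwardUnitNormal D x ν := ⟨_, U₀, ρ₀, h₀, rfl⟩
    rw [outwardNormal, dif_pos hex]
    obtain ⟨U₁, ρ₁, h₁, heq⟩ := hex.choose_spec
    rw [heq]
    -- `outwardNormal` comes from an arbitrary choice of defining function, which uniqueness makes
    -- irrelevant.
    exact h₁.isDefiningFunctionAt.normal_unique h hD.isOpen hx

theorem sphereArea_eq (hp : 1 ≤ p) : sphereArea p = kernelMass (4 * p) (2 * p) :=
  kernelMass_eq_sphere (by omega) (by omega)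

/-- The resulting factor `2` offsets the `1 / 2` in the densities of the forms. -/
theorem two_div_sphereArea_mul (hp : 1 ≤ p) :
    2 / sphereArea p * kernelMass (4 * p) (2 * p) = 2 := by
  rw [sphereArea_eq hp]
  exact div_mul_cancel₀ _ (kernelMass_pos (by omega) (by omega)).ne'

theorem cauchyKernel_smul (a : Space p →L[ℝ] Cl p) (X : Space p) :
    cauchyKernel (2 * p) 0 ((2 / sphereArea p) • a) X =
      (2 / sphereArea p / ‖X‖ ^ (4 * p)) • a X := by
  have h : (‖X‖ ^ 2) ^ (2 * p) = ‖X‖ ^ (4 * p) := by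
    rw [← pow_mul]
    congr 1
    ring
  rw [cauchyKernel, radialFactor, add_zero, h, _root_.smul_apply, smul_smul, mul_comm,
    ← div_eq_mul_inv]

theorem kerE_eq : kerE (p := p) = cauchyKernel (2 * p) 0 ((2 / sphereArea p) • zSum wittF) := by
  funext X
  rw [cauchyKernel_smul, kerE, vecZ_eq]

theorem kerEd_eq :
    kerEd (p := p) = cauchyKernel (2 * p) 0 ((2 / sphereArea p) • zcSum wittFd) := by
  funext X
  rw [cauchyKernel_smul, kerEd, vecZd_eq]

theorem kerEJ_eq :
    kerEJ (p := p) = cauchyKernel (2 * p) 0 ((2 / sphereArea p) • zSum (rotate wittFd)) := by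
  funext X
  rw [cauchyKernel_smul, kerEJ, vecZJ_eq]

theorem kerEdJ_eq :
    kerEdJ (p := p) = cauchyKernel (2 * p) 0 ((2 / sphereArea p) • zcSum (rotate wittF)) := by
  funext X
  rw [cauchyKernel_smul, kerEdJ, vecZdJ_eq]

/-! ### The Cauchy formula for Witt bases and for isotropic symbols -/

section Formulae

variable {g : Space p → Cl p} {X : Space p}

/-- The two-term representation formula for a Witt basis and the corresponding identity for the
operator `𝓔`. -/
theorem IsWittBasis.boundary_integrals {w w' : Fin (2 * p) → Cl p} (hw : IsWittBasis w w')
    (hp : 1 ≤ p) (hD : IsSmoothBoundedDomain D) (hΩ : IsOpen Ω) (hDΩ : closure D ⊆ Ω)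
    (hg : ∀ x ∈ Ω, DifferentiableAt ℝ g x)
    (hdirac : ∀ x ∈ Ω, ∑ k, w' k * dzOp k g x = 0)
    (hdirac' : ∀ x ∈ Ω, ∑ k, w k * dzcOp k g x = 0) (hX : X ∈ D) (heuler : euler g X = 0)
    {η η' : Form p (Cl p)}
    (hη : ∀ ν, density η ν = ((-2 * Complex.I) ^ (2 * p) / 2) • zcSum w' ν)
    (hη' : ∀ ν, density η' ν = ((-2 * Complex.I) ^ (2 * p) / 2) • zSum w ν)
    {k k' : Space p → Cl p} (hk : k = cauchyKernel (2 * p) 0 ((2 / sphereArea p) • zSum w))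
    (hk' : k' = cauchyKernel (2 * p) 0 ((2 / sphereArea p) • zcSum w')) :
    HasBoundaryIntegral D (fun Y => (1 / (-2 * Complex.I) ^ (2 * p) : ℂ) •
        (mulForm (k (Y - X)) η (g Y) + mulForm (k' (Y - X)) η' (g Y))) (g X) ∧
      HasBoundaryIntegral D
        (fun Y => mulForm (euler (fun X' => k (Y - X')) X) η (g Y) +
          mulForm (euler (fun X' => k' (Y - X')) X) η' (g Y)) 0 := by
  have hC := hD.isC2Domain
  have hI : (-2 * Complex.I) ^ (2 * p) ≠ 0 := by simp
  set c := (-2 * Complex.I) ^ (2 * p) with hc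
  -- Each kernel is paired with the dual symbol, so that the two products add up to an
  -- anticommutator, with `κ = 2 / a_{4p}`.
  set a : Fin 2 → Space p →L[ℝ] Cl p :=
    ![(2 / sphereArea p) • zSum w, (2 / sphereArea p) • zcSum w'] with ha
  set b : Fin 2 → Space p →L[ℝ] Cl p := ![zcSum w', zSum w] with hb
  have hab : ∀ x, ∑ l, a l x * b l x = (2 / sphereArea p * ‖x‖ ^ 2) • (1 : Cl p) := fun x => by
    simp only [ha, hb, Fin.sum_univ_two, Matrix.cons_val_zero, Matrix.cons_val_one,
      _root_.smul_apply, smul_mul_assoc]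
    rw [← smul_add, hw.zSum_zcSum, smul_smul]
  have hdir : ∀ l, ∀ x ∈ Ω, diracSymbol (b l) (fderiv ℝ g x) = 0 := by
    intro l x hx
    fin_cases l
    · simp [hb, diracSymbol_zcSum, hdirac x hx]
    · simp [hb, diracSymbol_zSum, hdirac' x hx]
  have hT : ∀ l, IntegrableOn (fun Y => b l (outwardNormal D Y) * g Y) (frontier D)
      μHE[4 * p - 1] := fun l =>
    hC.integrableOn_normal_mul (by omega) hΩ hDΩ hg (hdir l)
  have hint : IntegrableOn (fun Y => ∑ l, cauchyKernel (2 * p) 0 (a l) (Y - X) *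
      (b l (outwardNormal D Y) * g Y)) (frontier D) μHE[4 * p - 1] :=
    integrable_finsetSum _ fun l _ => hC.integrableOn_kernel_mul le_rfl (a l) hX (hT l)
  have hval := hC.cauchy_formula (q := 2 * p) (by omega) (by omega) hΩ hDΩ hab hg hdir hX
  obtain ⟨hint', hval'⟩ := hC.cauchy_formula_derivation (q := 2 * p) (by omega) (by omega) hΩ hDΩ
    hab hg hdir hX (eulerSymbol X) (eulerSymbol_mul X) (by rw [← euler_eq, heuler])
  -- The factor `c / 2` of the densities meets the normalization `1 / c` and leaves `1 / 2`.
  have hd : ∀ Y, density ((1 / c) • (mulForm (k (Y - X)) η (g Y) + mulForm (k' (Y - X)) η' (g Y)))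
      (outwardNormal D Y) = (1 / 2 : ℂ) • ∑ l, cauchyKernel (2 * p) 0 (a l) (Y - X) *
        (b l (outwardNormal D Y) * g Y) := fun Y => by
    rw [density_smul, density_add, density_mulForm, density_mulForm, hη, hη', hk, hk']
    simp only [ha, hb, Fin.sum_univ_two, Matrix.cons_val_zero, Matrix.cons_val_one,
      smul_mul_assoc, mul_smul_comm]
    rw [← smul_add, smul_smul]
    congr 1
    field_simp
  have hd' : ∀ Y, density (mulForm (euler (fun X' => k (Y - X')) X) η (g Y) +
      mulForm (euler (fun X' => k' (Y - X')) X) η' (g Y)) (outwardNormal D Y) =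
      (c / 2) • ∑ l, eulerSymbol X (fderiv ℝ (fun X' => cauchyKernel (2 * p) 0 (a l) (Y - X')) X) *
        (b l (outwardNormal D Y) * g Y) := fun Y => by
    rw [density_add, density_mulForm, density_mulForm, hη, hη', hk, hk', euler_eq, euler_eq]
    simp only [ha, hb, Fin.sum_univ_two, Matrix.cons_val_zero, Matrix.cons_val_one,
      smul_mul_assoc, mul_smul_comm]
    rw [← smul_add]
  constructor
  · simp only [HasBoundaryIntegral, hd]
    refine ⟨hint.smul (1 / 2 : ℂ), ?_⟩
    rw [integral_smul, hval, two_div_sphereArea_mul hp, ← Complex.coe_smul, smul_smul]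
    norm_num
  · simp only [HasBoundaryIntegral, hd']
    refine ⟨hint'.smul (c / 2), ?_⟩
    rw [integral_smul, hval', smul_zero]

/-- The single-term identity for a symbol with square zero. -/
theorem hasBoundaryIntegral_of_mul_self (hp : 1 ≤ p) (hD : IsSmoothBoundedDomain D)
    (hΩ : IsOpen Ω) (hDΩ : closure D ⊆ Ω) (hg : ∀ x ∈ Ω, DifferentiableAt ℝ g x)
    {b : Space p →L[ℝ] Cl p} (hb : ∀ x, b x * b x = 0)
    (hdirac : ∀ x ∈ Ω, diracSymbol b (fderiv ℝ g x) = 0) (hX : X ∈ D) {η : Form p (Cl p)} {c : ℂ}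
    (hη : ∀ ν, density η ν = c • b ν) {k : Space p → Cl p}
    (hk : k = cauchyKernel (2 * p) 0 ((2 / sphereArea p) • b)) :
    HasBoundaryIntegral D (fun Y => mulForm (k (Y - X)) η (g Y)) 0 := by
  have hC := hD.isC2Domain
  have hT : IntegrableOn (fun Y => b (outwardNormal D Y) * g Y) (frontier D) μHE[4 * p - 1] :=
    hC.integrableOn_normal_mul (by omega) hΩ hDΩ hg hdirac
  have hint := hC.integrableOn_kernel_mul (q := 2 * p) le_rfl ((2 / sphereArea p) • b) hX hT
  -- A single pair with `a` a multiple of `b`: the product vanishes, so `κ = 0` and the Cauchy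
  -- integral is zero.
  have hval := hC.cauchy_formula (q := 2 * p) (ι := Unit) (a := fun _ => (2 / sphereArea p) • b)
    (b := fun _ => b) (κ := 0) (by omega) (by omega) hΩ hDΩ (fun x => by simp [hb]) hg
    (fun _ => hdirac) hX
  simp only [Finset.univ_unique, Finset.sum_singleton, zero_mul, zero_smul] at hval
  simp only [HasBoundaryIntegral, density_mulForm, hη, hk, smul_mul_assoc, mul_smul_comm]
  refine ⟨hint.smul c, ?_⟩
  rw [integral_smul, hval, smul_zero]

end Formulae

end OspMonogenic
end

/-! ### Assembly of the six identities -/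

theorem mainTheorem1 (p : ℕ) (hp : 1 ≤ p) (D Ω : Set (Space p)) (g : Space p → Cl p)
    (hD : IsSmoothBoundedDomain D) (hΩ : IsOpen Ω) (hDΩ : closure D ⊆ Ω)
    (hg : IsOspMonogenic g Ω) :
    ∀ X ∈ interior D,
      -- the two representation formulae
      HasBoundaryIntegral D
        (fun Y => (1 / (-2 * Complex.I) ^ (2 * p) : ℂ) •
          (mulForm (kerE (Y - X)) dσ (g Y) + mulForm (kerEd (Y - X)) dσd (g Y)))
        (g X) ∧
      HasBoundaryIntegral D
        (fun Y => (1 / (-2 * Complex.I) ^ (2 * p) : ℂ) •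
          (mulForm (kerEJ (Y - X)) dσJ (g Y) + mulForm (kerEdJ (Y - X)) dσdJ (g Y)))
        (g X) ∧
      -- the two single-term identities
      HasBoundaryIntegral D (fun Y => mulForm (kerEd (Y - X)) dσ (g Y)) 0 ∧
      HasBoundaryIntegral D (fun Y => mulForm (kerEJ (Y - X)) dσdJ (g Y)) 0 ∧
      -- the two identities with the Euler operator, acting on the kernels in the variable `X`
      HasBoundaryIntegral D
        (fun Y => mulForm (euler (fun X' => kerE (Y - X')) X) dσ (g Y) +
          mulForm (euler (fun X' => kerEd (Y - X')) X) dσd (g Y)) 0 ∧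
      HasBoundaryIntegral D
        (fun Y => mulForm (euler (fun X' => kerEJ (Y - X')) X) dσJ (g Y) +
          mulForm (euler (fun X' => kerEdJ (Y - X')) X) dσdJ (g Y)) 0 := by
  intro X hX
  rw [hD.isOpen.interior_eq] at hX
  have hgd : ∀ x ∈ Ω, DifferentiableAt ℝ g x := fun x hx =>
    hg.differentiableOn.differentiableAt (hΩ.mem_nhds hx)
  have heuler := hg.euler_eq_zero X (hDΩ (subset_closure hX))
  have hJ : ∀ x ∈ Ω, ∑ k, rotate wittF k * dzOp k g x = 0 := fun x hx => by
    rw [← diracZJ_eq, hg.diracZJ_eq_zero x hx]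
  have hdJ : ∀ x ∈ Ω, ∑ k, rotate wittFd k * dzcOp k g x = 0 := fun x hx => by
    rw [← diracZdJ_eq, hg.diracZdJ_eq_zero x hx]
  obtain ⟨h1, h5⟩ := isWittBasis_wittF.boundary_integrals hp hD hΩ hDΩ hgd hg.diracZ_eq_zero
    hg.diracZd_eq_zero hX heuler density_dσ density_dσd kerE_eq kerEd_eq
  -- `z^J` pairs the coordinates `z_k` with the vectors `𝔣†`, so the two families exchange roles
  -- before the rotation.
  obtain ⟨h2, h6⟩ := isWittBasis_wittF.symm.rotate.boundary_integrals hp hD hΩ hDΩ hgd hJ hdJ hX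
    heuler density_dσJ density_dσdJ kerEJ_eq kerEdJ_eq
  refine ⟨h1, h2, ?_, ?_, h5, h6⟩
  -- `E†` and `dσ_z` both carry the isotropic symbol `z†`; in the last identity, `E^J` and
  -- `dσ_{z^{†J}}` both carry `z^J`.
  · refine hasBoundaryIntegral_of_mul_self hp hD hΩ hDΩ hgd
      (zcSum_mul_self isWittBasis_wittF.anticomm') (fun x hx => ?_) hX density_dσ kerEd_eq
    rw [diracSymbol_zcSum]
    exact (congrArg _ (hg.diracZ_eq_zero x hx)).trans (smul_zero _)
  · refine hasBoundaryIntegral_of_mul_self hp hD hΩ hDΩ hgd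
      (zSum_mul_self isWittBasis_wittF.symm.rotate.anticomm) (fun x hx => ?_) hX density_dσdJ
      kerEJ_eq
    rw [diracSymbol_zSum, hdJ x hx, smul_zero]
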